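/- Let $0<\alpha<1$, $k=\lceil 2\alpha\rceil$, $2\alpha-\lceil 2\alpha\rceil+1\le\gamma\le 1$, $\eta>0$, $\rho>0$, and $\theta_1,\dots,\theta_N\in\mathbb R$. Write $v^\perp=(v_2,-v_1)$. **Patch solutions.** Let $T>0$. For $t\in[0,T)$ let $\Omega_1(t),\dots,\Omega_N(t)\subset\mathbb R^2$ be bounded open sets whose boundaries are pairwise disjoint simple closed $C^1$ curves; let $x_i(\cdot,t)$ be the (periodic) arc length parametrization of $\partial\Omega_i(t)$ and $L_i(t)$ its length. Put $\partial\Omega(t)=\bigcup_i\partial\Omega_i(t)$, $\omega(\cdot,t)=\sum_i\theta_i\chi_{\Omega_i(t)}$, and for $z\in\partial\Omega(t)$ with unit normal $n$ put $u_n(z,t)=\Big(\mathrm{P.V.}\int_{\mathbb R^2}\frac{(z-y)^\perp\cdot n}{|z-y|^{2+2\alpha}}\,\omega(y,t)\,dy\Big)n$. With $d_H$ the Hausdorff distance, $\omega$ is a patch solution of the $\alpha$-SQG equation on $[0,T)$ if each $\partial\Omega_i(t)$ is continuous in $t$ with respect to $d_H$ and, for every $t\in[0,T)$, $$\lim_{h\to0+}\frac1h\,d_H\big(\partial\Omega(t+h),\{z+h\,u_n(z,t):z\in\partial\Omega(t)\}\big)=0.$$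 It is a $C^{k,\gamma}$ patch solution if moreover the $x_i(\cdot,t)$ are $C^k$ and $$\|\partial\Omega(t)\|_{C^{k,\gamma}}=\max_j\Big(\sum_{l=0}^k\|\partial_s^lx_j(\cdot,t)\|_\infty+\sup_{s\ne r}\frac{|\partial_s^kx_j(s,t)-\partial_s^kx_j(r,t)|}{|s-r|^\gamma}\Big)$$ is bounded on every interval $[0,T']$ with $T'<T$. **Separation distance.** Assume $2\eta\le L_i(t)$ for all $i$ and $t$. Call $(p,q)$ a competing pair at time $t$ if $p\in\partial\Omega_i(t)$ and $q\in\partial\Omega_j(t)$ for some $i\neq j$, or if $p,q$ lie on the same curve $\partial\Omega_i(t)$ at distance at least $\eta$ along this closed curve. Let $d(t)$ be the minimum of $|p-q|$ over all competing pairs. (So $d=\min_{i,j}d_{ij}$, where, for $i\ne j$, $d_{ij}(t)=\mathrm{dist}(\partial\Omega_i(t),\partial\Omega_j(t))$, which is $\mathrm{dist}(\Omega_i(t),\Omega_j(t))$ if the two patches are disjoint, and $d_{ii}(t)=\min_{|s-r|\ge\eta}|x_i(s,t)-x_i(r,t)|$ with $|s-r|$ measured modulo $L_i(t)$.) **Admissible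 pairs.** Let $r(t)=\frac14\min\big(\rho,(100\,\|\partial\Omega(t)\|_{C^{k,\gamma}})^{-1/(k+\gamma-1)}\big)$. A pair $p,q\in\partial\Omega(t)$ is admissible at time $t$ if, with $r=r(t)$, the set $\partial\Omega(t)\cap(B_{2r}(p)\cup B_{2r}(q))$ consists of two disjoint curves $\mathcal C_1\ni p$ and $\mathcal C_2\ni q$, and $|p-q|=\mathrm{dist}(\mathcal C_1,\mathcal C_2)$. **Theorem.** There is a constant $C>0$ depending only on $\alpha,k,\gamma,\eta,\rho$ and $\theta_1,\dots,\theta_N$ such that the following holds. Let $\omega$ be a $C^{k,\gamma}$ patch solution on $[0,T)$ with $2\eta\le L_i(t)$ for all $i,t$, and suppose that there is $c>0$ with $|x_i(s,t)-x_i(r,t)|\ge c|s-r|$ for all $t\in[0,T)$, all $i$ and all $s,r$ with $|s-r|\le\eta$. Suppose that for almost every $t\in[0,T)$ every competing pair $(p,q)$ with $|p-q|=d(t)$ is admissible. Then for all $t\in[0,T]$ $$d(t)\ \ge\ d(0)\exp\Big(-C\int_0^t\|\partial\Omega(t')\|_{C^{k,\gamma}}^{\frac{k+2\alpha-1}{k+\gamma-1}}\,dt'\Big),$$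 where $d(T)$ stands for $\liminf_{t\to T-}d(t)$, and the exponential is $0$ if the integral is infinite. In particular, if $\alpha\le\frac12$ (so $k=1$) and $\|\partial\Omega(t)\|_{C^{1,1}}\le K$ for all $t\in[0,T)$ (bounded curvature), then $d(t)\ge d(0)\exp\big(-C\,K^{\frac{k+2\alpha-1}{k+\gamma-1}}\,t\big)$ for all $t\in[0,T)$. -/

import Mathlib

open Set Filter Topology MeasureTheory
open scoped ENNReal

noncomputable section

namespace SQGPatch

/-- The Euclidean plane. -/
abbrev Plane : Type := EuclideanSpace ℝ (Fin 2)

/-- The rotation `v^⊥ = (v₂, -v₁)`, with the convention of `∇^⊥ = (∂₂, -∂₁)`. -/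
def perp (v : Plane) : Plane := !₂[v 1, -v 0]

/-- `x` is an arc length parametrization of the simple closed `C¹` curve `Γ` of length `L`,
extended `L`-periodically to the whole line. -/
structure IsArcLengthParam (x : ℝ → Plane) (L : ℝ) (Γ : Set Plane) : Prop where
  length_pos : 0 < L
  contDiff : ContDiff ℝ 1 x
  unit_speed : ∀ s, ‖deriv x s‖ = 1
  periodic : Function.Periodic x L
  injOn : InjOn x (Ico 0 L)
  range_eq : range x = Γ

/-- The patch function `ω(y, t) = ∑ θ_i χ_{Ω_i(t)}(y)`. -/
def vorticity {N : ℕ} (θ : Fin N → ℝ) (Ω : Fin N → ℝ → Set Plane) (t : ℝ) (y : Plane) : ℝ :=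
  ∑ i, (Ω i t).indicator (fun _ => θ i) y

/-- The component in the direction `n` of the velocity generated by `ω` at the point `z`: the
inner product with `n` is taken first, then the principal value of the integral,
`P.V. ∫ ((z - y)^⊥ · n) / |z - y|^{2 + 2α} ω(y) dy`. -/
def velocityComponent (α : ℝ) (ω : Plane → ℝ) (z n : Plane) : ℝ :=
  limUnder (𝓝[>] (0 : ℝ)) fun ε : ℝ =>
    ∫ y in {y : Plane | ε < ‖z - y‖}, inner ℝ (perp (z - y)) n / ‖z - y‖ ^ (2 + 2 * α) * ω y

/-- The unit normal at the point with parameter `s` of a curve parametrized by arc length. -/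
def unitNormal (x : ℝ → Plane) (s : ℝ) : Plane := perp (deriv x s)

/-- The normal velocity `u_n = (u · n) n` at the point `x s` of a boundary curve. It does not
depend on the choice between the two unit normals. -/
def normalVelocity (α : ℝ) (ω : Plane → ℝ) (x : ℝ → Plane) (s : ℝ) : Plane :=
  velocityComponent α ω (x s) (unitNormal x s) • unitNormal x s

/-- `∂Ω(t)`, the union of the boundaries of the patches. -/
def totalBoundary {N : ℕ} (Ω : Fin N → ℝ → Set Plane) (t : ℝ) : Set Plane :=
  ⋃ i, frontier (Ω i t)

/-- `X^h_{u_n(·,t)}[∂Ω(t)] = {z + h u_n(z, t) : z ∈ ∂Ω(t)}`; here `x i t` is an arc length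
parametrization of `∂Ω_i(t)`. -/
def transportedBoundary {N : ℕ} (α : ℝ) (θ : Fin N → ℝ) (Ω : Fin N → ℝ → Set Plane)
    (x : Fin N → ℝ → ℝ → Plane) (t h : ℝ) : Set Plane :=
  ⋃ i, range fun s => x i t s + h • normalVelocity α (vorticity θ Ω t) (x i t) s

/-- `Ω` is a patch solution of the `α`-SQG equation on `[0, T)` with couplings `θ`; the curve
`∂Ω_i(t)` has length `L i t` and arc length parametrization `x i t`. -/
structure IsPatchSolution {N : ℕ} (α T : ℝ) (θ : Fin N → ℝ) (Ω : Fin N → ℝ → Set Plane)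
    (x : Fin N → ℝ → ℝ → Plane) (L : Fin N → ℝ → ℝ) : Prop where
  isOpen : ∀ i, ∀ t ∈ Ico 0 T, IsOpen (Ω i t)
  isBounded : ∀ i, ∀ t ∈ Ico 0 T, Bornology.IsBounded (Ω i t)
  param : ∀ i, ∀ t ∈ Ico 0 T, IsArcLengthParam (x i t) (L i t) (frontier (Ω i t))
  disjoint : ∀ t ∈ Ico 0 T, ∀ i j, i ≠ j → Disjoint (frontier (Ω i t)) (frontier (Ω j t))
  continuous : ∀ i, ∀ t ∈ Ico 0 T,
    Tendsto (fun τ => Metric.hausdorffEDist (frontier (Ω i τ)) (frontier (Ω i t)))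
      (𝓝[Ico 0 T] t) (𝓝 0)
  evolution : ∀ t ∈ Ico 0 T,
    Tendsto (fun h : ℝ => Metric.hausdorffEDist (totalBoundary Ω (t + h))
      (transportedBoundary α θ Ω x t h) / ENNReal.ofReal h) (𝓝[>] 0) (𝓝 0)

/-- `‖∂Ω(t)‖_{C^{k,γ}} = max_j (∑_{l ≤ k} ‖∂_s^l x_j‖_∞
  + sup_{s ≠ r} |∂_s^k x_j(s) - ∂_s^k x_j(r)| / |s - r|^γ)`, possibly infinite. -/
def boundaryNorm {N : ℕ} (k : ℕ) (γ : ℝ) (x : Fin N → ℝ → ℝ → Plane) (t : ℝ) : ℝ≥0∞ :=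
  ⨆ j, ((∑ l ∈ Finset.range (k + 1), ⨆ s, ‖iteratedDeriv l (x j t) s‖ₑ) +
    ⨆ (s : ℝ) (r : ℝ) (_ : s ≠ r),
      ‖iteratedDeriv k (x j t) s - iteratedDeriv k (x j t) r‖ₑ / ENNReal.ofReal (|s - r| ^ γ))

/-- A `C^{k,γ}` patch solution: the boundary curves are `C^k`, with `C^{k,γ}` norms bounded on
every compact time interval in `[0, T)`. -/
structure IsHolderPatchSolution {N : ℕ} (k : ℕ) (γ α T : ℝ) (θ : Fin N → ℝ)
    (Ω : Fin N → ℝ → Set Plane) (x : Fin N → ℝ → ℝ → Plane) (L : Fin N → ℝ → ℝ) : Prop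
    extends IsPatchSolution α T θ Ω x L where
  contDiff_param : ∀ i, ∀ t ∈ Ico 0 T, ContDiff ℝ k (x i t)
  norm_bounded : ∀ T' < T, (⨆ t ∈ Icc 0 T', boundaryNorm k γ x t) < ∞

/-- The local arc-chord condition at scale `η`. -/
def LocalArcChord {N : ℕ} (η T : ℝ) (x : Fin N → ℝ → ℝ → Plane) : Prop :=
  ∃ c > 0, ∀ t ∈ Ico 0 T, ∀ i, ∀ s r : ℝ, |s - r| ≤ η → c * |r - s| ≤ ‖x i t s - x i t r‖

/-- The pairs of boundary points that compete in the separation distance: points of two different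
boundary curves, or points of the same curve whose distance along that (closed) curve, i.e. whose
parameter distance modulo the length of the curve, is at least `η`. -/
def competingPairs {N : ℕ} (η : ℝ) (Ω : Fin N → ℝ → Set Plane) (x : Fin N → ℝ → ℝ → Plane)
    (L : Fin N → ℝ → ℝ) (t : ℝ) : Set (Plane × Plane) :=
  {z | (∃ i j, i ≠ j ∧ z.1 ∈ frontier (Ω i t) ∧ z.2 ∈ frontier (Ω j t)) ∨
    ∃ i, ∃ s r : ℝ, (∀ m : ℤ, η ≤ |s - r + m * L i t|) ∧ z = (x i t s, x i t r)}

/-- The separation distance `d(t) = min_{i,j} d_{ij}(t)`. For `i ≠ j` the distance of the curves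
`∂Ω_i` and `∂Ω_j` is the distance of the patches when the patches are disjoint. -/
def separation {N : ℕ} (η : ℝ) (Ω : Fin N → ℝ → Set Plane) (x : Fin N → ℝ → ℝ → Plane)
    (L : Fin N → ℝ → ℝ) (t : ℝ) : ℝ≥0∞ :=
  ⨅ z ∈ competingPairs η Ω x L t, edist z.1 z.2

/-- The radius `r(t) = (1/4) min (ρ, (100 ‖∂Ω(t)‖_{C^{k,γ}})^{-1/(k+γ-1)})`. -/
def localRadius {N : ℕ} (k : ℕ) (γ ρ : ℝ) (x : Fin N → ℝ → ℝ → Plane) (t : ℝ) : ℝ :=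
  1 / 4 * min ρ ((100 * (boundaryNorm k γ x t).toReal) ^ (-(1 / ((k : ℝ) + γ - 1))))

/-- `p, q` is an admissible pair of points of `Γ` (a finite disjoint union of simple closed
curves) at scale `r`. A curve contained in `Γ` is the same thing as a connected subset. -/
def IsAdmissible (Γ : Set Plane) (r : ℝ) (p q : Plane) : Prop :=
  ∃ C₁ C₂ : Set Plane, IsConnected C₁ ∧ IsConnected C₂ ∧ Disjoint C₁ C₂ ∧
    Γ ∩ (Metric.ball p (2 * r) ∪ Metric.ball q (2 * r)) = C₁ ∪ C₂ ∧ p ∈ C₁ ∧ q ∈ C₂ ∧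
    edist p q = ⨅ (y ∈ C₁) (z ∈ C₂), edist y z

/-- The exponent `(k + 2α - 1) / (k + γ - 1)`. -/
def rateExponent (k : ℕ) (α γ : ℝ) : ℝ := ((k : ℝ) + 2 * α - 1) / ((k : ℝ) + γ - 1)

/-- `exp (-a)` for `a ∈ [0, ∞]`, with value `0` at `a = ∞`. -/
def expNeg (a : ℝ≥0∞) : ℝ≥0∞ := EReal.exp (-(a : EReal))

end SQGPatch

end

noncomputable section

namespace SQGPatch

/-! ### The rotation `perp` and orthonormal frames -/

/-! Two ingredients carry the proof: an estimate in space, which bounds the relative velocity of a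
closest pair by its distance, and an argument in time, which turns that bound into a Gronwall
inequality.

Space. At an admissible pair `p`, `q` at distance `d`, minimality makes both tangents orthogonal to
`p - q`. In a frame `(τ, τ^⊥)` with `τ^⊥` along `p - q`, the two normal velocities are therefore
integrals of one kernel, based at `q` and at `q + d τ^⊥`. Averaging with the reflection in the line
through `p` and `q` replaces `ω` by its odd part, and the velocity difference becomes the integral
of `a (k(a, b - d) - k(a, b))` against that odd part (`vel_sub_vel`). Since `ω` is constant on
connected sets off the boundary, the odd part vanishes wherever a point can be joined to its mirror
image without meeting the boundary. With `β = k + γ - 1`, `M` the boundary norm and `R = M^(-1/β)`,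
at scales up to a fixed multiple of `R` it lives in two strips of height of order `|a|^(1+β)` about
two nearly parallel curves. The centre lines are straight for `k = 1` and parabolas for `k = 2`; in
the latter case the second order condition at the minimum orders the curvatures, so the gap between
the strips does not pinch (`mem_strip_of_oddPart_ne_zero`). Because `β ≥ 2α`, the strips contribute
`O(d)` at unit scale. There is no logarithm even for `β = 2α`, since heights in the strips are at
most of order `d + |a|^(1+κ)`, which gains over the bare kernel difference
(`abs_integral_kern_sub_le`). Scaling back gives `C R^(-2α) d = C M^(2α/β) d`, which is at most `C
M^((k+2α-1)/β) d` (`exists_abs_vel_sub_le`, `exists_abs_inner_normalVelocity_le`). If `d` is not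
small compared with `R`, the two velocities are bounded without using that the curves are parallel.

Time. Only Hausdorff continuity of the boundary is given, with no tracking of points. Together with
locally uniform Hölder bounds it yields convergence of arcs, tangents and lengths
(`exists_shift_limit`, `tendsto_length`), hence continuity of the separation and closedness of the
set of minimizing pairs. Points from which a minimizing pair at time `t + h` was transported need
not compete at time `t`; what is needed is a pair that is minimal among all nearby boundary points.
Admissibility provides one at almost every time and a limit argument at every time
(`exists_regularMinimizer`), which gives the Dini bound `exists_minimizer_rate`. The sharp rate is
known only almost everywhere; a crude rate, from bounded normal velocity, holds everywhere and makes
`log d + K' t` monotone, which suffices for Gronwall (`log_sub_log_le_lintegral`). The arc-chord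
condition serves only to make the normal velocity finite and continuous, so its constant does not
enter `C`. -/

lemma inner_plane (v w : Plane) : inner ℝ v w = v 0 * w 0 + v 1 * w 1 := by
  simp [PiLp.inner_apply, Fin.sum_univ_two, mul_comm]

@[simp] lemma perp_apply_zero (v : Plane) : perp v 0 = v 1 := by simp [perp]

@[simp] lemma perp_apply_one (v : Plane) : perp v 1 = -v 0 := by simp [perp]

lemma plane_ext {v w : Plane} (h0 : v 0 = w 0) (h1 : v 1 = w 1) : v = w := by
  ext i; fin_cases i <;> simpa

lemma perp_add (v w : Plane) : perp (v + w) = perp v + perp w := by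
  apply plane_ext
  · simp
  · simp; ring

lemma perp_sub (v w : Plane) : perp (v - w) = perp v - perp w := by
  simp only [sub_eq_add_neg, perp_add]
  congr 1
  apply plane_ext <;> simp

lemma perp_neg (v : Plane) : perp (-v) = -perp v := by
  apply plane_ext <;> simp

lemma perp_perp (v : Plane) : perp (perp v) = -v := by
  apply plane_ext <;> simp

lemma inner_perp_perp (v w : Plane) : inner ℝ (perp v) (perp w) = inner ℝ v w := by
  simp [inner_plane]; ring

@[simp] lemma inner_perp_self (v : Plane) : inner ℝ v (perp v) = 0 := by
  simp [inner_plane]; ring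

@[simp] lemma inner_perp_self_left (v : Plane) : inner ℝ (perp v) v = 0 := by
  simp [inner_plane]; ring

@[simp] lemma norm_perp (v : Plane) : ‖perp v‖ = ‖v‖ := by
  rw [@norm_eq_sqrt_real_inner Plane, @norm_eq_sqrt_real_inner Plane, inner_perp_perp]

lemma continuous_perp : Continuous perp := by
  unfold perp
  fun_prop

lemma sq_coord_of_norm_one {τ : Plane} (hτ : ‖τ‖ = 1) : τ 0 ^ 2 + τ 1 ^ 2 = 1 := by
  have h : inner ℝ τ τ = (1 : ℝ) := by rw [real_inner_self_eq_norm_sq, hτ]; norm_num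
  rw [inner_plane] at h
  nlinarith

lemma frame_decomp {τ : Plane} (hτ : ‖τ‖ = 1) (w : Plane) :
    w = inner ℝ w τ • τ + inner ℝ w (perp τ) • perp τ := by
  have h := sq_coord_of_norm_one hτ
  apply plane_ext
  · simp [inner_plane]; linear_combination -(w 0) * h
  · simp [inner_plane]; linear_combination -(w 1) * h

lemma norm_sq_frame {τ : Plane} (hτ : ‖τ‖ = 1) (w : Plane) :
    ‖w‖ ^ 2 = inner ℝ w τ ^ 2 + inner ℝ w (perp τ) ^ 2 := by
  have h := sq_coord_of_norm_one hτ
  rw [← real_inner_self_eq_norm_sq]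
  simp only [inner_plane, perp_apply_zero, perp_apply_one]
  linear_combination -(w 0 ^ 2 + w 1 ^ 2) * h

lemma eq_perp_or_neg_of_inner_eq_zero {τ n : Plane} (hτ : ‖τ‖ = 1) (hn : ‖n‖ = 1)
    (h : inner ℝ n τ = 0) : n = perp τ ∨ n = -perp τ := by
  have h1 := norm_sq_frame hτ n
  rw [h, hn] at h1
  have h2 := frame_decomp hτ n
  rw [h, zero_smul, zero_add] at h2
  have h3 : inner ℝ n (perp τ) = 1 ∨ inner ℝ n (perp τ) = -1 := by
    have h4 : (inner ℝ n (perp τ) - 1) * (inner ℝ n (perp τ) + 1) = (0 : ℝ) := by linarith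
    rcases mul_eq_zero.mp h4 with h5 | h5
    · left; linarith
    · right; linarith
  rcases h3 with h3 | h3
  · left; rwa [h3, one_smul] at h2
  · right; rwa [h3, neg_one_smul] at h2

/-! ### Curves with Hölder continuous derivative -/

/-- `x` is a `C¹` unit speed curve whose tangent is Hölder with constant `H` and exponent `κ`. -/
structure IsHolderCurve (H κ : ℝ) (x : ℝ → Plane) : Prop where
  differentiable : Differentiable ℝ x
  unit_speed : ∀ s, ‖deriv x s‖ = 1
  holder : ∀ s r, ‖deriv x s - deriv x r‖ ≤ H * |s - r| ^ κ

namespace IsHolderCurve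

variable {H κ : ℝ} {x : ℝ → Plane}

lemma dist_le (hx : IsHolderCurve H κ x) (s r : ℝ) : ‖x s - x r‖ ≤ |s - r| := by
  have := Convex.norm_image_sub_le_of_norm_deriv_le (f := x) (s := univ) (C := 1) (x := r) (y := s)
    (fun u _ => hx.differentiable u) (fun u _ => (hx.unit_speed u).le) convex_univ trivial trivial
  simpa using this

/-- Mean value inequality for `u ↦ x u - u • deriv x s`, whose derivative is at most `H |h|^κ`
between `s` and `s + h`. -/
lemma taylor (hx : IsHolderCurve H κ x) (hH : 0 ≤ H) (hκ : 0 ≤ κ) (s h : ℝ) :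
    ‖x (s + h) - x s - h • deriv x s‖ ≤ H * |h| ^ κ * |h| := by
  have h1 : ∀ u ∈ uIcc s (s + h), HasDerivWithinAt (fun u => x u - u • deriv x s)
      (deriv x u - deriv x s) (uIcc s (s + h)) u := by
    intro u _
    have h2 := (hx.differentiable u).hasDerivAt.sub ((hasDerivAt_id u).smul_const (deriv x s))
    rw [one_smul] at h2
    exact h2.hasDerivWithinAt
  have h3 : ∀ u ∈ uIcc s (s + h), ‖deriv x u - deriv x s‖ ≤ H * |h| ^ κ := by
    intro u hu
    refine (hx.holder u s).trans ?_
    have h4 := abs_sub_left_of_mem_uIcc hu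
    rw [add_sub_cancel_left] at h4
    exact mul_le_mul_of_nonneg_left (Real.rpow_le_rpow (abs_nonneg _) h4 hκ) hH
  have h4 := Convex.norm_image_sub_le_of_norm_hasDerivWithin_le h1 h3 (convex_uIcc _ _)
    left_mem_uIcc right_mem_uIcc
  have h5 : x (s + h) - (s + h) • deriv x s - (x s - s • deriv x s)
      = x (s + h) - x s - h • deriv x s := by rw [add_smul]; abel
  rw [h5] at h4
  simpa using h4

lemma continuous_deriv (hx : IsHolderCurve H κ x) (hκ : 0 < κ) : Continuous (deriv x) := by
  rw [continuous_iff_continuousAt]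
  intro s
  rw [ContinuousAt, tendsto_iff_norm_sub_tendsto_zero]
  have h1 : Tendsto (fun r : ℝ => H * |r - s| ^ κ) (𝓝 s) (𝓝 0) := by
    have : Continuous fun r : ℝ => H * |r - s| ^ κ :=
      continuous_const.mul ((by fun_prop : Continuous fun r : ℝ => |r - s|).rpow_const
        (fun _ => Or.inr hκ.le))
    simpa [Real.zero_rpow hκ.ne'] using this.tendsto s
  exact squeeze_zero (fun _ => norm_nonneg _) (fun r => hx.holder r s) h1

lemma comp_add (hx : IsHolderCurve H κ x) (a : ℝ) : IsHolderCurve H κ (fun s => x (a + s)) where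
  differentiable := hx.differentiable.comp ((differentiable_const a).add differentiable_id)
  unit_speed s := by rw [deriv_comp_const_add]; exact hx.unit_speed _
  holder s r := by
    rw [deriv_comp_const_add, deriv_comp_const_add]
    simpa using hx.holder (a + s) (a + r)

end IsHolderCurve

lemma IsArcLengthParam.differentiable {x : ℝ → Plane} {L : ℝ} {Γ : Set Plane}
    (hx : IsArcLengthParam x L Γ) : Differentiable ℝ x :=
  hx.contDiff.differentiable one_ne_zero

lemma IsArcLengthParam.isCompact {x : ℝ → Plane} {L : ℝ} {Γ : Set Plane}
    (hx : IsArcLengthParam x L Γ) : IsCompact Γ := by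
  rw [← hx.range_eq, ← hx.periodic.image_Icc hx.length_pos 0]
  exact isCompact_Icc.image hx.contDiff.continuous

lemma IsArcLengthParam.mem {x : ℝ → Plane} {L : ℝ} {Γ : Set Plane}
    (hx : IsArcLengthParam x L Γ) (s : ℝ) : x s ∈ Γ := hx.range_eq ▸ mem_range_self s

lemma IsArcLengthParam.eq_iff {x : ℝ → Plane} {L : ℝ} {Γ : Set Plane}
    (hx : IsArcLengthParam x L Γ) {s r : ℝ} : x s = x r ↔ ∃ m : ℤ, s = r + m * L := by
  constructor
  · intro h
    obtain ⟨s', hs', m, hm⟩ : ∃ s' ∈ Ico 0 L, ∃ m : ℤ, s = s' + m * L :=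
      ⟨toIcoMod hx.length_pos 0 s, by simpa using toIcoMod_mem_Ico hx.length_pos 0 s,
        toIcoDiv hx.length_pos 0 s, by
        have := toIcoMod_add_toIcoDiv_zsmul hx.length_pos 0 s
        rw [zsmul_eq_mul] at this; exact this.symm⟩
    obtain ⟨r', hr', m', hm'⟩ : ∃ s' ∈ Ico 0 L, ∃ m : ℤ, r = s' + m * L :=
      ⟨toIcoMod hx.length_pos 0 r, by simpa using toIcoMod_mem_Ico hx.length_pos 0 r,
        toIcoDiv hx.length_pos 0 r, by
        have := toIcoMod_add_toIcoDiv_zsmul hx.length_pos 0 r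
        rw [zsmul_eq_mul] at this; exact this.symm⟩
    have h1 : x s' = x r' := by
      rw [hm, hm'] at h
      rwa [hx.periodic.int_mul m s', hx.periodic.int_mul m' r'] at h
    have h2 := hx.injOn hs' hr' h1
    exact ⟨m - m', by rw [hm, hm', h2]; push_cast; ring⟩
  · rintro ⟨m, rfl⟩
    exact hx.periodic.int_mul m r

/-! ### Limits along ultrafilters -/

section Limits

variable {ι : Type*} {U : Ultrafilter ι}

/-- Nearest points on the fixed compact set `Γ` have a limit along the ultrafilter, and the `z i`
follow them. Ultrafilters replace subsequences throughout: every choice in a compact set converges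
and nothing has to be extracted. -/
lemma exists_tendsto_of_hausdorffEDist {Γn : ι → Set Plane} {Γ : Set Plane} (hΓ : IsCompact Γ)
    (hlim : Tendsto (fun i => Metric.hausdorffEDist (Γn i) Γ) U (𝓝 0)) {z : ι → Plane}
    (hz : ∀ i, z i ∈ Γn i) : ∃ w ∈ Γ, Tendsto z U (𝓝 w) := by
  have h1 : ∀ i, ∃ w, Metric.hausdorffEDist (Γn i) Γ < ∞ → w ∈ Γ ∧
      edist (z i) w ≤ Metric.hausdorffEDist (Γn i) Γ := by
    intro i
    by_cases hfin : Metric.hausdorffEDist (Γn i) Γ < ∞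
    · have hne : Γ.Nonempty := by
        obtain ⟨w, hw, -⟩ := Metric.exists_edist_lt_of_hausdorffEDist_lt (hz i) hfin
        exact ⟨w, hw⟩
      obtain ⟨w, hw, h⟩ := hΓ.exists_infEDist_eq_edist hne (z i)
      exact ⟨w, fun _ => ⟨hw, h ▸ Metric.infEDist_le_hausdorffEDist_of_mem (hz i)⟩⟩
    · exact ⟨z i, fun h => absurd h hfin⟩
  choose w hw using h1
  have hev : ∀ᶠ i in (U : Filter ι), Metric.hausdorffEDist (Γn i) Γ < ∞ :=
    hlim.eventually (gt_mem_nhds ENNReal.zero_lt_top)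
  have hwΓ : ∀ᶠ i in (U : Filter ι), w i ∈ Γ := hev.mono fun i hi => (hw i hi).1
  obtain ⟨v, hv, hUv⟩ := hΓ.ultrafilter_le_nhds (U.map w) (by
    rw [Ultrafilter.coe_map, le_principal_iff]; exact hwΓ)
  refine ⟨v, hv, ?_⟩
  have hwv : Tendsto w U (𝓝 v) := hUv
  have h2 : Tendsto (fun i => edist (z i) (w i)) U (𝓝 0) :=
    tendsto_of_tendsto_of_tendsto_of_le_of_le' tendsto_const_nhds hlim
      (Eventually.of_forall fun _ => zero_le) (hev.mono fun i hi => (hw i hi).2)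
  rw [tendsto_iff_edist_tendsto_0] at hwv ⊢
  have h3 := h2.add hwv
  rw [add_zero] at h3
  exact tendsto_of_tendsto_of_tendsto_of_le_of_le tendsto_const_nhds h3 (fun _ => zero_le)
    (fun i => edist_triangle _ _ _)

lemma exists_approx_of_hausdorffEDist {F : Filter ι} {Γn : ι → Set Plane} {Γ : Set Plane}
    (hne : ∀ i, (Γn i).Nonempty)
    (hlim : Tendsto (fun i => Metric.hausdorffEDist (Γn i) Γ) F (𝓝 0)) {w : Plane} (hw : w ∈ Γ)
    (hc : ∀ i, IsCompact (Γn i)) :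
    ∃ z : ι → Plane, (∀ i, z i ∈ Γn i) ∧ Tendsto z F (𝓝 w) := by
  have h1 : ∀ i, ∃ z ∈ Γn i, edist w z ≤ Metric.hausdorffEDist (Γn i) Γ := by
    intro i
    obtain ⟨z, hz, h⟩ := (hc i).exists_infEDist_eq_edist (hne i) w
    exact ⟨z, hz, by rw [← h, Metric.hausdorffEDist_comm]
                     exact Metric.infEDist_le_hausdorffEDist_of_mem hw⟩
  choose z hz hzd using h1
  refine ⟨z, hz, ?_⟩
  rw [tendsto_iff_edist_tendsto_0]
  exact tendsto_of_tendsto_of_tendsto_of_le_of_le tendsto_const_nhds hlim (fun _ => zero_le)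
    (fun i => by rw [edist_comm]; exact hzd i)

/-- Pointwise limits of uniformly Hölder curves are Hölder curves, with convergent tangents. -/
lemma IsHolderCurve.of_tendsto {H κ : ℝ} (hH : 0 ≤ H) (hκ : 0 < κ) {y : ι → ℝ → Plane}
    {x : ℝ → Plane} (hy : ∀ i, IsHolderCurve H κ (y i))
    (hlim : ∀ s, Tendsto (fun i => y i s) U (𝓝 (x s))) :
    IsHolderCurve H κ x ∧ ∀ s, Tendsto (fun i => deriv (y i) s) U (𝓝 (deriv x s)) := by
  have h1 : ∀ s, ∃ v, Tendsto (fun i => deriv (y i) s) U (𝓝 v) := by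
    intro s
    obtain ⟨v, -, hv⟩ := (isCompact_closedBall (0 : Plane) 1).ultrafilter_le_nhds
      (U.map fun i => deriv (y i) s) (by
        rw [Ultrafilter.coe_map, le_principal_iff, mem_map]
        exact Filter.univ_mem' fun i => by
          simp [(hy i).unit_speed s])
    exact ⟨v, hv⟩
  choose v hv using h1
  -- The Taylor bound is uniform in the index, so it survives the limit and identifies `v s` as the
  -- derivative of `x`.
  have h2 : ∀ s h, ‖x (s + h) - x s - h • v s‖ ≤ H * |h| ^ κ * |h| := by
    intro s h
    refine le_of_tendsto (((hlim (s + h)).sub (hlim s)).sub ((hv s).const_smul h)).norm ?_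
    exact Eventually.of_forall fun i => (hy i).taylor hH hκ.le s h
  have h3 : ∀ s, HasDerivAt x (v s) s := by
    intro s
    rw [hasDerivAt_iff_isLittleO_nhds_zero, Asymptotics.isLittleO_iff]
    intro c hc
    have h4 : Tendsto (fun h : ℝ => H * |h| ^ κ) (𝓝 0) (𝓝 0) := by
      have : Continuous fun r : ℝ => H * |r| ^ κ :=
        continuous_const.mul (continuous_abs.rpow_const (fun _ => Or.inr hκ.le))
      simpa [Real.zero_rpow hκ.ne'] using this.tendsto 0
    filter_upwards [h4.eventually (gt_mem_nhds hc)] with h hh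
    refine (h2 s h).trans ?_
    rw [Real.norm_eq_abs]
    gcongr
  have h5 : ∀ s, deriv x s = v s := fun s => (h3 s).deriv
  refine ⟨⟨fun s => (h3 s).differentiableAt, fun s => ?_, fun s r => ?_⟩, fun s => h5 s ▸ hv s⟩
  · rw [h5]
    refine tendsto_nhds_unique (hv s).norm ?_
    simp [(hy _).unit_speed s]
  · rw [h5, h5]
    exact le_of_tendsto ((hv s).sub (hv r)).norm (Eventually.of_forall fun i => (hy i).holder s r)

end Limits

/-- A unit speed `C¹` curve with values in a simple closed curve runs along its arc length
parametrization. -/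
lemma IsArcLengthParam.exists_shift {x y : ℝ → Plane} {L : ℝ} {Γ : Set Plane}
    (hx : IsArcLengthParam x L Γ) (hy : Differentiable ℝ y) (hy' : Continuous (deriv y))
    (hu : ∀ s, ‖deriv y s‖ = 1) (hyΓ : ∀ s, y s ∈ Γ) :
    ∃ σ c : ℝ, (c = 1 ∨ c = -1) ∧ ∀ s, y s = x (σ + c * s) := by
  have : Fact (0 < L) := ⟨hx.length_pos⟩
  -- `x` factors through an injective map of the circle, a closed embedding by compactness. Hence
  -- `y` lifts continuously to the circle and then, through the covering, to a real parameter `F`.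
  let X : AddCircle L → Plane := hx.periodic.lift
  have hXc : Continuous X := continuous_coinduced_dom.mpr hx.contDiff.continuous
  have hXcoe : ∀ s : ℝ, X (s : AddCircle L) = x s := fun s => hx.periodic.lift_coe s
  have hXi : Function.Injective X := by
    intro a b hab
    induction a using QuotientAddGroup.induction_on with
    | H a =>
    induction b using QuotientAddGroup.induction_on with
    | H b =>
    change X (a : AddCircle L) = X (b : AddCircle L) at hab
    rw [hXcoe, hXcoe, hx.eq_iff] at hab
    obtain ⟨m, rfl⟩ := hab
    change ((b + m * L : ℝ) : AddCircle L) = (b : AddCircle L)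
    rw [AddCircle.coe_add, ← zsmul_eq_mul, AddCircle.coe_zsmul, AddCircle.coe_period, smul_zero,
      add_zero]
  have hemb : IsClosedEmbedding X := hXc.isClosedEmbedding hXi
  have hex : ∀ s, ∃ g : AddCircle L, X g = y s := by
    intro s
    have := hyΓ s
    rw [← hx.range_eq] at this
    obtain ⟨r, hr⟩ := this
    exact ⟨r, by rw [hXcoe, hr]⟩
  choose g hg using hex
  have hgc : Continuous g := by
    rw [hemb.isEmbedding.continuous_iff]
    convert hy.continuous using 1
    exact funext hg
  obtain ⟨σ₀, hσ₀⟩ := QuotientAddGroup.mk_surjective (g 0)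
  obtain ⟨F, ⟨-, hF⟩, -⟩ := (AddCircle.isCoveringMap_coe L).existsUnique_continuousMap_lifts
    (⟨g, hgc⟩ : C(ℝ, AddCircle L)) 0 σ₀ hσ₀
  have hyF : ∀ s, y s = x (F s) := by
    intro s
    rw [← hg, ← hXcoe]
    congr 1
    exact (congrFun hF s).symm
  -- Near `F s` the parameter is recovered from the coordinate `⟨e, x⟩`, which has derivative 1
  -- there; composing its local inverse with `⟨e, y⟩` shows that `F` is differentiable.
  have hFd : ∀ s, HasDerivAt F (inner ℝ (deriv x (F s)) (deriv y s)) s := by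
    intro s
    set e := deriv x (F s) with he
    have h1 : HasStrictDerivAt (fun u => inner ℝ e (x u)) 1 (F s) := by
      have h2 : HasStrictDerivAt x e (F s) :=
        hx.contDiff.contDiffAt.hasStrictDerivAt one_ne_zero
      have h3 := (innerSL ℝ e).hasStrictFDerivAt.comp_hasStrictDerivAt (F s) h2
      have h4 : (innerSL ℝ e) e = 1 := by
        rw [innerSL_apply_apply, real_inner_self_eq_norm_sq, he, hx.unit_speed]; norm_num
      rw [h4] at h3
      exact h3
    have h5 := h1.eventually_left_inverse one_ne_zero
    have h6 : ∀ᶠ u in 𝓝 s, F u = h1.localInverse _ _ _ one_ne_zero (inner ℝ e (y u)) := by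
      filter_upwards [F.continuous.continuousAt.eventually h5] with u hu'
      rw [hyF u]; exact hu'.symm
    have h7 := (h1.to_localInverse one_ne_zero).hasDerivAt
    have h8 : HasDerivAt (fun u => inner ℝ e (y u)) (inner ℝ e (deriv y s)) s :=
      (innerSL ℝ e).hasFDerivAt.comp_hasDerivAt s (hy s).hasDerivAt
    have h9 : HasDerivAt (fun u => h1.localInverse _ _ _ one_ne_zero (inner ℝ e (y u)))
        ((1 : ℝ)⁻¹ * inner ℝ e (deriv y s)) s := by
      rw [show (inner ℝ e (x (F s)) : ℝ) = inner ℝ e (y s) by rw [hyF]] at h7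
      exact h7.comp s h8
    rw [inv_one, one_mul] at h9
    exact h9.congr_of_eventuallyEq h6
  -- Both curves have unit speed, so the derivative of `F` is `1` or `-1`; by continuity the sign
  -- never changes.
  have hc1 : ∀ s, inner ℝ (deriv x (F s)) (deriv y s) = (1 : ℝ) ∨
      inner ℝ (deriv x (F s)) (deriv y s) = (-1 : ℝ) := by
    intro s
    have h1 : HasDerivAt y (inner ℝ (deriv x (F s)) (deriv y s) • deriv x (F s)) s := by
      have h2 := (hx.differentiable (F s)).hasDerivAt.scomp s (hFd s)
      exact h2.congr_of_eventuallyEq (Eventually.of_forall hyF)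
    have h3 := congrArg norm h1.deriv
    rw [norm_smul, hu, hx.unit_speed, mul_one, Real.norm_eq_abs] at h3
    exact (abs_eq zero_le_one).mp h3.symm
  have hcc : Continuous fun s => (inner ℝ (deriv x (F s)) (deriv y s) : ℝ) :=
    ((hx.contDiff.continuous_deriv le_rfl).comp F.continuous).inner hy'
  have hconst : ∀ s, inner ℝ (deriv x (F s)) (deriv y s)
      = (inner ℝ (deriv x (F 0)) (deriv y 0) : ℝ) := by
    intro s
    have h0 : ∀ u v, inner ℝ (deriv x (F u)) (deriv y u) = (1 : ℝ) →
        inner ℝ (deriv x (F v)) (deriv y v) = (-1 : ℝ) → False := by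
      intro u v h1 h2
      obtain ⟨w, hw⟩ := mem_range_of_exists_le_of_exists_ge hcc (c := 0)
        ⟨v, by rw [h2]; norm_num⟩ ⟨u, by rw [h1]; norm_num⟩
      simp only at hw
      rcases hc1 w with h | h <;> rw [h] at hw <;> norm_num at hw
    rcases hc1 s with h1 | h1 <;> rcases hc1 0 with h2 | h2
    · rw [h1, h2]
    · exact (h0 _ _ h1 h2).elim
    · exact (h0 _ _ h2 h1).elim
    · rw [h1, h2]
  set c := (inner ℝ (deriv x (F 0)) (deriv y 0) : ℝ) with hcdef
  refine ⟨F 0, c, hc1 0, fun s => ?_⟩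
  rw [hyF s]
  congr 1
  have h1 : ∀ u, HasDerivAt (fun u => F u - c * u) 0 u := by
    intro u
    have h2 := (hFd u).sub ((hasDerivAt_id u).const_mul c)
    rw [hconst u, mul_one, sub_self] at h2
    exact h2
  have h3 := is_const_of_deriv_eq_zero (fun u => (h1 u).differentiableAt)
    (fun u => (h1 u).deriv) s 0
  simp only [mul_zero, sub_zero] at h3
  linarith

/-- A curve which almost closes up after length `ℓ` and returns to a periodic simple curve has
a period within `δ` of `ℓ`: it cannot run more than once around. -/
lemma exists_return {x : ℝ → Plane} {P ℓ δ : ℝ} (hP : 0 < P) (hδ : 0 < δ)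
    (hper : Function.Periodic x P) (hx : Differentiable ℝ x) (hx' : Continuous (deriv x))
    (hu : ∀ s, ‖deriv x s‖ = 1)
    (h1 : ∀ s r, |s - r| ≤ δ → ‖deriv x s - deriv x r‖ ≤ 1 / 10)
    (h2 : ∀ s, ‖x (s + ℓ) - x s‖ ≤ δ / 10)
    (h3 : ∀ s, ‖deriv x (s + ℓ) - deriv x s‖ ≤ 1 / 10) :
    ∃ s, ∃ a ∈ Icc (ℓ - δ) (ℓ + δ), x (s + a) = x s := by
  by_contra! hne
  have htan : ∀ s, ∀ a ∈ Icc (ℓ - δ) (ℓ + δ), ‖deriv x (s + a) - deriv x s‖ ≤ 1 / 5 := by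
    intro s a ha
    have h4 := h1 (s + a) (s + ℓ) (by rw [abs_le]; constructor <;> linarith [ha.1, ha.2])
    calc ‖deriv x (s + a) - deriv x s‖
        = ‖(deriv x (s + a) - deriv x (s + ℓ)) + (deriv x (s + ℓ) - deriv x s)‖ := by
          congr 1; abel
      _ ≤ 1 / 10 + 1 / 10 := (norm_add_le _ _).trans (add_le_add h4 (h3 s))
      _ = 1 / 5 := by norm_num
  have hcos : ∀ u v : Plane, ‖u‖ = 1 → ‖v‖ = 1 → ‖u - v‖ ≤ 1 / 5 → 9 / 10 ≤ inner ℝ u v := by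
    intro u v hu hv huv
    have h4 := norm_sub_sq_real u v
    rw [hu, hv] at h4
    nlinarith [norm_nonneg (u - v)]
  have hinner_le : ∀ u v : Plane, ‖v‖ = 1 → |inner ℝ u v| ≤ ‖u‖ := by
    intro u v hv
    simpa [hv] using abs_real_inner_le_norm u v
  -- longitudinal displacement between the two sheets
  let ψ : ℝ → ℝ → ℝ := fun s a => inner ℝ (x (s + a) - x s) (deriv x s)
  let D : ℝ → ℝ → ℝ := fun s a => inner ℝ (x (s + a) - x s) (perp (deriv x s))
  have hψc : Continuous fun p : ℝ × ℝ => ψ p.1 p.2 := by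
    have := hx.continuous
    fun_prop
  have hDc : Continuous fun p : ℝ × ℝ => D p.1 p.2 := by
    have := hx.continuous
    exact ((this.comp (continuous_fst.add continuous_snd)).sub (this.comp continuous_fst)).inner
      (continuous_perp.comp (hx'.comp continuous_fst))
  have hψd : ∀ s a, HasDerivAt (ψ s) (inner ℝ (deriv x (s + a)) (deriv x s)) a := by
    intro s a
    have h4 : HasDerivAt (fun a => x (s + a) - x s) (deriv x (s + a)) a := by
      have := (hx (s + a)).hasDerivAt.comp_const_add s a
      exact this.sub_const _
    have h5 := h4.inner ℝ (hasDerivAt_const a (deriv x s))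
    simpa using h5
  have hmono : ∀ s, StrictMonoOn (ψ s) (Icc (ℓ - δ) (ℓ + δ)) := by
    intro s
    refine strictMonoOn_of_deriv_pos (convex_Icc _ _)
      (fun a _ => (hψd s a).continuousAt.continuousWithinAt) (fun a ha => ?_)
    rw [(hψd s a).deriv]
    rw [interior_Icc] at ha
    have := hcos _ _ (hu _) (hu _) (htan s a (Ioo_subset_Icc_self ha))
    linarith
  have hℓ : ∀ s, |ψ s ℓ| ≤ δ / 10 := fun s => (hinner_le _ _ (hu s)).trans (h2 s)
  have hgrow : ∀ s, 0 < ψ s (ℓ + δ) ∧ ψ s (ℓ - δ) < 0 := by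
    intro s
    have h4 : ∀ a ∈ interior (Icc (ℓ - δ) (ℓ + δ)), 9 / 10 ≤ deriv (ψ s) a := by
      intro a ha
      rw [(hψd s a).deriv]
      rw [interior_Icc] at ha
      exact hcos _ _ (hu _) (hu _) (htan s a (Ioo_subset_Icc_self ha))
    have h5 := (convex_Icc (ℓ - δ) (ℓ + δ)).mul_sub_le_image_sub_of_le_deriv
      (fun a _ => (hψd s a).continuousAt.continuousWithinAt)
      (fun a _ => (hψd s a).differentiableAt.differentiableWithinAt) h4
    have h6 := h5 ℓ ⟨by linarith, by linarith⟩ (ℓ + δ) ⟨by linarith, by linarith⟩ (by linarith)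
    have h7 := h5 (ℓ - δ) ⟨by linarith, by linarith⟩ ℓ ⟨by linarith, by linarith⟩ (by linarith)
    have h8 := abs_le.mp (hℓ s)
    constructor <;> nlinarith
  -- The next sheet crosses the normal line at `x s` for exactly one `a` in the window; the sign of
  -- `D s a` there tells on which side of the current sheet it runs.
  have hzero : ∀ s, ∃ a ∈ Icc (ℓ - δ) (ℓ + δ), ψ s a = 0 := by
    intro s
    have := intermediate_value_Icc (show ℓ - δ ≤ ℓ + δ by linarith)
      (fun a _ => (hψd s a).continuousAt.continuousWithinAt)
      (show (0 : ℝ) ∈ Icc (ψ s (ℓ - δ)) (ψ s (ℓ + δ)) from ⟨(hgrow s).2.le, (hgrow s).1.le⟩)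
    obtain ⟨a, ha, h⟩ := this
    exact ⟨a, ha, h⟩
  have hDne : ∀ s, ∀ a ∈ Icc (ℓ - δ) (ℓ + δ), ψ s a = 0 → D s a ≠ 0 := by
    intro s a ha h4 h5
    apply hne s a ha
    have h6 := frame_decomp (hu s) (x (s + a) - x s)
    have h7 : inner ℝ (x (s + a) - x s) (deriv x s) = (0 : ℝ) := h4
    have h8 : inner ℝ (x (s + a) - x s) (perp (deriv x s)) = (0 : ℝ) := h5
    rw [h7, h8, zero_smul, zero_smul, add_zero] at h6
    exact sub_eq_zero.mp h6
  have hclosed : ∀ Q : Set ℝ, IsClosed Q →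
      IsClosed {s | ∃ a ∈ Icc (ℓ - δ) (ℓ + δ), ψ s a = 0 ∧ D s a ∈ Q} := by
    intro Q hQ
    have h4 : IsClosed {p : ℝ × ℝ | ψ p.1 p.2 = 0 ∧ D p.1 p.2 ∈ Q} :=
      (isClosed_eq hψc continuous_const).inter (hQ.preimage hDc)
    rw [← isSeqClosed_iff_isClosed]
    intro u s hu' hus
    choose a ha h5 using hu'
    obtain ⟨a', ha', φ, hφ, hlim⟩ := isCompact_Icc.tendsto_subseq ha
    refine ⟨a', ha', ?_⟩
    have h6 := h4.mem_of_tendsto ((hus.comp hφ.tendsto_atTop).prodMk_nhds hlim)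
      (Eventually.of_forall fun n => h5 (φ n))
    exact h6
  -- The parameters for which the next sheet lies on a given side form a closed set. The two such
  -- sets cover the line, and at a common point the curve would close up, so one side is never
  -- taken.
  have hsign : (∀ s, ∀ a ∈ Icc (ℓ - δ) (ℓ + δ), ψ s a = 0 → 0 < D s a) ∨
      (∀ s, ∀ a ∈ Icc (ℓ - δ) (ℓ + δ), ψ s a = 0 → D s a < 0) := by
    by_contra! hcon
    obtain ⟨⟨s₁, a₁, ha₁, hz₁, hd₁⟩, ⟨s₂, a₂, ha₂, hz₂, hd₂⟩⟩ := hcon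
    obtain ⟨s, -, ⟨a, ha, hz, hd⟩, ⟨b, hb, hz', hd'⟩⟩ := isPreconnected_closed_iff.mp
      (isPreconnected_univ (α := ℝ)) _ _ (hclosed (Iic 0) isClosed_Iic)
      (hclosed (Ici 0) isClosed_Ici) (fun s _ => by
        obtain ⟨a, ha, hz⟩ := hzero s
        rcases le_total (D s a) 0 with h | h
        · exact Or.inl ⟨a, ha, hz, h⟩
        · exact Or.inr ⟨a, ha, hz, h⟩)
      ⟨s₁, trivial, a₁, ha₁, hz₁, hd₁⟩ ⟨s₂, trivial, a₂, ha₂, hz₂, hd₂⟩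
    have hab : a = b := (hmono s).injOn ha hb (hz.trans hz'.symm)
    subst hab
    exact hDne s a ha hz (le_antisymm hd hd')
  -- a point of maximal height
  let e : Plane := !₂[1, 0]
  have hfc : Continuous fun s => (inner ℝ e (x s) : ℝ) := continuous_const.inner hx.continuous
  obtain ⟨s₀, -, hs₀⟩ := isCompact_Icc.exists_isMaxOn (nonempty_Icc.mpr hP.le) hfc.continuousOn
    (s := Icc 0 P)
  have hmax : ∀ s, inner ℝ e (x s) ≤ (inner ℝ e (x s₀) : ℝ) := by
    intro s
    obtain ⟨s', hs', h⟩ := hper.exists_mem_Ico₀ hP s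
    rw [h]
    exact hs₀ (Ico_subset_Icc_self hs')
  have he : ‖e‖ = 1 := by
    simp [e, EuclideanSpace.norm_eq]
  have hperp : inner ℝ e (deriv x s₀) = (0 : ℝ) := by
    have h4 : HasDerivAt (fun s => (inner ℝ e (x s) : ℝ)) (inner ℝ e (deriv x s₀)) s₀ :=
      (innerSL ℝ e).hasFDerivAt.comp_hasDerivAt s₀ (hx s₀).hasDerivAt
    have h5 : IsLocalMax (fun s => (inner ℝ e (x s) : ℝ)) s₀ := Eventually.of_forall hmax
    exact h5.hasDerivAt_eq_zero h4
  obtain ⟨a, ha, hza⟩ := hzero s₀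
  have hfwd : inner ℝ e (x (s₀ + a) - x s₀) = D s₀ a * inner ℝ e (perp (deriv x s₀)) := by
    have h6 := frame_decomp (hu s₀) (x (s₀ + a) - x s₀)
    have h7 : inner ℝ (x (s₀ + a) - x s₀) (deriv x s₀) = (0 : ℝ) := hza
    rw [h7, zero_smul, zero_add] at h6
    rw [h6, inner_smul_right]
  have hfwd' : inner ℝ e (x (s₀ + a) - x s₀) ≤ (0 : ℝ) := by
    rw [inner_sub_right]; linarith [hmax (s₀ + a)]
  -- the sheet preceding the point of maximal height
  obtain ⟨b, hb, hzb⟩ : ∃ b ∈ Icc (ℓ - δ) (ℓ + δ), ψ (s₀ - b) b = 0 := by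
    have h4 : ContinuousOn (fun b => ψ (s₀ - b) b) (Icc (ℓ - δ) (ℓ + δ)) :=
      (hψc.comp (by fun_prop : Continuous fun b : ℝ => (s₀ - b, b))).continuousOn
    have := intermediate_value_Icc (show ℓ - δ ≤ ℓ + δ by linarith) h4
      (show (0 : ℝ) ∈ Icc _ _ from ⟨(hgrow _).2.le, (hgrow _).1.le⟩)
    obtain ⟨a, ha, h⟩ := this
    exact ⟨a, ha, h⟩
  have hbwd : inner ℝ e (x s₀ - x (s₀ - b))
      = D (s₀ - b) b * inner ℝ e (perp (deriv x (s₀ - b))) := by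
    have h6 := frame_decomp (hu (s₀ - b)) (x (s₀ - b + b) - x (s₀ - b))
    have h7 : inner ℝ (x (s₀ - b + b) - x (s₀ - b)) (deriv x (s₀ - b)) = (0 : ℝ) := hzb
    rw [h7, zero_smul, zero_add, sub_add_cancel] at h6
    rw [h6, inner_smul_right]
    simp only [D, sub_add_cancel]
  have hbwd' : 0 ≤ (inner ℝ e (x s₀ - x (s₀ - b)) : ℝ) := by
    rw [inner_sub_right]; linarith [hmax (s₀ - b)]
  have hDb := hDne _ _ hb hzb
  have hclose : |inner ℝ e (perp (deriv x (s₀ - b))) - inner ℝ e (perp (deriv x s₀))|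
      ≤ (1 / 5 : ℝ) := by
    rw [← inner_sub_right, ← perp_sub]
    refine (abs_real_inner_le_norm _ _).trans ?_
    rw [he, one_mul, norm_perp, norm_sub_rev]
    have := htan (s₀ - b) b hb
    rwa [sub_add_cancel] at this
  have hpm : inner ℝ e (perp (deriv x s₀)) = (1 : ℝ) ∨ inner ℝ e (perp (deriv x s₀)) = (-1 : ℝ) := by
    have h4 := norm_sq_frame (hu s₀) e
    rw [hperp, he] at h4
    have h5 : (inner ℝ e (perp (deriv x s₀)) - 1) * (inner ℝ e (perp (deriv x s₀)) + 1)
        = (0 : ℝ) := by linarith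
    rcases mul_eq_zero.mp h5 with h | h
    · left; linarith
    · right; linarith
  have hDa := hDne _ _ ha hza
  -- Seen from the highest point, the following and the preceding sheet are displaced in opposite
  -- directions along nearly the same vertical normal, so one of them would be higher still.
  rcases hsign with hs | hs
  · have p1 := hs _ _ ha hza
    have p2 := hs _ _ hb hzb
    rcases hpm with h | h
    · rw [hfwd, h] at hfwd'; linarith
    · rw [h] at hclose
      have := (abs_le.mp hclose).2
      rw [hbwd] at hbwd'
      nlinarith
  · have p1 := hs _ _ ha hza
    have p2 := hs _ _ hb hzb
    rcases hpm with h | h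
    · rw [h] at hclose
      have := (abs_le.mp hclose).1
      rw [hbwd] at hbwd'
      nlinarith
    · rw [hfwd, h] at hfwd'; linarith

/-- Pigeonhole for ultrafilters; it freezes the indices of the curves that carry a moving pair. -/
lemma exists_eventually_eq_of_finite {ι α : Type*} [Finite α] (U : Ultrafilter ι) (f : ι → α) :
    ∃ a, ∀ᶠ n in (U : Filter ι), f n = a := by
  obtain ⟨a, ha⟩ := (U.map f).eq_pure_of_finite
  refine ⟨a, ?_⟩
  have h : {a} ∈ U.map f := by rw [ha]; exact Ultrafilter.mem_pure.mpr rfl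
  exact h

/-! ### Hausdorff convergence of closed curves: arcs, tangents and lengths. -/

section CurveLimits

variable {ι : Type*} {U : Ultrafilter ι} {H κ : ℝ} {xn : ι → ℝ → Plane} {Ln : ι → ℝ}
  {Γn : ι → Set Plane} {x : ℝ → Plane} {L : ℝ} {Γ : Set Plane}

/-- With the moving base points `s i` taken as origins, compactness gives pointwise limits in `Γ`;
the uniform Hölder bound makes the limit a unit speed `C¹` curve, which must run along `x`, with
orientation `c`. Equicontinuity then allows convergent arguments `r i` in place of fixed ones. -/
lemma exists_shift_limit (hH : 0 ≤ H) (hκ : 0 < κ)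
    (hn : ∀ i, IsArcLengthParam (xn i) (Ln i) (Γn i)) (hh : ∀ i, IsHolderCurve H κ (xn i))
    (hx : IsArcLengthParam x L Γ)
    (hlim : Tendsto (fun i => Metric.hausdorffEDist (Γn i) Γ) U (𝓝 0)) (s : ι → ℝ) :
    ∃ σ c : ℝ, (c = 1 ∨ c = -1) ∧ ∀ r : ι → ℝ, ∀ r₀, Tendsto r U (𝓝 r₀) →
      Tendsto (fun i => xn i (s i + r i)) U (𝓝 (x (σ + c * r₀))) ∧
      Tendsto (fun i => deriv (xn i) (s i + r i)) U (𝓝 (c • deriv x (σ + c * r₀))) := by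
  have h1 : ∀ r : ℝ, ∃ w ∈ Γ, Tendsto (fun i => xn i (s i + r)) U (𝓝 w) := fun r =>
    exists_tendsto_of_hausdorffEDist hx.isCompact hlim (fun i => (hn i).mem _)
  choose y hyΓ hy using h1
  obtain ⟨hyh, hyd⟩ := IsHolderCurve.of_tendsto hH hκ (fun i => (hh i).comp_add (s i)) hy
  obtain ⟨σ, c, hc, hyx⟩ := hx.exists_shift hyh.differentiable (hyh.continuous_deriv hκ)
    hyh.unit_speed hyΓ
  have hyd' : ∀ r, deriv y r = c • deriv x (σ + c * r) := by
    intro r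
    have h2 : HasDerivAt (fun r => x (σ + c * r)) (c • deriv x (σ + c * r)) r := by
      have h3 : HasDerivAt (fun r : ℝ => σ + c * r) c r := by
        simpa using ((hasDerivAt_id r).const_mul c).const_add σ
      exact (hx.differentiable _).hasDerivAt.scomp r h3
    rw [funext hyx]
    exact h2.deriv
  refine ⟨σ, c, hc, fun r r₀ hr => ⟨?_, ?_⟩⟩
  · rw [← hyx]
    have h4 := hy r₀
    rw [tendsto_iff_norm_sub_tendsto_zero] at h4 hr ⊢
    have h5 := hr.add h4
    rw [add_zero] at h5
    refine squeeze_zero (fun _ => norm_nonneg _) (fun i => ?_) h5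
    calc ‖xn i (s i + r i) - y r₀‖ = ‖(xn i (s i + r i) - xn i (s i + r₀))
          + (xn i (s i + r₀) - y r₀)‖ := by congr 1; abel
      _ ≤ _ := (norm_add_le _ _).trans (add_le_add (by
          simpa using (hh i).dist_le (s i + r i) (s i + r₀)) le_rfl)
  · rw [← hyd']
    have h4 := hyd r₀
    rw [tendsto_iff_norm_sub_tendsto_zero] at h4
    have h6 : Tendsto (fun i => H * |r i - r₀| ^ κ) U (𝓝 0) := by
      have : Continuous fun r : ℝ => H * |r - r₀| ^ κ :=
        continuous_const.mul ((by fun_prop : Continuous fun r : ℝ => |r - r₀|).rpow_const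
          (fun _ => Or.inr hκ.le))
      have h7 := (this.tendsto r₀).comp hr
      rw [sub_self, abs_zero, Real.zero_rpow hκ.ne', mul_zero] at h7
      exact h7
    have h5 := h6.add h4
    rw [add_zero] at h5
    rw [tendsto_iff_norm_sub_tendsto_zero]
    refine squeeze_zero (fun _ => norm_nonneg _) (fun i => ?_) h5
    calc ‖deriv (xn i) (s i + r i) - deriv y r₀‖
        = ‖(deriv (xn i) (s i + r i) - deriv (xn i) (s i + r₀))
          + (deriv (fun u => xn i (s i + u)) r₀ - deriv y r₀)‖ := by
          rw [deriv_comp_const_add]; congr 1; abel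
      _ ≤ _ := (norm_add_le _ _).trans (add_le_add (by
          simpa using (hh i).holder (s i + r i) (s i + r₀)) le_rfl)

/-- Hausdorff convergence alone does not exclude that the approximating curves wind several times
around the limit. They nearly close up after length `L`, so `exists_return` produces a positive
multiple of `Ln i` below `L + δ`; conversely any limit of the lengths is a positive period of the
limit curve, hence at least `L`. The lower bound `ℓ₀` keeps that limit away from zero. -/
lemma tendsto_length (hH : 0 ≤ H) (hκ : 0 < κ) {ℓ₀ : ℝ} (hℓ₀ : 0 < ℓ₀) (hℓ : ∀ i, ℓ₀ ≤ Ln i)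
    (hn : ∀ i, IsArcLengthParam (xn i) (Ln i) (Γn i)) (hh : ∀ i, IsHolderCurve H κ (xn i))
    (hx : IsArcLengthParam x L Γ)
    (hlim : Tendsto (fun i => Metric.hausdorffEDist (Γn i) Γ) U (𝓝 0)) :
    Tendsto Ln U (𝓝 L) := by
  have hLpos := hx.length_pos
  have hperx : ∀ σ c : ℝ, (c = 1 ∨ c = -1) → x (σ + c * L) = x σ ∧
      deriv x (σ + c * L) = deriv x σ := by
    have h1 : Function.Periodic (deriv x) L := by
      intro s
      rw [← deriv_comp_add_const]
      congr 1
      exact funext hx.periodic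
    intro σ c hc
    rcases hc with rfl | rfl
    · rw [one_mul]; exact ⟨hx.periodic σ, h1 σ⟩
    · rw [neg_one_mul, ← sub_eq_add_neg]; exact ⟨hx.periodic.sub_eq σ, h1.sub_eq σ⟩
  have hsmall : ∀ᶠ δ in 𝓝[>] (0 : ℝ), ∀ᶠ i in (U : Filter ι), Ln i ≤ L + δ := by
    have h0 : Tendsto (fun δ : ℝ => H * δ ^ κ) (𝓝[>] 0) (𝓝 0) := by
      have : Continuous fun r : ℝ => H * r ^ κ :=
        continuous_const.mul (continuous_id.rpow_const (fun _ => Or.inr hκ.le))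
      simpa [Real.zero_rpow hκ.ne'] using (this.tendsto 0).mono_left nhdsWithin_le_nhds
    filter_upwards [h0.eventually (ge_mem_nhds (show (0 : ℝ) < 1 / 10 by norm_num)),
      self_mem_nhdsWithin, nhdsWithin_le_nhds (gt_mem_nhds hLpos)] with δ hδ1 hδ0 hδL
    rw [mem_Ioi] at hδ0
    have e1 : ∀ᶠ i in (U : Filter ι), ∀ s, ‖xn i (s + L) - xn i s‖ ≤ δ / 10 ∧
        ‖deriv (xn i) (s + L) - deriv (xn i) s‖ ≤ 1 / 10 := by
      -- Parameters violating the bound serve as base points of shifted curves, whose limit has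
      -- exact period `L`.
      by_contra hcon
      rw [← Ultrafilter.eventually_not] at hcon
      have h2 : ∀ i, ∃ s, (¬ ∀ s, ‖xn i (s + L) - xn i s‖ ≤ δ / 10 ∧
          ‖deriv (xn i) (s + L) - deriv (xn i) s‖ ≤ 1 / 10) →
          ¬ (‖xn i (s + L) - xn i s‖ ≤ δ / 10 ∧
            ‖deriv (xn i) (s + L) - deriv (xn i) s‖ ≤ 1 / 10) := by
        intro i
        by_cases h : ∀ s, ‖xn i (s + L) - xn i s‖ ≤ δ / 10 ∧
          ‖deriv (xn i) (s + L) - deriv (xn i) s‖ ≤ 1 / 10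
        · exact ⟨0, fun h' => absurd h h'⟩
        · push Not at h
          obtain ⟨s, hs⟩ := h
          exact ⟨s, fun _ h' => by linarith [hs h'.1, h'.2]⟩
      choose s hs using h2
      obtain ⟨σ, c, hc, hlim'⟩ := exists_shift_limit hH hκ hn hh hx hlim s
      obtain ⟨a1, a2⟩ := hlim' (fun _ => L) L tendsto_const_nhds
      obtain ⟨b1, b2⟩ := hlim' (fun _ => 0) 0 tendsto_const_nhds
      have c1 := (a1.sub b1).norm
      have c2 := (a2.sub b2).norm
      rw [mul_zero, add_zero, (hperx σ c hc).1, sub_self, norm_zero] at c1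
      rw [mul_zero, add_zero, (hperx σ c hc).2, sub_self, norm_zero] at c2
      have hfin : ∀ᶠ i in (U : Filter ι), False := by
        filter_upwards [hcon, c1.eventually (ge_mem_nhds (show (0 : ℝ) < δ / 10 by positivity)),
          c2.eventually (ge_mem_nhds (show (0 : ℝ) < 1 / 10 by norm_num))] with i hi h1 h2
        rw [add_zero] at h1 h2
        exact hs i hi ⟨h1, h2⟩
      exact hfin.exists.elim fun _ h => h
    filter_upwards [e1] with i hi
    obtain ⟨s, a, ha, hsa⟩ := exists_return (hn i).length_pos hδ0 (hn i).periodic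
      (hn i).differentiable ((hh i).continuous_deriv hκ) (hn i).unit_speed
      (fun s r hsr => ((hh i).holder s r).trans (le_trans (by gcongr) hδ1))
      (fun s => (hi s).1) (fun s => (hi s).2)
    obtain ⟨m, hm⟩ := (hn i).eq_iff.mp hsa
    have ham : a = m * Ln i := by linarith
    have hapos : 0 < a := by linarith [ha.1]
    have hm1 : (1 : ℝ) ≤ m := by
      have : 0 < (m : ℝ) := by
        by_contra hneg
        push Not at hneg
        nlinarith [(hn i).length_pos]
      exact_mod_cast (Int.cast_pos.mp this)
    have := (hn i).length_pos
    nlinarith [ha.2]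
  obtain ⟨δ, hδ, hδpos⟩ := (hsmall.and self_mem_nhdsWithin).exists
  obtain ⟨L', hL'mem, hL'⟩ : ∃ L' ∈ Icc ℓ₀ (L + δ), Tendsto Ln U (𝓝 L') := by
    obtain ⟨L', h, h'⟩ := (isCompact_Icc (a := ℓ₀) (b := L + δ)).ultrafilter_le_nhds (U.map Ln) (by
      rw [Ultrafilter.coe_map, le_principal_iff, mem_map]
      filter_upwards [hδ] with i hi using ⟨hℓ i, hi⟩)
    exact ⟨L', h, h'⟩
  have hle : L' ≤ L := by
    have h1 : Tendsto (fun δ : ℝ => L + δ) (𝓝[>] 0) (𝓝 L) := by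
      have : Continuous fun δ : ℝ => L + δ := by fun_prop
      simpa using (this.tendsto 0).mono_left nhdsWithin_le_nhds
    exact ge_of_tendsto h1 (hsmall.mono fun δ hδ => le_of_tendsto hL' hδ)
  obtain ⟨σ, c, hc, hlim'⟩ := exists_shift_limit hH hκ hn hh hx hlim (fun _ => 0)
  have a1 := (hlim' Ln L' hL').1
  have b1 := (hlim' (fun _ => 0) 0 tendsto_const_nhds).1
  have hcl : x (σ + c * L') = x σ := by
    refine tendsto_nhds_unique a1 ?_
    convert b1 using 2 with i
    · rw [(hn i).periodic 0, add_zero]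
    · rw [mul_zero, add_zero]
  obtain ⟨m, hm⟩ := hx.eq_iff.mp hcl
  have hcm : c * L' = m * L := by linarith
  have hge : L ≤ L' := by
    have h0 : 0 < L' := lt_of_lt_of_le hℓ₀ hL'mem.1
    have habs : L' = |(m : ℝ)| * L := by
      have := congrArg abs hcm
      rw [abs_mul, abs_mul, abs_of_pos h0, abs_of_pos hLpos] at this
      rcases hc with rfl | rfl <;> simpa using this
    have hm0 : m ≠ 0 := by
      rintro rfl
      simp at habs; linarith
    have : (1 : ℝ) ≤ |(m : ℝ)| := by exact_mod_cast Int.one_le_abs hm0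
    nlinarith
  rwa [le_antisymm hle hge] at hL'

end CurveLimits

/-- The distance modulo `L` is `min a (L - a)` for the representative `a ∈ [0, L)` of `r - s`. The
form with the gap `a` is the one suited to limits. -/
lemma forall_le_abs_iff {η L s r : ℝ} (hL : 0 < L) :
    (∀ m : ℤ, η ≤ |s - r + m * L|) ↔ ∃ a ∈ Icc η (L - η), ∃ m : ℤ, r = s + a + m * L := by
  constructor
  · intro h
    have h1 := toIcoMod_add_toIcoDiv_zsmul hL 0 (r - s)
    have h2 := toIcoMod_mem_Ico hL 0 (r - s)
    rw [zsmul_eq_mul] at h1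
    set a := toIcoMod hL 0 (r - s)
    set m := toIcoDiv hL 0 (r - s)
    rw [zero_add] at h2
    refine ⟨a, ⟨?_, ?_⟩, m, by linarith⟩
    · have h3 := h m
      rw [show s - r + m * L = -a by linarith, abs_neg, abs_of_nonneg h2.1] at h3
      exact h3
    · have h3 := h (m + 1)
      push_cast at h3
      rw [show s - r + (m + 1) * L = L - a by linarith, abs_of_nonneg (by linarith [h2.2])] at h3
      linarith
  · rintro ⟨a, ha, m, rfl⟩ m'
    rw [show s - (s + a + m * L) + m' * L = ((m' - m : ℤ) : ℝ) * L - a by push_cast; ring]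
    rcases le_or_gt (m' - m) 0 with h | h
    · have h4 : ((m' - m : ℤ) : ℝ) ≤ 0 := by exact_mod_cast h
      rw [abs_sub_comm]
      refine le_trans ?_ (le_abs_self _)
      nlinarith [ha.1]
    · have h4 : (1 : ℝ) ≤ ((m' - m : ℤ) : ℝ) := by exact_mod_cast h
      refine le_trans ?_ (le_abs_self _)
      nlinarith [ha.2]

/-! ### Competing pairs and continuity of the separation distance. -/

section Separation

variable {N : ℕ} {α T η H κ : ℝ} {θ : Fin N → ℝ} {Ω : Fin N → ℝ → Set Plane}
  {x : Fin N → ℝ → ℝ → Plane} {L : Fin N → ℝ → ℝ}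

lemma mem_competingPairs_iff (hsol : IsPatchSolution α T θ Ω x L) {t : ℝ}
    (ht : t ∈ Ico 0 T) {z : Plane × Plane} :
    z ∈ competingPairs η Ω x L t ↔
      (∃ i j, i ≠ j ∧ z.1 ∈ frontier (Ω i t) ∧ z.2 ∈ frontier (Ω j t)) ∨
      ∃ i, ∃ s, ∃ a ∈ Icc η (L i t - η), z = (x i t s, x i t (s + a)) := by
  refine or_congr Iff.rfl (exists_congr fun i => exists_congr fun s => ?_)
  have hp := hsol.param i t ht
  constructor
  · rintro ⟨r, h, rfl⟩
    obtain ⟨a, ha, m, rfl⟩ := (forall_le_abs_iff hp.length_pos).mp h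
    exact ⟨a, ha, by rw [hp.periodic.int_mul m (s + a)]⟩
  · rintro ⟨a, ha, rfl⟩
    exact ⟨s + a, (forall_le_abs_iff hp.length_pos).mpr ⟨a, ha, 0, by simp⟩, rfl⟩

variable {ι : Type*} {U : Ultrafilter ι} {τ : ι → ℝ} {t₀ : ℝ}

lemma IsPatchSolution.tendsto_hausdorffEDist (hsol : IsPatchSolution α T θ Ω x L)
    (hτ : ∀ n, τ n ∈ Ico 0 T) (ht₀ : t₀ ∈ Ico 0 T) (hlim : Tendsto τ U (𝓝 t₀)) (i : Fin N) :
    Tendsto (fun n => Metric.hausdorffEDist (frontier (Ω i (τ n))) (frontier (Ω i t₀))) U (𝓝 0) :=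
  (hsol.continuous i t₀ ht₀).comp
    (tendsto_nhdsWithin_of_tendsto_nhds_of_eventually_within _ hlim (Eventually.of_forall hτ))

/-- Limits of points on two distinct curves lie on the corresponding distinct limit curves. For a
pair on one curve the gap converges and stays in the window `[η, L - η]` because the lengths
converge. -/
lemma exists_tendsto_competingPairs (hη : 0 < η) (hH : 0 ≤ H) (hκ : 0 < κ)
    (hsol : IsPatchSolution α T θ Ω x L)
    (hL : ∀ i, ∀ t ∈ Ico 0 T, 2 * η ≤ L i t) (hτ : ∀ n, τ n ∈ Ico 0 T) (ht₀ : t₀ ∈ Ico 0 T)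
    (hlim : Tendsto τ U (𝓝 t₀)) (hh : ∀ n i, IsHolderCurve H κ (x i (τ n)))
    {z : ι → Plane × Plane} (hz : ∀ n, z n ∈ competingPairs η Ω x L (τ n)) :
    ∃ w ∈ competingPairs η Ω x L t₀, Tendsto z U (𝓝 w) := by
  have hd := hsol.tendsto_hausdorffEDist hτ ht₀ hlim
  have hz' := fun n => (mem_competingPairs_iff hsol (hτ n)).mp (hz n)
  rcases Ultrafilter.eventually_or.mp (Eventually.of_forall hz' : ∀ᶠ n in (U : Filter ι), _)
    with h | h
  · have h1 : ∀ n, ∃ ij : Fin N × Fin N, (∃ i j, i ≠ j ∧ (z n).1 ∈ frontier (Ω i (τ n)) ∧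
        (z n).2 ∈ frontier (Ω j (τ n))) → ij.1 ≠ ij.2 ∧ (z n).1 ∈ frontier (Ω ij.1 (τ n)) ∧
        (z n).2 ∈ frontier (Ω ij.2 (τ n)) := by
      intro n
      by_cases hn : ∃ i j, i ≠ j ∧ (z n).1 ∈ frontier (Ω i (τ n)) ∧
        (z n).2 ∈ frontier (Ω j (τ n))
      · obtain ⟨i, j, hij⟩ := hn
        exact ⟨(i, j), fun _ => hij⟩
      · obtain ⟨n0, hn0⟩ := h.exists
        obtain ⟨i, j, -⟩ := hn0
        exact ⟨(i, j), fun h => absurd h hn⟩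
    choose ij hij using h1
    obtain ⟨⟨i, j⟩, hev⟩ := exists_eventually_eq_of_finite U ij
    have hev' : ∀ᶠ n in (U : Filter ι), i ≠ j ∧ (z n).1 ∈ frontier (Ω i (τ n)) ∧
        (z n).2 ∈ frontier (Ω j (τ n)) := by
      filter_upwards [h, hev] with n hn hn'
      have := hij n hn
      rwa [hn'] at this
    have key : ∀ (i : Fin N) (p : ι → Plane), (∀ᶠ n in (U : Filter ι), p n ∈ frontier (Ω i (τ n))) →
        ∃ w ∈ frontier (Ω i t₀), Tendsto p U (𝓝 w) := by
      classical
      intro i p hp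
      obtain ⟨w, hw, hlim⟩ := exists_tendsto_of_hausdorffEDist (hsol.param i t₀ ht₀).isCompact
        (hd i) (z := fun n => if p n ∈ frontier (Ω i (τ n)) then p n else x i (τ n) 0)
        (fun n => by
          split_ifs with hn
          · exact hn
          · exact (hsol.param i _ (hτ n)).mem 0)
      refine ⟨w, hw, hlim.congr' ?_⟩
      filter_upwards [hp] with n hn
      simp [hn]
    obtain ⟨w₁, hw₁, hl₁⟩ := key i (fun n => (z n).1) (hev'.mono fun n hn => hn.2.1)
    obtain ⟨w₂, hw₂, hl₂⟩ := key j (fun n => (z n).2) (hev'.mono fun n hn => hn.2.2)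
    obtain ⟨n0, hn0⟩ := hev'.exists
    exact ⟨(w₁, w₂), Or.inl ⟨i, j, hn0.1, hw₁, hw₂⟩, hl₁.prodMk_nhds hl₂⟩
  · have h1 : ∀ n, ∃ i : Fin N, ∃ s a : ℝ, (∃ i, ∃ s, ∃ a ∈ Icc η (L i (τ n) - η),
        z n = (x i (τ n) s, x i (τ n) (s + a))) →
        a ∈ Icc η (L i (τ n) - η) ∧ z n = (x i (τ n) s, x i (τ n) (s + a)) := by
      intro n
      by_cases hn : ∃ i, ∃ s, ∃ a ∈ Icc η (L i (τ n) - η),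
        z n = (x i (τ n) s, x i (τ n) (s + a))
      · obtain ⟨i, s, a, hsa⟩ := hn
        exact ⟨i, s, a, fun _ => hsa⟩
      · obtain ⟨n0, i, -⟩ := h.exists
        exact ⟨i, 0, 0, fun h => absurd h hn⟩
    choose i' s a hsa using h1
    obtain ⟨i, hev⟩ := exists_eventually_eq_of_finite U i'
    have hev' : ∀ᶠ n in (U : Filter ι), a n ∈ Icc η (L i (τ n) - η) ∧
        z n = (x i (τ n) (s n), x i (τ n) (s n + a n)) := by
      filter_upwards [h, hev] with n hn hn'
      have := hsa n hn
      rwa [hn'] at this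
    have hLlim : Tendsto (fun n => L i (τ n)) U (𝓝 (L i t₀)) :=
      tendsto_length hH hκ (show 0 < 2 * η by positivity) (fun n => hL i _ (hτ n))
        (fun n => hsol.param i _ (hτ n)) (fun n => hh n i) (hsol.param i t₀ ht₀) (hd i)
    obtain ⟨a₀, -, ha₀⟩ := (isCompact_Icc (a := η) (b := L i t₀ + 1)).ultrafilter_le_nhds
      (U.map a) (by
      rw [Ultrafilter.coe_map, le_principal_iff, mem_map]
      filter_upwards [hev', hLlim.eventually (gt_mem_nhds (lt_add_one (L i t₀)))] with n hn hn'
      exact ⟨hn.1.1, by linarith [hn.1.2]⟩)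
    have ha₀' : Tendsto a U (𝓝 a₀) := ha₀
    have haη : a₀ ∈ Icc η (L i t₀ - η) :=
      ⟨ge_of_tendsto ha₀' (hev'.mono fun n hn => hn.1.1),
        le_of_tendsto_of_tendsto ha₀' (hLlim.sub_const η) (hev'.mono fun n hn => hn.1.2)⟩
    obtain ⟨σ, c, hc, hlim'⟩ := exists_shift_limit hH hκ (fun n => hsol.param i _ (hτ n))
      (fun n => hh n i) (hsol.param i t₀ ht₀) (hd i) s
    have b1 := (hlim' (fun _ => 0) 0 tendsto_const_nhds).1
    have b2 := (hlim' a a₀ ha₀').1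
    refine ⟨(x i t₀ (σ + c * 0), x i t₀ (σ + c * a₀)), Or.inr ⟨i, _, _, ?_, rfl⟩, ?_⟩
    · have hLp := (hsol.param i t₀ ht₀).length_pos
      rcases hc with rfl | rfl
      · exact (forall_le_abs_iff hLp).mpr ⟨a₀, haη, 0, by simp⟩
      -- When the limit reverses the orientation, the gap `a₀` turns into `L - a₀`, which lies in
      -- the same window.
      · refine (forall_le_abs_iff hLp).mpr ⟨L i t₀ - a₀, ⟨by linarith [haη.2], by
          linarith [haη.1]⟩, -1, by push_cast; ring⟩
    · refine (b1.prodMk_nhds b2).congr' ?_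
      filter_upwards [hev'] with n hn
      rw [hn.2, add_zero]

/-- Approximability of competing pairs gives upper semicontinuity of the separation, as closedness
under limits gives lower semicontinuity. -/
lemma exists_approx_competingPairs (hη : 0 < η) (hH : 0 ≤ H) (hκ : 0 < κ)
    (hsol : IsPatchSolution α T θ Ω x L)
    (hL : ∀ i, ∀ t ∈ Ico 0 T, 2 * η ≤ L i t) (hτ : ∀ n, τ n ∈ Ico 0 T) (ht₀ : t₀ ∈ Ico 0 T)
    (hlim : Tendsto τ U (𝓝 t₀)) (hh : ∀ n i, IsHolderCurve H κ (x i (τ n)))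
    {w : Plane × Plane} (hw : w ∈ competingPairs η Ω x L t₀) :
    ∃ z : ι → Plane × Plane, (∀ n, z n ∈ competingPairs η Ω x L (τ n)) ∧ Tendsto z U (𝓝 w) := by
  have hd := hsol.tendsto_hausdorffEDist hτ ht₀ hlim
  have happ : ∀ i, ∀ p ∈ frontier (Ω i t₀), ∃ z : ι → Plane, (∀ n, z n ∈ frontier (Ω i (τ n))) ∧
      Tendsto z U (𝓝 p) := fun i p hp =>
    exists_approx_of_hausdorffEDist (fun n => ⟨_, (hsol.param i _ (hτ n)).mem 0⟩) (hd i) hp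
      (fun n => (hsol.param i _ (hτ n)).isCompact)
  rcases (mem_competingPairs_iff hsol ht₀).mp hw with ⟨i, j, hij, h1, h2⟩ | ⟨i, s, a, ha, rfl⟩
  · obtain ⟨z₁, hz₁, hl₁⟩ := happ i _ h1
    obtain ⟨z₂, hz₂, hl₂⟩ := happ j _ h2
    exact ⟨fun n => (z₁ n, z₂ n), fun n => Or.inl ⟨i, j, hij, hz₁ n, hz₂ n⟩,
      hl₁.prodMk_nhds hl₂⟩
  · have hp₀ := hsol.param i t₀ ht₀
    obtain ⟨z₁, hz₁, hl₁⟩ := happ i _ (hp₀.mem s)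
    have h1 : ∀ n, ∃ r, x i (τ n) r = z₁ n := fun n => by
      have := hz₁ n
      rwa [← (hsol.param i _ (hτ n)).range_eq] at this
    choose r hr using h1
    have hLlim : Tendsto (fun n => L i (τ n)) U (𝓝 (L i t₀)) :=
      tendsto_length hH hκ (show 0 < 2 * η by positivity) (fun n => hL i _ (hτ n))
        (fun n => hsol.param i _ (hτ n)) (fun n => hh n i) hp₀ (hd i)
    obtain ⟨σ, c, hc, hlim'⟩ := exists_shift_limit hH hκ (fun n => hsol.param i _ (hτ n))
      (fun n => hh n i) hp₀ (hd i) r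
    have b1 := (hlim' (fun _ => 0) 0 tendsto_const_nhds).1
    have hσs : x i t₀ σ = x i t₀ s := by
      refine tendsto_nhds_unique ?_ hl₁
      simpa [hr] using b1
    obtain ⟨m, hm⟩ := hp₀.eq_iff.mp hσs
    -- The gap `a` is clamped to the window at time `τ n`, which is nonempty because `2 * η ≤ L`;
    -- the clamping disappears in the limit.
    let b : ι → ℝ := fun n => max η (min a (L i (τ n) - η))
    have hbmem : ∀ n, b n ∈ Icc η (L i (τ n) - η) := fun n =>
      ⟨le_max_left _ _, max_le (by linarith [hL i _ (hτ n)]) (min_le_right _ _)⟩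
    have hblim : Tendsto b U (𝓝 a) := by
      have : Tendsto b U (𝓝 (max η (min a (L i t₀ - η)))) :=
        tendsto_const_nhds.max (tendsto_const_nhds.min (hLlim.sub_const η))
      rwa [min_eq_left ha.2, max_eq_right ha.1] at this
    have b2 := (hlim' (fun n => c * b n) (c * a) (hblim.const_mul c)).1
    have hcc : c * (c * a) = a := by rcases hc with rfl | rfl <;> ring
    rw [hcc, hm, show s + m * L i t₀ + a = s + a + m * L i t₀ by ring,
      hp₀.periodic.int_mul m (s + a)] at b2
    rw [mul_zero, add_zero, hσs] at b1
    refine ⟨fun n => (x i (τ n) (r n + 0), x i (τ n) (r n + c * b n)),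
      fun n => Or.inr ⟨i, _, _, ?_, rfl⟩, b1.prodMk_nhds b2⟩
    have hLp := (hsol.param i _ (hτ n)).length_pos
    rw [add_zero]
    rcases hc with rfl | rfl
    · exact (forall_le_abs_iff hLp).mpr ⟨b n, hbmem n, 0, by simp⟩
    · exact (forall_le_abs_iff hLp).mpr ⟨L i (τ n) - b n, ⟨by linarith [(hbmem n).2], by
          linarith [(hbmem n).1]⟩, -1, by push_cast; ring⟩

lemma competingPairs_nonempty (hsol : IsPatchSolution α T θ Ω x L)
    (hL : ∀ i, ∀ t ∈ Ico 0 T, 2 * η ≤ L i t) {t : ℝ} (ht : t ∈ Ico 0 T) (i : Fin N) :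
    (competingPairs η Ω x L t).Nonempty :=
  ⟨_, (mem_competingPairs_iff hsol ht).mpr
    (Or.inr ⟨i, 0, η, ⟨le_rfl, by linarith [hL i t ht]⟩, rfl⟩)⟩

lemma separation_le {t : ℝ} {z : Plane × Plane} (hz : z ∈ competingPairs η Ω x L t) :
    separation η Ω x L t ≤ edist z.1 z.2 :=
  iInf₂_le z hz

/-- A minimizing sequence at a fixed time converges along a free ultrafilter on `ℕ`: closedness of
competing pairs is applied with constant time. -/
lemma exists_minimizer (hη : 0 < η) (hH : 0 ≤ H) (hκ : 0 < κ) (hsol : IsPatchSolution α T θ Ω x L)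
    (hL : ∀ i, ∀ t ∈ Ico 0 T, 2 * η ≤ L i t) {t : ℝ} (ht : t ∈ Ico 0 T)
    (hh : ∀ i, IsHolderCurve H κ (x i t)) (i : Fin N) :
    ∃ z ∈ competingPairs η Ω x L t, edist z.1 z.2 = separation η Ω x L t := by
  have hne := competingPairs_nonempty hsol hL ht i
  have h1 : separation η Ω x L t
      = sInf ((fun z : Plane × Plane => edist z.1 z.2) '' competingPairs η Ω x L t) := by
    rw [sInf_image]; rfl
  obtain ⟨u, -, hu, hmem⟩ := exists_seq_tendsto_sInf (hne.image fun z => edist z.1 z.2)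
    (OrderBot.bddBelow _)
  choose z hz hzu using hmem
  obtain ⟨w, hw, hlim⟩ := exists_tendsto_competingPairs (U := Filter.hyperfilter ℕ)
    (τ := fun _ => t) hη hH hκ hsol hL (fun _ => ht) ht tendsto_const_nhds (fun _ => hh) hz
  refine ⟨w, hw, ?_⟩
  rw [h1]
  have hc : Continuous fun z : Plane × Plane => edist z.1 z.2 := by fun_prop
  refine tendsto_nhds_unique ((hc.tendsto w).comp hlim) ?_
  have := hu.mono_left (Nat.hyperfilter_le_atTop)
  exact this.congr fun n => (hzu n).symm

/-- The separation distance depends continuously on time. -/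
lemma tendsto_separation (hη : 0 < η) (hH : 0 ≤ H) (hκ : 0 < κ)
    (hsol : IsPatchSolution α T θ Ω x L)
    (hL : ∀ i, ∀ t ∈ Ico 0 T, 2 * η ≤ L i t) (hτ : ∀ n, τ n ∈ Ico 0 T) (ht₀ : t₀ ∈ Ico 0 T)
    (hlim : Tendsto τ U (𝓝 t₀)) (hh : ∀ n i, IsHolderCurve H κ (x i (τ n)))
    (hh₀ : ∀ i, IsHolderCurve H κ (x i t₀)) (i : Fin N) :
    Tendsto (fun n => separation η Ω x L (τ n)) U (𝓝 (separation η Ω x L t₀)) := by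
  have hc : Continuous fun z : Plane × Plane => edist z.1 z.2 := by fun_prop
  obtain ⟨w, hw, hws⟩ := exists_minimizer hη hH hκ hsol hL ht₀ hh₀ i
  obtain ⟨z, hz, hzw⟩ := exists_approx_competingPairs hη hH hκ hsol hL hτ ht₀ hlim hh hw
  have h1 := fun n => exists_minimizer hη hH hκ hsol hL (hτ n) (hh n) i
  choose y hy hys using h1
  obtain ⟨v, hv, hyv⟩ := exists_tendsto_competingPairs hη hH hκ hsol hL hτ ht₀ hlim hh hy
  have h2 : Tendsto (fun n => edist (y n).1 (y n).2) U (𝓝 (edist v.1 v.2)) :=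
    (hc.tendsto v).comp hyv
  have h3 : edist v.1 v.2 ≤ separation η Ω x L t₀ := by
    rw [← hws]
    refine le_of_tendsto_of_tendsto h2 ((hc.tendsto w).comp hzw) (Eventually.of_forall fun n => ?_)
    simp only [Function.comp_apply]
    rw [hys n]
    exact separation_le (hz n)
  rw [le_antisymm h3 (separation_le hv)] at h2
  exact h2.congr hys

end Separation

/-! ### Pointwise bounds extracted from the boundary norm. -/

section Norms

variable {N : ℕ} {k : ℕ} {γ t M : ℝ} {x : Fin N → ℝ → ℝ → Plane}

lemma enorm_iteratedDeriv_le (j : Fin N) {l : ℕ} (hl : l ≤ k) (s : ℝ) :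
    ‖iteratedDeriv l (x j t) s‖ₑ ≤ boundaryNorm k γ x t := by
  calc ‖iteratedDeriv l (x j t) s‖ₑ ≤ ⨆ s, ‖iteratedDeriv l (x j t) s‖ₑ :=
        le_iSup (fun s => ‖iteratedDeriv l (x j t) s‖ₑ) s
    _ ≤ ∑ l ∈ Finset.range (k + 1), ⨆ s, ‖iteratedDeriv l (x j t) s‖ₑ :=
        Finset.single_le_sum (f := fun l => ⨆ s, ‖iteratedDeriv l (x j t) s‖ₑ)
          (fun _ _ => zero_le) (Finset.mem_range.mpr (by omega))
    _ ≤ _ := le_self_add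
    _ ≤ boundaryNorm k γ x t := le_iSup (fun j =>
        (∑ l ∈ Finset.range (k + 1), ⨆ s, ‖iteratedDeriv l (x j t) s‖ₑ) +
        ⨆ (s : ℝ) (r : ℝ) (_ : s ≠ r),
        ‖iteratedDeriv k (x j t) s - iteratedDeriv k (x j t) r‖ₑ / ENNReal.ofReal (|s - r| ^ γ)) j

lemma enorm_iteratedDeriv_sub_le (j : Fin N) {s r : ℝ} (hsr : s ≠ r) :
    ‖iteratedDeriv k (x j t) s - iteratedDeriv k (x j t) r‖ₑ / ENNReal.ofReal (|s - r| ^ γ)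
      ≤ boundaryNorm k γ x t := by
  calc _ ≤ ⨆ (s : ℝ) (r : ℝ) (_ : s ≠ r),
        ‖iteratedDeriv k (x j t) s - iteratedDeriv k (x j t) r‖ₑ
          / ENNReal.ofReal (|s - r| ^ γ) :=
        le_iSup_of_le s (le_iSup_of_le r (le_iSup_of_le hsr le_rfl))
    _ ≤ _ := le_add_self
    _ ≤ boundaryNorm k γ x t := le_iSup (fun j =>
        (∑ l ∈ Finset.range (k + 1), ⨆ s, ‖iteratedDeriv l (x j t) s‖ₑ) +
        ⨆ (s : ℝ) (r : ℝ) (_ : s ≠ r),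
        ‖iteratedDeriv k (x j t) s - iteratedDeriv k (x j t) r‖ₑ / ENNReal.ofReal (|s - r| ^ γ)) j

variable (hM : boundaryNorm k γ x t ≤ ENNReal.ofReal M)
include hM

lemma norm_iteratedDeriv_le_of_boundaryNorm_le (hM0 : 0 ≤ M) (j : Fin N) {l : ℕ} (hl : l ≤ k)
    (s : ℝ) : ‖iteratedDeriv l (x j t) s‖ ≤ M := by
  have h := (enorm_iteratedDeriv_le j hl s).trans hM
  rwa [← ofReal_norm, ENNReal.ofReal_le_ofReal_iff hM0] at h

lemma norm_iteratedDeriv_sub_le_of_boundaryNorm_le (hM0 : 0 ≤ M) (hγ : 0 < γ) (j : Fin N)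
    (s r : ℝ) : ‖iteratedDeriv k (x j t) s - iteratedDeriv k (x j t) r‖ ≤ M * |s - r| ^ γ := by
  rcases eq_or_ne s r with rfl | hsr
  · simp [Real.zero_rpow hγ.ne']
  have hpos : 0 < |s - r| ^ γ := Real.rpow_pos_of_pos (abs_pos.mpr (sub_ne_zero.mpr hsr)) _
  have h := (enorm_iteratedDeriv_sub_le j hsr).trans hM
  rwa [ENNReal.div_le_iff (by simpa using hpos) ENNReal.ofReal_ne_top, ← ofReal_norm,
    ← ENNReal.ofReal_mul hM0, ENNReal.ofReal_le_ofReal_iff (by positivity)] at h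

end Norms

/-- The Hölder exponent of the tangent of a `C^{k,γ}` curve. -/
def tangentExp (k : ℕ) (γ : ℝ) : ℝ := min ((k : ℝ) + γ - 1) 1

lemma tangentExp_pos {k : ℕ} {γ : ℝ} (hk : 1 ≤ k) (hγ : 0 < γ) : 0 < tangentExp k γ := by
  have : (1 : ℝ) ≤ k := by exact_mod_cast hk
  exact lt_min (by linarith) one_pos

lemma tangentExp_one {γ : ℝ} (hγ : γ ≤ 1) : tangentExp 1 γ = γ := by
  simp [tangentExp, hγ]

lemma tangentExp_two {γ : ℝ} (hγ : 0 < γ) : tangentExp 2 γ = 1 := by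
  rw [tangentExp, min_eq_right]; push_cast; linarith

section HolderSolution

variable {N : ℕ} {k : ℕ} {γ α T η ρ : ℝ} {θ : Fin N → ℝ} {Ω : Fin N → ℝ → Set Plane}
  {x : Fin N → ℝ → ℝ → Plane} {L : Fin N → ℝ → ℝ}

/-- For `k = 2` the tangent is Lipschitz because the second derivative is bounded by `M`; for `k =
1` its Hölder seminorm is part of the norm. -/
lemma IsHolderPatchSolution.isHolderCurve (hsol : IsHolderPatchSolution k γ α T θ Ω x L)
    (hk : k = 1 ∨ k = 2) (hγ : 0 < γ) (hγ₁ : γ ≤ 1) {t M : ℝ} (ht : t ∈ Ico 0 T) (hM0 : 0 ≤ M)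
    (hM : boundaryNorm k γ x t ≤ ENNReal.ofReal M) (i : Fin N) :
    IsHolderCurve M (tangentExp k γ) (x i t) where
  differentiable := (hsol.param i t ht).differentiable
  unit_speed := (hsol.param i t ht).unit_speed
  holder s r := by
    rcases hk with rfl | rfl
    · rw [tangentExp_one hγ₁]
      simpa [iteratedDeriv_one] using
        norm_iteratedDeriv_sub_le_of_boundaryNorm_le hM hM0 hγ i s r
    · rw [tangentExp_two hγ, Real.rpow_one]
      have h1 : Differentiable ℝ (deriv (x i t)) := by
        have h2 := hsol.contDiff_param i t ht
        have h3 : ContDiff ℝ (1 + 1) (x i t) := by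
          convert h2 using 1; norm_num
        exact (contDiff_succ_iff_deriv.mp h3).2.2.differentiable one_ne_zero
      have := Convex.norm_image_sub_le_of_norm_deriv_le (f := deriv (x i t)) (s := univ) (C := M)
        (x := r) (y := s) (fun u _ => h1 u) (fun u _ => by
          have h4 := norm_iteratedDeriv_le_of_boundaryNorm_le hM hM0 i (le_refl 2) u
          rwa [iteratedDeriv_succ, iteratedDeriv_one] at h4) convex_univ trivial trivial
      simpa using this

lemma IsHolderPatchSolution.exists_norm_bound (hsol : IsHolderPatchSolution k γ α T θ Ω x L)
    {T' : ℝ} (hT' : T' < T) :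
    ∃ M : ℝ, 1 ≤ M ∧ ∀ t ∈ Icc 0 T', boundaryNorm k γ x t ≤ ENNReal.ofReal M := by
  have h1 := hsol.norm_bounded T' hT'
  refine ⟨max 1 (⨆ t ∈ Icc 0 T', boundaryNorm k γ x t).toReal, le_max_left _ _, fun t ht => ?_⟩
  calc boundaryNorm k γ x t ≤ ⨆ t ∈ Icc 0 T', boundaryNorm k γ x t :=
        le_iSup₂ (f := fun t (_ : t ∈ Icc 0 T') => boundaryNorm k γ x t) t ht
    _ = ENNReal.ofReal (⨆ t ∈ Icc 0 T', boundaryNorm k γ x t).toReal :=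
        (ENNReal.ofReal_toReal h1.ne).symm
    _ ≤ _ := ENNReal.ofReal_le_ofReal (le_max_right _ _)

lemma IsHolderPatchSolution.boundaryNorm_ne_top (hsol : IsHolderPatchSolution k γ α T θ Ω x L)
    {t : ℝ} (ht : t ∈ Ico 0 T) : boundaryNorm k γ x t ≠ ∞ := by
  obtain ⟨M, -, h⟩ := hsol.exists_norm_bound ht.2
  exact ne_top_of_le_ne_top ENNReal.ofReal_ne_top (h t ⟨ht.1, le_rfl⟩)

lemma IsPatchSolution.one_le_boundaryNorm (hsol : IsPatchSolution α T θ Ω x L) (hk : 1 ≤ k)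
    {t : ℝ} (ht : t ∈ Ico 0 T) (i : Fin N) : 1 ≤ boundaryNorm k γ x t := by
  have h := enorm_iteratedDeriv_le (γ := γ) (x := x) (t := t) i hk 0
  rw [iteratedDeriv_one, ← ofReal_norm, (hsol.param i t ht).unit_speed] at h
  simpa using h

end HolderSolution

/-! ### Minimizing pairs -/

section Regular

variable {N : ℕ} {k : ℕ} {γ α T η ρ H κ : ℝ} {θ : Fin N → ℝ} {Ω : Fin N → ℝ → Set Plane}
  {x : Fin N → ℝ → ℝ → Plane} {L : Fin N → ℝ → ℝ}

/-- A competing pair at minimal distance which minimizes the distance among all boundary points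
within `δ` of it, competing or not. -/
structure IsRegularMinimizer (η : ℝ) (Ω : Fin N → ℝ → Set Plane) (x : Fin N → ℝ → ℝ → Plane)
    (L : Fin N → ℝ → ℝ) (δ t : ℝ) (z : Plane × Plane) : Prop where
  mem : z ∈ competingPairs η Ω x L t
  edist_eq : edist z.1 z.2 = separation η Ω x L t
  local_min : ∀ p ∈ totalBoundary Ω t, ∀ q ∈ totalBoundary Ω t, dist p z.1 < δ → dist q z.2 < δ →
    separation η Ω x L t ≤ edist p q

/-- A boundary point closer to `p` than `|p - q| = dist(C₁, C₂)` cannot lie on `C₂`. So near `p`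
only `C₁` is seen, near `q` only `C₂`, and the pair minimizes among all boundary points nearby. -/
lemma IsAdmissible.le_edist {Γ : Set Plane} {r : ℝ} {p q : Plane} (h : IsAdmissible Γ r p q)
    {p' q' : Plane} (hp' : p' ∈ Γ) (hq' : q' ∈ Γ) (hp : dist p' p < min (dist p q) (2 * r))
    (hq : dist q' q < min (dist p q) (2 * r)) : edist p q ≤ edist p' q' := by
  obtain ⟨C₁, C₂, -, -, -, hC, hp1, hq2, hd⟩ := h
  have key : ∀ y ∈ C₁, ∀ z ∈ C₂, edist p q ≤ edist y z := fun y hy z hz => by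
    rw [hd]; exact iInf₂_le_of_le y hy (iInf₂_le z hz)
  have h1 : p' ∈ C₁ ∪ C₂ := by
    rw [← hC]; exact ⟨hp', Or.inl (hp.trans_le (min_le_right _ _))⟩
  have h2 : q' ∈ C₁ ∪ C₂ := by
    rw [← hC]; exact ⟨hq', Or.inr (hq.trans_le (min_le_right _ _))⟩
  rcases h1 with h1 | h1
  · rcases h2 with h2 | h2
    · have := key _ h2 _ hq2
      rw [edist_dist, edist_dist, ENNReal.ofReal_le_ofReal_iff dist_nonneg] at this
      exact absurd (hq.trans_le (min_le_left _ _)) (not_lt.mpr this)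
    · exact key _ h1 _ h2
  · have := key _ hp1 _ h1
    rw [edist_dist, edist_dist, ENNReal.ofReal_le_ofReal_iff dist_nonneg, dist_comm p p'] at this
    exact absurd (hp.trans_le (min_le_left _ _)) (not_lt.mpr this)

variable {ι : Type*} {U : Ultrafilter ι} {τ : ι → ℝ} {t₀ : ℝ}

/-- With `δ` fixed, minimality over open `δ`-balls survives Hausdorff limits, since every boundary
point at time `t₀` is a limit of boundary points at the times `τ n`. -/
lemma IsRegularMinimizer.exists_tendsto (hη : 0 < η) (hH : 0 ≤ H) (hκ : 0 < κ)
    (hsol : IsPatchSolution α T θ Ω x L)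
    (hL : ∀ i, ∀ t ∈ Ico 0 T, 2 * η ≤ L i t) (hτ : ∀ n, τ n ∈ Ico 0 T) (ht₀ : t₀ ∈ Ico 0 T)
    (hlim : Tendsto τ U (𝓝 t₀)) (hh : ∀ n i, IsHolderCurve H κ (x i (τ n)))
    (hh₀ : ∀ i, IsHolderCurve H κ (x i t₀)) (i₀ : Fin N) {δ : ℝ} {z : ι → Plane × Plane}
    (hz : ∀ n, IsRegularMinimizer η Ω x L δ (τ n) (z n)) :
    ∃ w, IsRegularMinimizer η Ω x L δ t₀ w ∧ Tendsto z U (𝓝 w) := by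
  have hd := hsol.tendsto_hausdorffEDist hτ ht₀ hlim
  have happ : ∀ p ∈ totalBoundary Ω t₀, ∃ z : ι → Plane,
      (∀ n, z n ∈ totalBoundary Ω (τ n)) ∧ Tendsto z U (𝓝 p) := by
    intro p hp
    obtain ⟨i, hi⟩ := mem_iUnion.mp hp
    obtain ⟨z, hz, hl⟩ := exists_approx_of_hausdorffEDist
      (fun n => ⟨_, (hsol.param i _ (hτ n)).mem 0⟩) (hd i) hi
      (fun n => (hsol.param i _ (hτ n)).isCompact)
    exact ⟨z, fun n => mem_iUnion.mpr ⟨i, hz n⟩, hl⟩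
  obtain ⟨w, hw, hzw⟩ := exists_tendsto_competingPairs hη hH hκ hsol hL hτ ht₀ hlim hh
    (fun n => (hz n).mem)
  have hsep := tendsto_separation hη hH hκ hsol hL hτ ht₀ hlim hh hh₀ i₀
  have hc : Continuous fun z : Plane × Plane => edist z.1 z.2 := by fun_prop
  refine ⟨w, ⟨hw, ?_, ?_⟩, hzw⟩
  · refine tendsto_nhds_unique ((hc.tendsto w).comp hzw) (hsep.congr fun n => ?_)
    exact (hz n).edist_eq.symm
  · intro p hp q hq hpw hqw
    obtain ⟨p', hp', hpl⟩ := happ p hp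
    obtain ⟨q', hq', hql⟩ := happ q hq
    refine le_of_tendsto_of_tendsto hsep (hpl.edist hql) ?_
    have h1 : Tendsto (fun n => dist (p' n) (z n).1) U (𝓝 (dist p w.1)) :=
      hpl.dist ((continuous_fst.tendsto w).comp hzw)
    have h2 : Tendsto (fun n => dist (q' n) (z n).2) U (𝓝 (dist q w.2)) :=
      hql.dist ((continuous_snd.tendsto w).comp hzw)
    filter_upwards [h1.eventually (gt_mem_nhds hpw), h2.eventually (gt_mem_nhds hqw)] with n a b
    exact (hz n).local_min _ (hp' n) _ (hq' n) a b

lemma continuousOn_separation (hη : 0 < η) (hH : 0 ≤ H) (hκ : 0 < κ)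
    (hsol : IsPatchSolution α T θ Ω x L)
    (hL : ∀ i, ∀ t ∈ Ico 0 T, 2 * η ≤ L i t) {T' : ℝ} (hT' : T' < T)
    (hh : ∀ t ∈ Icc 0 T', ∀ i, IsHolderCurve H κ (x i t)) (i₀ : Fin N) :
    ContinuousOn (separation η Ω x L) (Icc 0 T') := by
  rw [continuousOn_iff_continuous_domRestrict, continuous_iff_continuousAt]
  intro t₀
  rw [ContinuousAt, tendsto_iff_ultrafilter]
  intro U hU
  exact tendsto_separation (ι := Icc 0 T') (τ := Subtype.val) hη hH hκ hsol hL
    (fun n => ⟨n.2.1, n.2.2.trans_lt hT'⟩) ⟨t₀.2.1, t₀.2.2.trans_lt hT'⟩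
    ((continuous_subtype_val.tendsto t₀).mono_left hU) (fun n => hh n n.2) (hh t₀ t₀.2) i₀

/-- The minimum is attained. Distinct boundaries are disjoint, and coinciding points of one curve
differ by a multiple of its length, which a gap in `[η, L - η]` is not. -/
lemma separation_pos (hη : 0 < η) (hH : 0 ≤ H) (hκ : 0 < κ) (hsol : IsPatchSolution α T θ Ω x L)
    (hL : ∀ i, ∀ t ∈ Ico 0 T, 2 * η ≤ L i t) {t : ℝ} (ht : t ∈ Ico 0 T)
    (hh : ∀ i, IsHolderCurve H κ (x i t)) (i₀ : Fin N) : 0 < separation η Ω x L t := by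
  obtain ⟨z, hz, h⟩ := exists_minimizer hη hH hκ hsol hL ht hh i₀
  rw [← h, edist_pos]
  rcases (mem_competingPairs_iff hsol ht).mp hz with ⟨i, j, hij, h1, h2⟩ | ⟨i, s, a, ha, rfl⟩
  · exact (hsol.disjoint t ht i j hij).ne_of_mem h1 h2
  · intro heq
    obtain ⟨m, hm⟩ := (hsol.param i t ht).eq_iff.mp heq
    have hLp := (hsol.param i t ht).length_pos
    have h1 : a = ((-m : ℤ) : ℝ) * L i t := by push_cast; linarith
    have h2 : 0 < a := hη.trans_le ha.1
    have h3 : a < L i t := by linarith [ha.2]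
    rw [h1] at h2 h3
    have h4 : (0 : ℝ) < ((-m : ℤ) : ℝ) := pos_of_mul_pos_left h2 hLp.le
    have h5 : (1 : ℝ) ≤ ((-m : ℤ) : ℝ) := by exact_mod_cast (Int.cast_pos.mp h4)
    nlinarith

lemma separation_ne_top (hη : 0 < η) (hH : 0 ≤ H) (hκ : 0 < κ)
    (hsol : IsPatchSolution α T θ Ω x L)
    (hL : ∀ i, ∀ t ∈ Ico 0 T, 2 * η ≤ L i t) {t : ℝ} (ht : t ∈ Ico 0 T)
    (hh : ∀ i, IsHolderCurve H κ (x i t)) (i₀ : Fin N) : separation η Ω x L t ≠ ∞ := by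
  obtain ⟨z, hz, h⟩ := exists_minimizer hη hH hκ hsol hL ht hh i₀
  rw [← h]
  exact edist_ne_top _ _

lemma localRadius_pos (hρ : 0 < ρ) {t : ℝ} (hpos : 0 < (boundaryNorm k γ x t).toReal) :
    0 < localRadius k γ ρ x t := by
  have : 0 < (100 * (boundaryNorm k γ x t).toReal) ^ (-(1 / ((k : ℝ) + γ - 1))) :=
    Real.rpow_pos_of_pos (by positivity) _
  unfold localRadius
  have := lt_min hρ this
  positivity

lemma le_localRadius {t M : ℝ} (hpos : 0 < (boundaryNorm k γ x t).toReal)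
    (hM : boundaryNorm k γ x t ≤ ENNReal.ofReal M) (hM0 : 0 ≤ M) (hβ : 0 < (k : ℝ) + γ - 1) :
    1 / 4 * min ρ ((100 * M) ^ (-(1 / ((k : ℝ) + γ - 1)))) ≤ localRadius k γ ρ x t := by
  unfold localRadius
  have h1 : (boundaryNorm k γ x t).toReal ≤ M := ENNReal.toReal_le_of_le_ofReal hM0 hM
  have h2 : (100 * M) ^ (-(1 / ((k : ℝ) + γ - 1)))
      ≤ (100 * (boundaryNorm k γ x t).toReal) ^ (-(1 / ((k : ℝ) + γ - 1))) := by
    apply Real.rpow_le_rpow_of_nonpos (by positivity) (by linarith)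
    rw [neg_nonpos]; positivity
  gcongr

/-- At every time some minimizing pair is a local minimizer, at a scale which is uniform on
compact time intervals, if this holds at almost every time by admissibility. -/
lemma exists_regularMinimizer (hη : 0 < η) (hρ : 0 < ρ) (hH : 0 ≤ H) (hκ : 0 < κ)
    (hsol : IsPatchSolution α T θ Ω x L)
    (hL : ∀ i, ∀ t ∈ Ico 0 T, 2 * η ≤ L i t) {T' M : ℝ} (hT'0 : 0 < T') (hT' : T' < T)
    (hh : ∀ t ∈ Icc 0 T', ∀ i, IsHolderCurve H κ (x i t)) (hk : 1 ≤ k) (hγ : 0 < γ)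
    (hM : ∀ t ∈ Icc 0 T', boundaryNorm k γ x t ≤ ENNReal.ofReal M)
    (hadm : ∀ᵐ t ∂(volume.restrict (Ico 0 T)), ∀ z ∈ competingPairs η Ω x L t,
      edist z.1 z.2 = separation η Ω x L t →
      IsAdmissible (totalBoundary Ω t) (localRadius k γ ρ x t) z.1 z.2) (i₀ : Fin N) :
    ∃ δ > 0, ∀ t ∈ Icc 0 T', ∃ z, IsRegularMinimizer η Ω x L δ t z := by
  have hIco : ∀ t ∈ Icc 0 T', t ∈ Ico 0 T := fun t ht => ⟨ht.1, ht.2.trans_lt hT'⟩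
  have hone : ∀ t ∈ Icc 0 T', 1 ≤ boundaryNorm k γ x t := fun t ht =>
    hsol.one_le_boundaryNorm hk (hIco t ht) i₀
  have hnt : ∀ t ∈ Icc 0 T', boundaryNorm k γ x t ≠ ∞ := fun t ht =>
    ne_top_of_le_ne_top ENNReal.ofReal_ne_top (hM t ht)
  have hnpos : ∀ t ∈ Icc 0 T', 0 < (boundaryNorm k γ x t).toReal := fun t ht =>
    ENNReal.toReal_pos (zero_lt_one.trans_le (hone t ht)).ne' (hnt t ht)
  have hM0 : 0 < M := by
    have h0 := left_mem_Icc.mpr hT'0.le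
    have := (hone 0 h0).trans (hM 0 h0)
    exact ENNReal.ofReal_pos.mp (zero_lt_one.trans_le this)
  have hβ : 0 < (k : ℝ) + γ - 1 := by
    have : (1 : ℝ) ≤ k := by exact_mod_cast hk
    linarith
  obtain ⟨tm, htm, hmin⟩ := isCompact_Icc.exists_isMinOn (nonempty_Icc.mpr hT'0.le)
    (continuousOn_separation hη hH hκ hsol hL hT' hh i₀)
  set m := (separation η Ω x L tm).toReal with hm
  have hmpos : 0 < m := ENNReal.toReal_pos
    (separation_pos hη hH hκ hsol hL (hIco _ htm) (hh _ htm) i₀).ne'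
    (separation_ne_top hη hH hκ hsol hL (hIco _ htm) (hh _ htm) i₀)
  set r₀ := 1 / 4 * min ρ ((100 * M) ^ (-(1 / ((k : ℝ) + γ - 1)))) with hr₀
  have hr₀pos : 0 < r₀ := by
    have : 0 < min ρ ((100 * M) ^ (-(1 / ((k : ℝ) + γ - 1)))) :=
      lt_min hρ (Real.rpow_pos_of_pos (by positivity) _)
    positivity
  -- `m` bounds the separation and `r₀` the local radius from below on `[0, T']`, so
  -- `IsAdmissible.le_edist` applies on `δ`-balls at all good times at once.
  set δ := min m (2 * r₀) with hδ
  have hδpos : 0 < δ := lt_min hmpos (by positivity)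
  refine ⟨δ, hδpos, fun t₀ ht₀ => ?_⟩
  set G : Set ℝ := {t | t ∈ Icc 0 T' ∧ ∀ z ∈ competingPairs η Ω x L t,
      edist z.1 z.2 = separation η Ω x L t →
      IsAdmissible (totalBoundary Ω t) (localRadius k γ ρ x t) z.1 z.2} with hG
  have hgood : ∀ t ∈ G, ∃ z, IsRegularMinimizer η Ω x L δ t z := by
    rintro t ⟨ht, hadm⟩
    obtain ⟨z, hz, hze⟩ := exists_minimizer hη hH hκ hsol hL (hIco _ ht) (hh _ ht) i₀
    refine ⟨z, hz, hze, fun p hp q hq hpz hqz => ?_⟩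
    rw [← hze]
    have h1 : m ≤ dist z.1 z.2 := by
      rw [dist_edist, hze]
      exact ENNReal.toReal_mono
        (separation_ne_top hη hH hκ hsol hL (hIco _ ht) (hh _ ht) i₀) (hmin ht)
    have h2 : δ ≤ min (dist z.1 z.2) (2 * localRadius k γ ρ x t) := by
      have := le_localRadius (ρ := ρ) (hnpos t ht) (hM t ht) hM0.le hβ
      exact min_le_min h1 (by linarith)
    exact (hadm z hz hze).le_edist hp hq (hpz.trans_le h2) (hqz.trans_le h2)
  -- The good times have full measure and are therefore dense; regular minimizers at good times
  -- converge to one at `t₀`.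
  have hclos : t₀ ∈ closure G := by
    have h1 : ∀ᵐ t ∂(volume.restrict (Ioo 0 T')), t ∈ G := by
      have h2 : ∀ᵐ t ∂(volume.restrict (Ioo 0 T')), _ :=
        ae_mono (Measure.restrict_mono (Ioo_subset_Ico_self.trans
          (Ico_subset_Ico_right hT'.le)) le_rfl) hadm
      filter_upwards [h2, ae_restrict_mem measurableSet_Ioo] with t ht ht'
      exact ⟨Ioo_subset_Icc_self ht', ht⟩
    have h3 : Ioo 0 T' ⊆ closure G := by
      intro s hs
      rw [mem_closure_iff]
      intro o ho hso
      by_contra hcon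
      rw [not_nonempty_iff_eq_empty] at hcon
      have h4 : volume (o ∩ Ioo 0 T') = 0 := by
        rw [ae_restrict_iff' measurableSet_Ioo] at h1
        refine measure_mono_null (fun u hu => ?_) h1
        simp only [mem_compl_iff, mem_ofPred_eq]
        intro hcon'
        have : u ∈ o ∩ G := ⟨hu.1, hcon' hu.2⟩
        rw [hcon] at this
        exact this
      exact ((ho.inter isOpen_Ioo).measure_pos volume ⟨s, hso, hs⟩).ne' h4
    have h5 : Icc 0 T' ⊆ closure G := by
      rw [← closure_Ioo hT'0.ne]
      exact closure_minimal h3 isClosed_closure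
    exact h5 ht₀
  have hNB : (comap (Subtype.val : G → ℝ) (𝓝 t₀)).NeBot := mem_closure_iff_comap_neBot.mp hclos
  have hlim : Tendsto (Subtype.val : G → ℝ)
      (Ultrafilter.of (comap (Subtype.val : G → ℝ) (𝓝 t₀))) (𝓝 t₀) :=
    tendsto_comap.mono_left (Ultrafilter.of_le _)
  choose z hz using fun n : G => hgood n n.2
  obtain ⟨w, hw, -⟩ := IsRegularMinimizer.exists_tendsto hη hH hκ hsol hL
    (fun n => hIco _ n.2.1) (hIco _ ht₀) hlim (fun n => hh _ n.2.1) (hh _ ht₀) i₀ hz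
  exact ⟨w, hw⟩

end Regular

/-! ### Patch functions -/

/-- A bounded, compactly supported measurable function that is constant on each connected set
avoiding the closed null set `Γ`. -/
structure IsPatchFunction (ω : Plane → ℝ) (Γ : Set Plane) (Θ B : ℝ) : Prop where
  measurable : Measurable ω
  bound : ∀ y, |ω y| ≤ Θ
  support : ∀ y, B < ‖y‖ → ω y = 0
  eq_of_preconnected : ∀ S : Set Plane, IsPreconnected S → Disjoint S Γ →
    ∀ a ∈ S, ∀ b ∈ S, ω a = ω b
  isClosed : IsClosed Γ
  null : volume Γ = 0

lemma IsPatchFunction.nonneg {ω : Plane → ℝ} {Γ : Set Plane} {Θ B : ℝ}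
    (h : IsPatchFunction ω Γ Θ B) : 0 ≤ Θ := (abs_nonneg _).trans (h.bound 0)

lemma IsPatchFunction.continuousAt {ω : Plane → ℝ} {Γ : Set Plane} {Θ B : ℝ}
    (h : IsPatchFunction ω Γ Θ B) {y : Plane} (hy : y ∉ Γ) : ContinuousAt ω y := by
  obtain ⟨ε, hε, hball⟩ := Metric.isOpen_iff.mp h.isClosed.isOpen_compl y hy
  have h1 : ω =ᶠ[𝓝 y] fun _ => ω y := by
    filter_upwards [Metric.ball_mem_nhds y hε] with w hw
    exact h.eq_of_preconnected _ (convex_ball y ε).isPreconnected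
      (disjoint_left.mpr fun u hu => hball hu) w hw y (Metric.mem_ball_self hε)
  exact continuousAt_const.congr h1.symm

/-- The point with coordinates `p` in the frame `(τ, τ^⊥)` based at `z`. -/
def framePoint (z τ : Plane) (p : ℝ × ℝ) : Plane := z + (p.1 • τ + p.2 • perp τ)

lemma continuous_framePoint (z τ : Plane) : Continuous (framePoint z τ) := by
  unfold framePoint; fun_prop

lemma continuous_framePoint_left (p : ℝ × ℝ) :
    Continuous fun zτ : Plane × Plane => framePoint zτ.1 zτ.2 p := by
  unfold framePoint
  have := continuous_perp
  fun_prop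

lemma inner_framePoint_sub {z τ : Plane} (hτ : ‖τ‖ = 1) (p : ℝ × ℝ) :
    inner ℝ (framePoint z τ p - z) τ = p.1 ∧ inner ℝ (framePoint z τ p - z) (perp τ) = p.2 := by
  have h1 : inner ℝ τ τ = (1 : ℝ) := by rw [real_inner_self_eq_norm_sq, hτ]; norm_num
  have h2 : inner ℝ (perp τ) (perp τ) = (1 : ℝ) := by rw [inner_perp_perp, h1]
  unfold framePoint
  rw [add_sub_cancel_left]
  simp only [inner_add_left, real_inner_smul_left, h1, h2, inner_perp_self, inner_perp_self_left]
  constructor <;> ring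

lemma norm_sq_framePoint_sub {z τ : Plane} (hτ : ‖τ‖ = 1) (p : ℝ × ℝ) :
    ‖framePoint z τ p - z‖ ^ 2 = p.1 ^ 2 + p.2 ^ 2 := by
  rw [norm_sq_frame hτ, (inner_framePoint_sub hτ p).1, (inner_framePoint_sub hτ p).2]

lemma measurePreserving_framePoint {z τ : Plane} (hτ : ‖τ‖ = 1) :
    MeasurePreserving (framePoint z τ) := by
  let A : Plane →ₗ[ℝ] Plane :=
    { toFun := fun w => w 0 • τ + w 1 • perp τ
      map_add' := fun v w => by simp only [PiLp.add_apply, add_smul]; abel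
      map_smul' := fun c w => by
        simp only [PiLp.smul_apply, smul_eq_mul, mul_smul, RingHom.id_apply, smul_add] }
  let A' : Plane →ₗᵢ[ℝ] Plane := ⟨A, fun w => by
    have h1 := norm_sq_framePoint_sub (z := 0) hτ (w 0, w 1)
    simp only [framePoint, sub_zero, zero_add] at h1
    have h2 : ‖w‖ ^ 2 = w 0 ^ 2 + w 1 ^ 2 := by
      rw [EuclideanSpace.norm_sq_eq]; simp [Fin.sum_univ_two]
    have h3 : ‖A w‖ ^ 2 = ‖w‖ ^ 2 := by rw [h2]; exact h1
    exact (sq_eq_sq₀ (norm_nonneg _) (norm_nonneg _)).mp h3⟩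
  have h1 := (volume_preserving_finTwoArrow ℝ).symm
  have h2 := (PiLp.volume_preserving_toLp (Fin 2)).comp h1
  have h3 := ((A'.toLinearIsometryEquiv rfl).measurePreserving).comp h2
  have h4 := (measurePreserving_add_left (volume : Measure Plane) z).comp h3
  have h5 : framePoint z τ = (fun v => z + v) ∘ (A'.toLinearIsometryEquiv rfl) ∘
      WithLp.toLp 2 ∘ MeasurableEquiv.finTwoArrow.symm := by
    ext1 p
    rfl
  rw [h5]
  exact h4

lemma measurableEmbedding_framePoint {z τ : Plane} (hτ : ‖τ‖ = 1) :
    MeasurableEmbedding (framePoint z τ) := by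
  refine (continuous_framePoint z τ).measurableEmbedding fun p q h => ?_
  have h1 := inner_framePoint_sub (z := z) hτ p
  have h2 := inner_framePoint_sub (z := z) hτ q
  rw [h] at h1
  exact Prod.ext (h1.1.symm.trans h2.1) (h1.2.symm.trans h2.2)

/-- The image of the line has Hausdorff dimension at most 1, hence vanishing two-dimensional
Hausdorff measure, which on `ℝ × ℝ` is Lebesgue measure. -/
lemma volume_range_of_lipschitz {x : ℝ → Plane} (hx : LipschitzWith 1 x) :
    volume (range x) = 0 := by
  have hτ : ‖(!₂[1, 0] : Plane)‖ = 1 := by simp [EuclideanSpace.norm_eq]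
  set τ : Plane := !₂[1, 0] with hτdef
  rw [← (measurePreserving_framePoint (z := 0) hτ).measure_preimage_emb
    (measurableEmbedding_framePoint hτ)]
  let g : ℝ → ℝ × ℝ := fun s => (inner ℝ (x s) τ, inner ℝ (x s) (perp τ))
  have hsub : framePoint 0 τ ⁻¹' range x ⊆ range g := by
    rintro p ⟨s, hs⟩
    refine ⟨s, ?_⟩
    have := inner_framePoint_sub (z := 0) hτ p
    rw [← hs, sub_zero] at this
    exact Prod.ext this.1 this.2
  have hin : ∀ v : Plane, ‖v‖ = 1 → LipschitzWith 1 fun s => (inner ℝ (x s) v : ℝ) := by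
    intro v hv
    refine LipschitzWith.of_dist_le_mul fun s r => ?_
    rw [Real.dist_eq, ← inner_sub_left]
    refine (abs_real_inner_le_norm _ _).trans ?_
    rw [hv, mul_one, ← dist_eq_norm]
    exact hx.dist_le_mul s r
  have hg : LipschitzWith 1 g := by
    have := (hin τ hτ).prodMk (hin (perp τ) (by rw [norm_perp, hτ]))
    simpa using this
  have hdim : dimH (range g) < ((2 : NNReal) : ℝ≥0∞) := by
    refine (hg.dimH_range_le).trans_lt ?_
    rw [Real.dimH_univ]
    exact_mod_cast one_lt_two
  have h0 := hausdorffMeasure_of_dimH_lt hdim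
  have h2 : ((2 : NNReal) : ℝ) = 2 := rfl
  rw [h2, hausdorffMeasure_prod_real] at h0
  exact measure_mono_null hsub h0

/-! ### The vorticity of a patch solution is a patch function. -/

section Vorticity

variable {N : ℕ} {α T : ℝ} {θ : Fin N → ℝ} {Ω : Fin N → ℝ → Set Plane}
  {x : Fin N → ℝ → ℝ → Plane} {L : Fin N → ℝ → ℝ}

lemma mem_iff_mem_of_preconnected {W S : Set Plane} (hW : IsOpen W) (hS : IsPreconnected S)
    (hd : Disjoint S (frontier W)) {a b : Plane} (ha : a ∈ S) (hb : b ∈ S) : a ∈ W ↔ b ∈ W := by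
  have hsub : S ⊆ W ∪ (closure W)ᶜ := by
    intro y hy
    by_cases h : y ∈ closure W
    · left
      by_contra hW'
      refine disjoint_left.mp hd hy ?_
      rw [hW.frontier_eq]
      exact ⟨h, hW'⟩
    · right; exact h
  have hdis : Disjoint W (closure W)ᶜ :=
    disjoint_compl_right.mono_left subset_closure
  rcases hS.subset_or_subset hW isClosed_closure.isOpen_compl hdis hsub with h | h
  · exact ⟨fun _ => h hb, fun _ => h ha⟩
  · exact ⟨fun h' => absurd (subset_closure h') (h ha), fun h' => absurd (subset_closure h') (h hb)⟩

lemma IsPatchSolution.isPatchFunction (hsol : IsPatchSolution α T θ Ω x L) {t B : ℝ}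
    (ht : t ∈ Ico 0 T) (hB0 : 0 ≤ B) (hB : ∀ i s, ‖x i t s‖ ≤ B) :
    IsPatchFunction (vorticity θ Ω t) (totalBoundary Ω t) (∑ i, |θ i|) B where
  measurable := by
    unfold vorticity
    exact Finset.measurable_sum _ fun i _ =>
      measurable_const.indicator (hsol.isOpen i t ht).measurableSet
  bound y := by
    refine (Finset.abs_sum_le_sum_abs _ _).trans (Finset.sum_le_sum fun i _ => ?_)
    by_cases h : y ∈ Ω i t <;> simp [h]
  support y hy := by
    refine Finset.sum_eq_zero fun i _ => indicator_of_notMem (fun hmem => ?_) _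
    -- The outward ray from `y` never meets a boundary, as all boundaries lie in the ball of radius
    -- `B`. A patch containing `y` would contain the whole ray, against boundedness.
    set S : Set Plane := (fun c : ℝ => c • y) '' Ici 1 with hS
    have hSc : IsPreconnected S :=
      isPreconnected_Ici.image _ (by fun_prop)
    have hy0 : 0 < ‖y‖ := hB0.trans_lt hy
    have hd : Disjoint S (frontier (Ω i t)) := by
      rw [disjoint_left]
      rintro _ ⟨c, hc, rfl⟩ hf
      rw [← (hsol.param i t ht).range_eq] at hf
      obtain ⟨s, hs⟩ := hf
      have h1 := hB i s
      rw [hs] at h1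
      simp only [norm_smul, Real.norm_eq_abs] at h1
      rw [mem_Ici] at hc
      rw [abs_of_nonneg (by linarith)] at h1
      nlinarith
    obtain ⟨R, hR⟩ := (hsol.isBounded i t ht).exists_norm_le
    have h2 : (max 1 ((|R| + 1) / ‖y‖)) • y ∈ Ω i t :=
      (mem_iff_mem_of_preconnected (hsol.isOpen i t ht) hSc hd (a := y)
        ⟨1, self_mem_Ici, one_smul _ _⟩ ⟨_, mem_Ici.mpr (le_max_left _ _), rfl⟩).mp hmem
    have h3 := hR _ h2
    rw [norm_smul, Real.norm_eq_abs, abs_of_pos (lt_of_lt_of_le one_pos (le_max_left _ _))] at h3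
    have h4 : (|R| + 1) / ‖y‖ * ‖y‖ ≤ max 1 ((|R| + 1) / ‖y‖) * ‖y‖ := by
      gcongr; exact le_max_right _ _
    rw [div_mul_cancel₀ _ hy0.ne'] at h4
    linarith [le_abs_self R]
  eq_of_preconnected S hS hd a ha b hb := by
    refine Finset.sum_congr rfl fun i _ => ?_
    have h1 : Disjoint S (frontier (Ω i t)) :=
      hd.mono_right (subset_iUnion (fun i => frontier (Ω i t)) i)
    have h2 := mem_iff_mem_of_preconnected (hsol.isOpen i t ht) hS h1 ha hb
    by_cases h : a ∈ Ω i t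
    · rw [indicator_of_mem h, indicator_of_mem (h2.mp h)]
    · rw [indicator_of_notMem h, indicator_of_notMem (fun h' => h (h2.mpr h'))]
  isClosed := isClosed_iUnion_of_finite fun i => isClosed_frontier
  null := by
    refine measure_iUnion_null fun i => ?_
    rw [← (hsol.param i t ht).range_eq]
    refine volume_range_of_lipschitz ?_
    refine lipschitzWith_of_nnnorm_deriv_le (hsol.param i t ht).differentiable fun s => ?_
    rw [← NNReal.coe_le_coe, coe_nnnorm, (hsol.param i t ht).unit_speed]
    rfl

end Vorticity

/-! ### Integrals over strips and tails -/

/-- Fubini: each section is an interval of length `2 * h a`, wherever its centre lies. The shape of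
the centre line is thus irrelevant, which is why parabolas cost no more than lines. -/
lemma lintegral_strip {S : Set ℝ} (hS : MeasurableSet S) {c h : ℝ → ℝ} {Ψ : ℝ → ℝ≥0∞}
    (hc : Measurable c) (hh : Measurable h) (hΨ : Measurable Ψ) :
    ∫⁻ p in {p : ℝ × ℝ | p.1 ∈ S ∧ |p.2 - c p.1| ≤ h p.1}, Ψ p.1
      = ∫⁻ a in S, ENNReal.ofReal (2 * h a) * Ψ a := by
  have hm : MeasurableSet {p : ℝ × ℝ | p.1 ∈ S ∧ |p.2 - c p.1| ≤ h p.1} :=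
    (measurable_fst hS).inter (measurableSet_le
      ((measurable_snd.sub (hc.comp measurable_fst)).abs) (hh.comp measurable_fst))
  have hme : Measurable ({p : ℝ × ℝ | p.1 ∈ S ∧ |p.2 - c p.1| ≤ h p.1}.indicator
      fun p : ℝ × ℝ => Ψ p.1) := (hΨ.comp measurable_fst).indicator hm
  rw [← lintegral_indicator hm, Measure.volume_eq_prod, lintegral_prod _ hme.aemeasurable,
    ← lintegral_indicator hS]
  congr 1
  ext a
  by_cases ha : a ∈ S
  · rw [indicator_of_mem ha]
    have h1 : ∀ b : ℝ, {p : ℝ × ℝ | p.1 ∈ S ∧ |p.2 - c p.1| ≤ h p.1}.indicator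
        (fun p => Ψ p.1) (a, b) = (Icc (c a - h a) (c a + h a)).indicator (fun _ => Ψ a) b := by
      intro b
      have h2 : (a, b) ∈ {p : ℝ × ℝ | p.1 ∈ S ∧ |p.2 - c p.1| ≤ h p.1}
          ↔ b ∈ Icc (c a - h a) (c a + h a) := by
        simp only [mem_ofPred_eq, ha, true_and, abs_le, mem_Icc]
        constructor <;> rintro ⟨h3, h4⟩ <;> constructor <;> linarith
      by_cases hb : b ∈ Icc (c a - h a) (c a + h a)
      · rw [indicator_of_mem hb, indicator_of_mem (h2.mpr hb)]
      · rw [indicator_of_notMem hb, indicator_of_notMem (fun h => hb (h2.mp h))]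
    simp_rw [h1]
    rw [lintegral_indicator measurableSet_Icc, setLIntegral_const, Real.volume_Icc, mul_comm]
    congr 2; ring
  · rw [indicator_of_notMem ha]
    have h1 : ∀ b : ℝ, {p : ℝ × ℝ | p.1 ∈ S ∧ |p.2 - c p.1| ≤ h p.1}.indicator
        (fun p => Ψ p.1) (a, b) = 0 := fun b => indicator_of_notMem (fun h => ha h.1) _
    simp_rw [h1]
    simp

lemma lintegral_abs_le (S : Set ℝ) (hS : MeasurableSet S) (hS0 : S ⊆ Ioi 0) (f : ℝ → ℝ≥0∞) :
    ∫⁻ a in {a : ℝ | |a| ∈ S}, f |a| ≤ 2 * ∫⁻ a in S, f a := by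
  have h1 : {a : ℝ | |a| ∈ S} ⊆ S ∪ -S := by
    intro a ha
    rcases abs_choice a with h | h
    · left; rw [← h]; exact ha
    · right; rw [Set.mem_neg, ← h]; exact ha
  have h2 : ∫⁻ a in -S, f |a| = ∫⁻ a in S, f |a| := by
    have := (Measure.measurePreserving_neg (volume : Measure ℝ)).setLIntegral_comp_preimage_emb
      (Homeomorph.neg ℝ).measurableEmbedding (fun a => f |a|) S
    simpa using this
  have h3 : ∫⁻ a in S, f |a| = ∫⁻ a in S, f a := by
    refine setLIntegral_congr_fun hS fun a ha => ?_
    rw [abs_of_pos (hS0 ha)]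
  calc ∫⁻ a in {a : ℝ | |a| ∈ S}, f |a| ≤ ∫⁻ a in S ∪ -S, f |a| := lintegral_mono_set h1
    _ ≤ _ := lintegral_union_le _ _ _
    _ = 2 * ∫⁻ a in S, f a := by rw [h2, h3, two_mul]

lemma lintegral_rpow_Ioc {e r : ℝ} (he : -1 < e) (hr : 0 < r) :
    ∫⁻ a in Ioc 0 r, ENNReal.ofReal (a ^ e) = ENNReal.ofReal (r ^ (e + 1) / (e + 1)) := by
  rw [← ofReal_integral_eq_lintegral_ofReal]
  · rw [← intervalIntegral.integral_of_le hr.le, integral_rpow (Or.inl he),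
      Real.zero_rpow (by linarith), sub_zero]
  · exact (intervalIntegrable_iff_integrableOn_Ioc_of_le hr.le).mp
      (intervalIntegral.intervalIntegrable_rpow' he)
  · filter_upwards [ae_restrict_mem measurableSet_Ioc] with a ha
    exact Real.rpow_nonneg ha.1.le _

lemma lintegral_rpow_Ioi {e r : ℝ} (he : e < -1) (hr : 0 < r) :
    ∫⁻ a in Ioi r, ENNReal.ofReal (a ^ e) = ENNReal.ofReal (r ^ (e + 1) / (-(e + 1))) := by
  rw [← ofReal_integral_eq_lintegral_ofReal (integrableOn_Ioi_rpow_of_lt he hr)]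
  · rw [integral_Ioi_rpow_of_lt he hr, div_neg, neg_div]
  · filter_upwards [ae_restrict_mem measurableSet_Ioi] with a ha
    exact Real.rpow_nonneg (hr.le.trans (le_of_lt ha)) _

/-- Polar coordinates for the sup norm of `ℝ × ℝ`, whose unit ball has area 4; the factor 8 is the
dimension times this area. -/
lemma lintegral_prod_norm_tail {e r : ℝ} (he : e < -2) (hr : 0 < r) :
    ∫⁻ p in {p : ℝ × ℝ | r < ‖p‖}, ENNReal.ofReal (‖p‖ ^ e)
      = ENNReal.ofReal (8 * (r ^ (e + 2) / (-(e + 2)))) := by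
  have hm : MeasurableSet {p : ℝ × ℝ | r < ‖p‖} := measurableSet_lt measurable_const measurable_norm
  let f : ℝ → ℝ := (Ioi r).indicator fun y => y ^ e
  have hff : ∀ p : ℝ × ℝ, {p : ℝ × ℝ | r < ‖p‖}.indicator (fun p => ‖p‖ ^ e) p = f ‖p‖ := by
    intro p
    by_cases h : r < ‖p‖
    · rw [indicator_of_mem (show p ∈ {p : ℝ × ℝ | r < ‖p‖} from h)]
      exact (indicator_of_mem (s := Ioi r) h fun y => y ^ e).symm
    · rw [indicator_of_notMem (show p ∉ {p : ℝ × ℝ | r < ‖p‖} from h)]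
      exact (indicator_of_notMem (s := Ioi r) h fun y => y ^ e).symm
  have hdim : Module.finrank ℝ (ℝ × ℝ) = 2 := by simp
  have hy : EqOn (fun y : ℝ => y ^ (Module.finrank ℝ (ℝ × ℝ) - 1) • f y)
      ((Ioi r).indicator fun y => y ^ (e + 1)) (Ioi 0) := by
    intro y hy
    rw [mem_Ioi] at hy
    simp only [hdim, f]
    by_cases h : y ∈ Ioi r
    · rw [indicator_of_mem h, indicator_of_mem h, Real.rpow_add hy, Real.rpow_one]
      simp [mul_comm]
    · rw [indicator_of_notMem h, indicator_of_notMem h, smul_zero]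
  have hint' : IntegrableOn ((Ioi r).indicator fun y : ℝ => y ^ (e + 1)) (Ioi 0) :=
    ((integrable_indicator_iff measurableSet_Ioi).mpr
      (integrableOn_Ioi_rpow_of_lt (by linarith) hr)).integrableOn
  have hint : Integrable (fun p : ℝ × ℝ => f ‖p‖) := by
    rw [integrable_fun_norm_addHaar]
    exact hint'.congr_fun hy.symm measurableSet_Ioi
  have hint2 : IntegrableOn (fun p : ℝ × ℝ => ‖p‖ ^ e) {p : ℝ × ℝ | r < ‖p‖} := by
    rw [← integrable_indicator_iff hm]
    exact hint.congr (Eventually.of_forall fun p => (hff p).symm)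
  rw [← ofReal_integral_eq_lintegral_ofReal hint2 (Eventually.of_forall fun p =>
    Real.rpow_nonneg (norm_nonneg p) e), ← integral_indicator hm]
  simp_rw [hff]
  rw [integral_fun_norm_addHaar, setIntegral_congr_fun measurableSet_Ioi hy,
    setIntegral_indicator measurableSet_Ioi, inter_eq_right.mpr (Ioi_subset_Ioi hr.le),
    integral_Ioi_rpow_of_lt (by linarith) hr, hdim]
  have hball : (volume : Measure (ℝ × ℝ)).real (Metric.ball 0 1) = 4 := by
    rw [Measure.real, show (0 : ℝ × ℝ) = (0, 0) from rfl, ← ball_prod_same,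
      Measure.volume_eq_prod, Measure.prod_prod, Real.volume_ball]
    norm_num
  rw [hball]
  congr 1
  simp only [smul_eq_mul, nsmul_eq_mul]
  rw [show e + 1 + 1 = e + 2 by ring]
  push_cast
  have : e + 2 ≠ 0 := by linarith
  field_simp
  ring

/-- The kernel `|p|^{-2-2α}` (Euclidean length) in frame coordinates. -/
def kern (α : ℝ) (p : ℝ × ℝ) : ℝ := (p.1 ^ 2 + p.2 ^ 2) ^ (-(1 + α))

/-- The part of `ω` that is odd with respect to reflection in the normal line at `z`. -/
def oddPart (ω : Plane → ℝ) (z τ : Plane) (p : ℝ × ℝ) : ℝ :=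
  ω (framePoint z τ p) - ω (framePoint z τ (-p.1, p.2))

/-- The velocity component along `τ^⊥`, as an absolutely convergent integral. -/
def vel (α : ℝ) (ω : Plane → ℝ) (z τ : Plane) : ℝ :=
  -(1 / 2) * ∫ p : ℝ × ℝ, p.1 * kern α p * oddPart ω z τ p

/-- Near `z`, the set `Γ` lies in the thin region `|b| ≤ A |a|^{1+κ}` around the line through `z`
in the direction `τ`. -/
def FlatAt (Γ : Set Plane) (z τ : Plane) (r A κ : ℝ) : Prop :=
  ∀ y ∈ Γ, |inner ℝ (y - z) τ| ≤ r → |inner ℝ (y - z) (perp τ)| ≤ r →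
    |inner ℝ (y - z) (perp τ)| ≤ A * |inner ℝ (y - z) τ| ^ (1 + κ)

/-! ### Pointwise kernel bounds and vanishing of the odd part. -/

section Kernel

variable {α : ℝ}

lemma kern_nonneg (p : ℝ × ℝ) : 0 ≤ kern α p := Real.rpow_nonneg (by positivity) _

lemma measurable_kern : Measurable (kern α) := by
  unfold kern; fun_prop

lemma kern_le_of_sq_le (hα : 0 < α) {m : ℝ} (hm : 0 < m) {p : ℝ × ℝ}
    (h : m ^ 2 ≤ p.1 ^ 2 + p.2 ^ 2) : kern α p ≤ m ^ (-(2 + 2 * α)) := by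
  have h1 : (m ^ 2) ^ (-(1 + α)) = m ^ (-(2 + 2 * α)) := by
    rw [← Real.rpow_natCast, ← Real.rpow_mul hm.le]; congr 1; push_cast; ring
  rw [← h1]
  exact Real.rpow_le_rpow_of_nonpos (by positivity) h (by linarith)

lemma sq_norm_le (p : ℝ × ℝ) : ‖p‖ ^ 2 ≤ p.1 ^ 2 + p.2 ^ 2 := by
  rw [Prod.norm_def]
  rcases max_choice ‖p.1‖ ‖p.2‖ with h | h <;> rw [h, Real.norm_eq_abs, sq_abs] <;> nlinarith [sq_nonneg p.1, sq_nonneg p.2]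

lemma abs_fst_mul_kern_le (hα : 0 < α) {p : ℝ × ℝ} (hp : p.1 ≠ 0) :
    |p.1| * kern α p ≤ |p.1| ^ (-1 - 2 * α) := by
  have h0 := abs_pos.mpr hp
  have h1 := kern_le_of_sq_le hα h0 (p := p) (by rw [sq_abs]; nlinarith [sq_nonneg p.2])
  calc |p.1| * kern α p ≤ |p.1| * |p.1| ^ (-(2 + 2 * α)) := by gcongr
    _ = |p.1| ^ (-1 - 2 * α) := by
      rw [← Real.rpow_one_add' h0.le (by linarith)]; congr 1; ring

lemma abs_fst_mul_kern_le_norm (hα : 0 < α) {p : ℝ × ℝ} (hp : 0 < ‖p‖) :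
    |p.1| * kern α p ≤ ‖p‖ ^ (-1 - 2 * α) := by
  have h1 := kern_le_of_sq_le hα hp (sq_norm_le p)
  have h2 : |p.1| ≤ ‖p‖ := norm_fst_le p
  calc |p.1| * kern α p ≤ ‖p‖ * ‖p‖ ^ (-(2 + 2 * α)) := by
        gcongr; exact kern_nonneg p
    _ = ‖p‖ ^ (-1 - 2 * α) := by
      rw [← Real.rpow_one_add' hp.le (by linarith)]; congr 1; ring

end Kernel

section OddPart

variable {ω : Plane → ℝ} {Γ : Set Plane} {Θ B : ℝ} {z τ : Plane} {r A κ : ℝ}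

/-- The graph of `m` joins the point to its mirror image off `Γ`, and `ω` is constant on such a
connected set. -/
lemma IsPatchFunction.oddPart_eq_zero_of_graph (hω : IsPatchFunction ω Γ Θ B) {p : ℝ × ℝ}
    {m : ℝ → ℝ} (hm : Continuous m) (h1 : m p.1 = p.2) (h2 : m (-p.1) = p.2)
    (hΓ : ∀ y, |y| ≤ |p.1| → framePoint z τ (y, m y) ∉ Γ) : oddPart ω z τ p = 0 := by
  have hS : IsPreconnected ((fun y => framePoint z τ (y, m y)) '' Icc (-|p.1|) |p.1|) :=
    isPreconnected_Icc.image _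
      ((continuous_framePoint z τ).comp (continuous_id.prodMk hm)).continuousOn
  have hd : Disjoint ((fun y => framePoint z τ (y, m y)) '' Icc (-|p.1|) |p.1|) Γ := by
    rw [disjoint_left]
    rintro _ ⟨y, hy, rfl⟩
    exact hΓ y (abs_le.mpr hy)
  unfold oddPart
  rw [sub_eq_zero]
  refine hω.eq_of_preconnected _ hS hd _ ⟨p.1, abs_le.mp le_rfl, ?_⟩ _
    ⟨-p.1, abs_le.mp (abs_neg p.1).le, ?_⟩
  · simp only [h1]
  · simp only [h2]

/-- The edge `y ↦ ±A |y|^(1+κ)` of the thin region is even; its vertical translate through `p` stays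
off the region and inside the box between `p` and its mirror image. -/
lemma FlatAt.oddPart_eq_zero (hf : FlatAt Γ z τ r A κ) (hω : IsPatchFunction ω Γ Θ B)
    (hτ : ‖τ‖ = 1) (hA : 0 ≤ A) (hκ : 0 < κ) {p : ℝ × ℝ} (h1 : |p.1| ≤ r) (h2 : |p.2| ≤ r)
    (h : A * |p.1| ^ (1 + κ) < |p.2|) : oddPart ω z τ p = 0 := by
  have hg : Continuous fun y : ℝ => A * |y| ^ (1 + κ) :=
    continuous_const.mul (continuous_abs.rpow_const fun _ => Or.inr (by linarith))
  have hmono : ∀ y, |y| ≤ |p.1| → A * |y| ^ (1 + κ) ≤ A * |p.1| ^ (1 + κ) := fun y hy => by gcongr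
  have key : ∀ m : ℝ → ℝ, ∀ y, |y| ≤ |p.1| → |m y| ≤ r → A * |y| ^ (1 + κ) < |m y| →
      framePoint z τ (y, m y) ∉ Γ := by
    intro m y hy hr hlt hmem
    obtain ⟨e1, e2⟩ := inner_framePoint_sub (z := z) hτ (y, m y)
    have h3 := hf _ hmem
    rw [e1, e2] at h3
    exact absurd (h3 (hy.trans h1) hr) (not_le.mpr hlt)
  have hnn : ∀ y : ℝ, 0 ≤ A * |y| ^ (1 + κ) := fun y => by positivity
  rcases le_total 0 p.2 with hp | hp
  · rw [abs_of_nonneg hp] at h h2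
    obtain ⟨m, hm⟩ : ∃ m : ℝ → ℝ, m = fun y => p.2 + A * |y| ^ (1 + κ) - A * |p.1| ^ (1 + κ) :=
      ⟨_, rfl⟩
    have hmc : Continuous m := by rw [hm]; exact (continuous_const.add hg).sub continuous_const
    refine hω.oddPart_eq_zero_of_graph hmc (by rw [hm]; ring)
      (by simp only [hm, abs_neg]; ring) fun y hy => key m y hy ?_ ?_
    · simp only [hm]
      rw [abs_le]; constructor <;> linarith [hmono y hy, hnn y]
    · simp only [hm]
      refine lt_of_lt_of_le ?_ (le_abs_self _); linarith
  · rw [abs_of_nonpos hp] at h h2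
    obtain ⟨m, hm⟩ : ∃ m : ℝ → ℝ, m = fun y => p.2 - A * |y| ^ (1 + κ) + A * |p.1| ^ (1 + κ) :=
      ⟨_, rfl⟩
    have hmc : Continuous m := by rw [hm]; exact (continuous_const.sub hg).add continuous_const
    refine hω.oddPart_eq_zero_of_graph hmc (by rw [hm]; ring)
      (by simp only [hm, abs_neg]; ring) fun y hy => key m y hy ?_ ?_
    · simp only [hm]
      rw [abs_le]; constructor <;> linarith [hmono y hy, hnn y]
    · simp only [hm]
      refine lt_of_lt_of_le ?_ (neg_le_abs _); linarith

lemma IsPatchFunction.abs_oddPart_le (hω : IsPatchFunction ω Γ Θ B) (p : ℝ × ℝ) :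
    |oddPart ω z τ p| ≤ 2 * Θ := by
  unfold oddPart
  have h1 := abs_le.mp (hω.bound (framePoint z τ p))
  have h2 := abs_le.mp (hω.bound (framePoint z τ (-p.1, p.2)))
  rw [abs_le]; constructor <;> linarith

lemma IsPatchFunction.eq_zero_of_norm (hω : IsPatchFunction ω Γ Θ B) (hτ : ‖τ‖ = 1) (hz : ‖z‖ ≤ B)
    {p : ℝ × ℝ} (hp : 2 * B < ‖p‖) : ω (framePoint z τ p) = 0 := by
  apply hω.support
  have h1 := norm_sq_framePoint_sub (z := z) hτ p
  have h2 := sq_norm_le p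
  have h3 : ‖p‖ ≤ ‖framePoint z τ p - z‖ := by
    rw [← h1] at h2
    exact (sq_le_sq₀ (norm_nonneg _) (norm_nonneg _)).mp h2
  have h4 := norm_sub_le (framePoint z τ p) z
  linarith

lemma IsPatchFunction.oddPart_eq_zero_of_norm (hω : IsPatchFunction ω Γ Θ B) (hτ : ‖τ‖ = 1)
    (hz : ‖z‖ ≤ B) {p : ℝ × ℝ} (hp : 2 * B < ‖p‖) : oddPart ω z τ p = 0 := by
  unfold oddPart
  rw [hω.eq_zero_of_norm hτ hz hp, hω.eq_zero_of_norm hτ hz (p := (-p.1, p.2)), sub_zero]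
  simpa [Prod.norm_def] using hp

lemma IsPatchFunction.measurable_oddPart (hω : IsPatchFunction ω Γ Θ B) :
    Measurable (oddPart ω z τ) := by
  unfold oddPart
  have h1 := (continuous_framePoint z τ).measurable
  exact (hω.measurable.comp h1).sub (hω.measurable.comp (h1.comp
    ((measurable_fst.neg).prodMk measurable_snd)))

end OddPart

/-- The strip `|b| ≤ A |a|^{1+κ}`, `0 < |a| ≤ r`. -/
def strip (r A κ : ℝ) : Set (ℝ × ℝ) := {p | p.1 ∈ {a : ℝ | |a| ∈ Ioc 0 r} ∧
  |p.2 - 0| ≤ A * |p.1| ^ (1 + κ)}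

lemma measurableSet_strip (r A κ : ℝ) : MeasurableSet (strip r A κ) :=
  (measurable_fst (measurable_norm measurableSet_Ioc)).inter (measurableSet_le
    ((measurable_snd.sub_const 0).abs) (by fun_prop))

lemma lintegral_strip_rpow_le {S : Set ℝ} (hS : MeasurableSet S) (hS0 : S ⊆ Ioi 0) {c : ℝ → ℝ}
    (hc : Measurable c) {A b e : ℝ} (hA : 0 ≤ A) :
    ∫⁻ p in {p : ℝ × ℝ | p.1 ∈ {a : ℝ | |a| ∈ S} ∧ |p.2 - c p.1| ≤ A * |p.1| ^ b},
      ENNReal.ofReal (|p.1| ^ e) ≤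
    ENNReal.ofReal (4 * A) * ∫⁻ a in S, ENNReal.ofReal (a ^ (b + e)) := by
  rw [lintegral_strip (S := {a : ℝ | |a| ∈ S}) (Ψ := fun a => ENNReal.ofReal (|a| ^ e)) (h := fun a => A * |a| ^ b)
    (measurable_norm hS) hc (by fun_prop) (by fun_prop)]
  refine (lintegral_abs_le S hS hS0
    (fun a => ENNReal.ofReal (2 * (A * a ^ b)) * ENNReal.ofReal (a ^ e))).trans ?_
  have h1 : ∫⁻ a in S, ENNReal.ofReal (2 * (A * a ^ b)) * ENNReal.ofReal (a ^ e)
      = ∫⁻ a in S, ENNReal.ofReal (2 * A) * ENNReal.ofReal (a ^ (b + e)) := by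
    refine setLIntegral_congr_fun hS fun a ha => ?_
    have ha0 : 0 < a := hS0 ha
    rw [← ENNReal.ofReal_mul (by positivity), ← ENNReal.ofReal_mul (by positivity),
      Real.rpow_add ha0]
    congr 1; ring
  rw [h1, lintegral_const_mul _ (by fun_prop), ← mul_assoc]
  refine mul_le_mul_left (le_of_eq ?_) _
  rw [show (4 : ℝ) * A = 2 * (2 * A) by ring, ENNReal.ofReal_mul (by norm_num : (0 : ℝ) ≤ 2)]
  simp

/-- An integrable majorant of the symmetrized velocity integrand. -/
def velBound (α Θ B r A κ : ℝ) (p : ℝ × ℝ) : ℝ :=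
  2 * Θ * ((strip r A κ).indicator (fun p => |p.1| ^ (-1 - 2 * α)) p
    + (Metric.closedBall 0 (2 * B)).indicator (fun _ => r ^ (-1 - 2 * α)) p)

/-! ### The normal velocity as an absolutely convergent integral. -/

section Vel

variable {α : ℝ} {ω : Plane → ℝ} {Γ : Set Plane} {Θ B : ℝ} {z τ : Plane} {r A κ : ℝ}

/-- Integrating over the height of the strip gives a factor `|a|^(1+κ)`, so the singularity
`|a|^(-1-2α)` becomes `|a|^(κ-2α)`, which is integrable at 0 precisely when `κ > 2α - 1`. -/
lemma integrable_velBound (hr : 0 < r) (hA : 0 ≤ A) (hκα : 2 * α - 1 < κ) :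
    Integrable (velBound α Θ B r A κ) := by
  refine Integrable.const_mul (Integrable.add ?_ ?_) _
  · rw [integrable_indicator_iff (measurableSet_strip r A κ)]
    refine ⟨(measurable_fst.abs.pow_const _).aestronglyMeasurable, ?_⟩
    rw [hasFiniteIntegral_iff_ofReal (Eventually.of_forall fun p => by positivity)]
    refine (lintegral_strip_rpow_le (c := fun _ => 0) measurableSet_Ioc
      Ioc_subset_Ioi_self measurable_const hA).trans_lt ?_
    rw [lintegral_rpow_Ioc (by linarith) hr]
    exact ENNReal.mul_lt_top ENNReal.ofReal_lt_top ENNReal.ofReal_lt_top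
  · rw [integrable_indicator_iff Metric.isClosed_closedBall.measurableSet]
    exact integrableOn_const (isCompact_closedBall _ _).measure_lt_top.ne

lemma FlatAt.abs_integrand_le (hf : FlatAt Γ z τ r A κ) (hω : IsPatchFunction ω Γ Θ B)
    (hα : 0 < α) (hτ : ‖τ‖ = 1) (hz : ‖z‖ ≤ B) (hA : 0 ≤ A) (hκ : 0 < κ) (hr : 0 < r)
    (p : ℝ × ℝ) : |p.1 * kern α p * oddPart ω z τ p| ≤ velBound α Θ B r A κ p := by
  have hΘ := hω.nonneg
  have hnn1 : 0 ≤ (strip r A κ).indicator (fun p : ℝ × ℝ => |p.1| ^ (-1 - 2 * α)) p :=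
    indicator_nonneg (fun _ _ => by positivity) _
  have hnn2 : 0 ≤ (Metric.closedBall 0 (2 * B)).indicator
      (fun _ : ℝ × ℝ => r ^ (-1 - 2 * α)) p := indicator_nonneg (fun _ _ => by positivity) _
  rcases eq_or_ne (oddPart ω z τ p) 0 with h0 | h0
  · rw [h0, mul_zero, abs_zero]
    unfold velBound; positivity
  rcases eq_or_ne p.1 0 with h1 | h1
  · rw [h1, zero_mul, zero_mul, abs_zero]
    unfold velBound; positivity
  have hpB : ‖p‖ ≤ 2 * B := by
    by_contra h
    exact h0 (hω.oddPart_eq_zero_of_norm hτ hz (not_le.mp h))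
  rw [abs_mul, abs_mul, abs_of_nonneg (kern_nonneg p), mul_comm]
  unfold velBound
  refine mul_le_mul (hω.abs_oddPart_le p) ?_ (mul_nonneg (abs_nonneg _) (kern_nonneg p))
    (by positivity)
  rcases le_or_gt ‖p‖ r with hpr | hpr
  · have h1r : |p.1| ≤ r := (norm_fst_le p).trans hpr
    have h2r : |p.2| ≤ r := (norm_snd_le p).trans hpr
    have hmem : p ∈ strip r A κ := by
      refine ⟨⟨abs_pos.mpr h1, h1r⟩, ?_⟩
      rw [sub_zero]
      by_contra h
      exact h0 (hf.oddPart_eq_zero hω hτ hA hκ h1r h2r (not_le.mp h))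
    rw [indicator_of_mem hmem]
    linarith [abs_fst_mul_kern_le hα h1]
  · have hmem : p ∈ Metric.closedBall (0 : ℝ × ℝ) (2 * B) := by simpa using hpB
    rw [indicator_of_mem hmem]
    have h3 := abs_fst_mul_kern_le_norm hα (hr.trans hpr)
    have h4 : ‖p‖ ^ (-1 - 2 * α) ≤ r ^ (-1 - 2 * α) :=
      Real.rpow_le_rpow_of_nonpos hr hpr.le (by linarith)
    linarith

lemma IsPatchFunction.measurable_integrand (hω : IsPatchFunction ω Γ Θ B) :
    Measurable fun p : ℝ × ℝ => p.1 * kern α p * oddPart ω z τ p :=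
  (measurable_fst.mul measurable_kern).mul hω.measurable_oddPart

lemma FlatAt.integrable (hf : FlatAt Γ z τ r A κ) (hω : IsPatchFunction ω Γ Θ B)
    (hα : 0 < α) (hτ : ‖τ‖ = 1) (hz : ‖z‖ ≤ B) (hA : 0 ≤ A) (hκ : 0 < κ) (hr : 0 < r)
    (hκα : 2 * α - 1 < κ) : Integrable fun p : ℝ × ℝ => p.1 * kern α p * oddPart ω z τ p :=
  (integrable_velBound hr hA hκα).mono' hω.measurable_integrand.aestronglyMeasurable
    (Eventually.of_forall (hf.abs_integrand_le hω hα hτ hz hA hκ hr))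

lemma FlatAt.abs_vel_le (hf : FlatAt Γ z τ r A κ) (hω : IsPatchFunction ω Γ Θ B)
    (hα : 0 < α) (hτ : ‖τ‖ = 1) (hz : ‖z‖ ≤ B) (hA : 0 ≤ A) (hκ : 0 < κ) (hr : 0 < r)
    (hκα : 2 * α - 1 < κ) : |vel α ω z τ| ≤ 1 / 2 * ∫ p, velBound α Θ B r A κ p := by
  unfold vel
  rw [abs_mul, abs_neg, abs_of_pos (by norm_num : (0 : ℝ) < 1 / 2)]
  refine mul_le_mul_of_nonneg_left ?_ (by norm_num)
  exact norm_integral_le_of_norm_le (f := fun p : ℝ × ℝ => p.1 * kern α p * oddPart ω z τ p)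
    (integrable_velBound hr hA hκα) (Eventually.of_forall (hf.abs_integrand_le hω hα hτ hz hA hκ hr))

lemma measurePreserving_reflect :
    MeasurePreserving (fun p : ℝ × ℝ => (-p.1, p.2)) :=
  (Measure.measurePreserving_neg (volume : Measure ℝ)).prod (MeasurePreserving.id volume)

lemma measurableEmbedding_reflect :
    MeasurableEmbedding (fun p : ℝ × ℝ => (-p.1, p.2)) :=
  ((Homeomorph.neg ℝ).prodCongr (Homeomorph.refl ℝ)).measurableEmbedding

/-- Truncated velocity integrals after symmetrization. -/
lemma IsPatchFunction.setIntegral_eq (hω : IsPatchFunction ω Γ Θ B) (hα : 0 < α) (hτ : ‖τ‖ = 1)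
    (hz : ‖z‖ ≤ B) {ε : ℝ} (hε : 0 < ε) :
    ∫ y in {y : Plane | ε < ‖z - y‖},
      inner ℝ (perp (z - y)) (perp τ) / ‖z - y‖ ^ (2 + 2 * α) * ω y
    = -(1 / 2) * ∫ p : ℝ × ℝ, {p : ℝ × ℝ | ε ^ 2 < p.1 ^ 2 + p.2 ^ 2}.indicator
        (fun p => p.1 * kern α p * oddPart ω z τ p) p := by
  set D : Set (ℝ × ℝ) := {p : ℝ × ℝ | ε ^ 2 < p.1 ^ 2 + p.2 ^ 2} with hD
  have hDm : MeasurableSet D := measurableSet_lt (by fun_prop) (by fun_prop)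
  set F : ℝ × ℝ → ℝ := fun p => p.1 * kern α p * ω (framePoint z τ p) with hF
  have hm : MeasurableSet {y : Plane | ε < ‖z - y‖} := measurableSet_lt (by fun_prop) (by fun_prop)
  have e1 : ∫ y in {y : Plane | ε < ‖z - y‖},
      inner ℝ (perp (z - y)) (perp τ) / ‖z - y‖ ^ (2 + 2 * α) * ω y
      = -∫ p, D.indicator F p := by
    rw [← integral_indicator hm, ← (measurePreserving_framePoint (z := z) hτ).integral_comp
      (measurableEmbedding_framePoint hτ), ← integral_neg]
    congr 1
    ext p
    have hn := norm_sq_framePoint_sub (z := z) hτ p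
    have hi := (inner_framePoint_sub (z := z) hτ p).1
    have hiff : framePoint z τ p ∈ {y : Plane | ε < ‖z - y‖} ↔ p ∈ D := by
      simp only [hD, mem_ofPred_eq]
      rw [← hn, norm_sub_rev, sq_lt_sq₀ hε.le (norm_nonneg _)]
    by_cases hp : p ∈ D
    · rw [indicator_of_mem hp, indicator_of_mem (hiff.mpr hp)]
      have h2 : ‖z - framePoint z τ p‖ ^ (2 + 2 * α) = (p.1 ^ 2 + p.2 ^ 2) ^ (1 + α) := by
        rw [← hn, norm_sub_rev, ← Real.rpow_natCast, ← Real.rpow_mul (norm_nonneg _)]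
        congr 1; push_cast; ring
      have h3 : inner ℝ (perp (z - framePoint z τ p)) (perp τ) = -p.1 := by
        rw [inner_perp_perp, ← hi, ← inner_neg_left, neg_sub]
      simp only [hF, kern]
      rw [h2, h3, Real.rpow_neg (by positivity)]
      ring
    · rw [indicator_of_notMem hp, indicator_of_notMem (fun h => hp (hiff.mp h)), neg_zero]
  have hFm : Measurable F := (measurable_fst.mul measurable_kern).mul
    (hω.measurable.comp (continuous_framePoint z τ).measurable)
  have hint : Integrable (D.indicator F) := by
    have hb : Integrable ((Metric.closedBall (0 : ℝ × ℝ) (2 * B)).indicator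
        fun _ => (2 * B) * ε ^ (-(2 + 2 * α)) * Θ) := by
      rw [integrable_indicator_iff Metric.isClosed_closedBall.measurableSet]
      exact integrableOn_const (isCompact_closedBall _ _).measure_lt_top.ne
    refine hb.mono' (hFm.indicator hDm).aestronglyMeasurable (Eventually.of_forall fun p => ?_)
    have hB : 0 ≤ B := (norm_nonneg z).trans hz
    have hΘ := hω.nonneg
    by_cases hp : p ∈ D
    · rw [indicator_of_mem hp]
      by_cases hpB : ‖p‖ ≤ 2 * B
      · rw [indicator_of_mem (by simpa using hpB)]
        simp only [hF]
        rw [norm_mul, norm_mul, Real.norm_eq_abs (kern α p), abs_of_nonneg (kern_nonneg p)]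
        gcongr
        · exact kern_nonneg p
        · exact (norm_fst_le p).trans hpB
        · exact kern_le_of_sq_le hα hε (le_of_lt hp)
        · exact hω.bound _
      · simp only [hF]
        rw [hω.eq_zero_of_norm hτ hz (not_le.mp hpB), mul_zero, norm_zero]
        exact indicator_nonneg (fun _ _ => by positivity) _
    · rw [indicator_of_notMem hp, norm_zero]
      exact indicator_nonneg (fun _ _ => by positivity) _
  -- The truncation is symmetric and `p.1 * kern α p` is odd in `p.1`, so averaging with the
  -- reflected integral replaces `ω` by half its odd part.
  have hrefl := measurePreserving_reflect.integral_comp measurableEmbedding_reflect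
    (D.indicator F)
  have hint' : Integrable (fun p : ℝ × ℝ => D.indicator F (-p.1, p.2)) :=
    (measurePreserving_reflect.integrable_comp_emb measurableEmbedding_reflect).mpr hint
  have hsum : ∫ p, D.indicator (fun p => p.1 * kern α p * oddPart ω z τ p) p
      = (∫ p, D.indicator F p) + ∫ p : ℝ × ℝ, D.indicator F (-p.1, p.2) := by
    rw [← integral_add hint hint']
    congr 1
    ext p
    have hiff : ((-p.1, p.2) : ℝ × ℝ) ∈ D ↔ p ∈ D := by simp [hD]
    by_cases hp : p ∈ D
    · rw [indicator_of_mem hp, indicator_of_mem hp, indicator_of_mem (hiff.mpr hp)]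
      simp only [hF, oddPart, kern]
      ring_nf
    · rw [indicator_of_notMem hp, indicator_of_notMem hp,
        indicator_of_notMem (fun h => hp (hiff.mp h)), add_zero]
  rw [e1, hsum, hrefl]
  ring

/-- The principal value defining the velocity component exists. -/
lemma FlatAt.tendsto_velocity (hf : FlatAt Γ z τ r A κ) (hω : IsPatchFunction ω Γ Θ B)
    (hα : 0 < α) (hτ : ‖τ‖ = 1) (hz : ‖z‖ ≤ B) (hA : 0 ≤ A) (hκ : 0 < κ) (hr : 0 < r)
    (hκα : 2 * α - 1 < κ) :
    Tendsto (fun ε : ℝ => ∫ y in {y : Plane | ε < ‖z - y‖},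
      inner ℝ (perp (z - y)) (perp τ) / ‖z - y‖ ^ (2 + 2 * α) * ω y) (𝓝[>] 0)
      (𝓝 (vel α ω z τ)) := by
  have h1 : Tendsto (fun ε : ℝ => ∫ p : ℝ × ℝ, {p : ℝ × ℝ | ε ^ 2 < p.1 ^ 2 + p.2 ^ 2}.indicator
        (fun p => p.1 * kern α p * oddPart ω z τ p) p) (𝓝[>] 0)
      (𝓝 (∫ p : ℝ × ℝ, p.1 * kern α p * oddPart ω z τ p)) := by
    refine tendsto_integral_filter_of_dominated_convergence (velBound α Θ B r A κ) ?_ ?_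
      (integrable_velBound hr hA hκα) ?_
    · refine Eventually.of_forall fun ε => ?_
      exact (hω.measurable_integrand.indicator
        (measurableSet_lt (by fun_prop) (by fun_prop))).aestronglyMeasurable
    · refine Eventually.of_forall fun ε => Eventually.of_forall fun p => ?_
      refine (norm_indicator_le_norm_self
        (fun p : ℝ × ℝ => p.1 * kern α p * oddPart ω z τ p) p).trans ?_
      exact hf.abs_integrand_le hω hα hτ hz hA hκ hr p
    · refine Eventually.of_forall fun p => ?_
      rcases eq_or_ne p.1 0 with h0 | h0
      · have h3 : ∀ ε : ℝ, {p : ℝ × ℝ | ε ^ 2 < p.1 ^ 2 + p.2 ^ 2}.indicator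
            (fun p => p.1 * kern α p * oddPart ω z τ p) p
            = p.1 * kern α p * oddPart ω z τ p := by
          intro ε
          by_cases hp : p ∈ {p : ℝ × ℝ | ε ^ 2 < p.1 ^ 2 + p.2 ^ 2}
          · rw [indicator_of_mem hp]
          · rw [indicator_of_notMem hp, h0, zero_mul, zero_mul]
        simp_rw [h3]
        exact tendsto_const_nhds
      · have hpos : 0 < p.1 ^ 2 + p.2 ^ 2 := by positivity
        have h4 : ∀ᶠ ε : ℝ in 𝓝[>] 0, ε ^ 2 < p.1 ^ 2 + p.2 ^ 2 := by
          have hc : Continuous fun ε : ℝ => ε ^ 2 := by fun_prop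
          have := hc.tendsto 0
          rw [zero_pow two_ne_zero] at this
          exact nhdsWithin_le_nhds (this.eventually (gt_mem_nhds hpos))
        refine tendsto_const_nhds.congr' ?_
        filter_upwards [h4] with ε hε
        exact (indicator_of_mem (s := {p : ℝ × ℝ | ε ^ 2 < p.1 ^ 2 + p.2 ^ 2}) hε
          (fun p => p.1 * kern α p * oddPart ω z τ p)).symm
  refine (h1.const_mul (-(1 / 2))).congr' ?_
  filter_upwards [self_mem_nhdsWithin] with ε hε
  exact (hω.setIntegral_eq hα hτ hz hε).symm

lemma FlatAt.velocityComponent_eq (hf : FlatAt Γ z τ r A κ) (hω : IsPatchFunction ω Γ Θ B)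
    (hα : 0 < α) (hτ : ‖τ‖ = 1) (hz : ‖z‖ ≤ B) (hA : 0 ≤ A) (hκ : 0 < κ) (hr : 0 < r)
    (hκα : 2 * α - 1 < κ) : velocityComponent α ω z (perp τ) = vel α ω z τ :=
  (hf.tendsto_velocity hω hα hτ hz hA hκ hr hκα).limUnder_eq

/-- Continuity of the velocity along uniformly flat families of frames. -/
lemma continuous_vel {zc τc : ℝ → Plane} (hz : Continuous zc) (hτ : Continuous τc)
    (hf : ∀ s, FlatAt Γ (zc s) (τc s) r A κ) (hω : IsPatchFunction ω Γ Θ B)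
    (hα : 0 < α) (hτ1 : ∀ s, ‖τc s‖ = 1) (hzB : ∀ s, ‖zc s‖ ≤ B) (hA : 0 ≤ A) (hκ : 0 < κ)
    (hr : 0 < r) (hκα : 2 * α - 1 < κ) : Continuous fun s => vel α ω (zc s) (τc s) := by
  rw [continuous_iff_continuousAt]
  intro s₀
  refine ContinuousAt.mul continuousAt_const ?_
  refine continuousAt_of_dominated (bound := velBound α Θ B r A κ)
    (Eventually.of_forall fun s => hω.measurable_integrand.aestronglyMeasurable)
    (Eventually.of_forall fun s => Eventually.of_forall
      ((hf s).abs_integrand_le hω hα (hτ1 s) (hzB s) hA hκ hr))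
    (integrable_velBound hr hA hκα) ?_
  -- `ω` is locally constant off the null set `Γ`; for almost every `p` both values entering the odd
  -- part are therefore continuous at `s₀`.
  have hnull : volume (framePoint (zc s₀) (τc s₀) ⁻¹' Γ) = 0 := by
    rw [(measurePreserving_framePoint (hτ1 s₀)).measure_preimage_emb
      (measurableEmbedding_framePoint (hτ1 s₀)), hω.null]
  have hnull' : volume ((fun p : ℝ × ℝ => (-p.1, p.2)) ⁻¹'
      (framePoint (zc s₀) (τc s₀) ⁻¹' Γ)) = 0 := by
    rw [measurePreserving_reflect.measure_preimage_emb measurableEmbedding_reflect, hnull]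
  filter_upwards [measure_eq_zero_iff_ae_notMem.mp hnull,
    measure_eq_zero_iff_ae_notMem.mp hnull'] with p hp hp'
  have key : ∀ q : ℝ × ℝ, framePoint (zc s₀) (τc s₀) q ∉ Γ →
      ContinuousAt (fun s => ω (framePoint (zc s) (τc s) q)) s₀ := by
    intro q hq
    have h1 : ContinuousAt (fun s => framePoint (zc s) (τc s) q) s₀ :=
      ((continuous_framePoint_left q).comp (hz.prodMk hτ)).continuousAt
    exact ContinuousAt.comp (f := fun s => framePoint (zc s) (τc s) q) (hω.continuousAt hq) h1
  unfold oddPart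
  exact continuousAt_const.mul ((key p hp).sub (key _ hp'))

end Vel

/-! ### Flatness of the boundary -/

/-- Since `H |h|^κ ≤ 1/8`, the tangential coordinate differs from `h` by at most `|h|/8`. The
transversal one is at most `H |h|^(1+κ)`, and replacing `|h|` by `8/7` times the tangential
coordinate costs `(8/7)^(1+κ) ≤ 2`. -/
lemma IsHolderCurve.frame_bounds {H κ : ℝ} {x : ℝ → Plane} (hx : IsHolderCurve H κ x)
    (hH : 0 ≤ H) (hκ : 0 < κ) (hκ₁ : κ ≤ 1) {h₀ : ℝ} (hh₀ : H * h₀ ^ κ ≤ 1 / 8) (s : ℝ) {h : ℝ}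
    (hh : |h| ≤ h₀) :
    |inner ℝ (x (s + h) - x s) (deriv x s) - h| ≤ |h| / 8 ∧
    |inner ℝ (x (s + h) - x s) (perp (deriv x s))| ≤
      2 * H * |inner ℝ (x (s + h) - x s) (deriv x s)| ^ (1 + κ) := by
  have h1 := hx.taylor hH hκ.le s h
  have hτ := hx.unit_speed s
  set τ := deriv x s with hτdef
  set w := x (s + h) - x s with hw
  have hττ : inner ℝ τ τ = (1 : ℝ) := by rw [real_inner_self_eq_norm_sq, hτ]; norm_num
  have h2 : |inner ℝ (w - h • τ) τ| ≤ ‖w - h • τ‖ := by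
    simpa [hτ] using abs_real_inner_le_norm (w - h • τ) τ
  have h3 : |inner ℝ (w - h • τ) (perp τ)| ≤ ‖w - h • τ‖ := by
    simpa [hτ] using abs_real_inner_le_norm (w - h • τ) (perp τ)
  rw [inner_sub_left, real_inner_smul_left, hττ, mul_one] at h2
  rw [inner_sub_left, real_inner_smul_left, inner_perp_self, mul_zero, sub_zero] at h3
  have h4 : H * |h| ^ κ ≤ 1 / 8 := by
    refine le_trans ?_ hh₀
    gcongr
  have h5 : |inner ℝ w τ - h| ≤ |h| / 8 := by
    refine h2.trans (h1.trans ?_)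
    nlinarith [abs_nonneg h]
  refine ⟨h5, h3.trans (h1.trans ?_)⟩
  have h6 : |h| ≤ 8 / 7 * |inner ℝ w τ| := by
    have : |h| ≤ |inner ℝ w τ| + |inner ℝ w τ - h| := by
      have := abs_sub_abs_le_abs_sub h (inner ℝ w τ)
      rw [abs_sub_comm] at this
      linarith
    linarith
  rcases eq_or_lt_of_le (abs_nonneg h) with h0 | h0
  · rw [← h0, mul_zero]; positivity
  rw [mul_assoc, ← Real.rpow_add_one h0.ne', add_comm κ 1]
  calc H * |h| ^ (1 + κ) ≤ H * (8 / 7 * |inner ℝ w τ|) ^ (1 + κ) := by gcongr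
    _ = H * ((8 / 7 : ℝ) ^ (1 + κ) * |inner ℝ w τ| ^ (1 + κ)) := by
      rw [Real.mul_rpow (by norm_num) (abs_nonneg _)]
    _ ≤ H * (2 * |inner ℝ w τ| ^ (1 + κ)) := by
      have h7 : (8 / 7 : ℝ) ^ (1 + κ) ≤ (8 / 7 : ℝ) ^ (2 : ℝ) :=
        Real.rpow_le_rpow_of_exponent_le (by norm_num) (by linarith)
      rw [Real.rpow_two] at h7
      have h8 : (8 / 7 : ℝ) ^ (1 + κ) ≤ 2 := h7.trans (by norm_num)
      gcongr
    _ = _ := by ring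

lemma exists_pos_mul_rpow_le {H κ c : ℝ} (hκ : 0 < κ) (hc : 0 < c) :
    ∃ h₀ > 0, H * h₀ ^ κ ≤ c := by
  have h0 : Tendsto (fun δ : ℝ => H * δ ^ κ) (𝓝[>] 0) (𝓝 0) := by
    have : Continuous fun r : ℝ => H * r ^ κ :=
      continuous_const.mul (continuous_id.rpow_const (fun _ => Or.inr hκ.le))
    simpa [Real.zero_rpow hκ.ne'] using (this.tendsto 0).mono_left nhdsWithin_le_nhds
  obtain ⟨δ, h1, h2⟩ := ((h0.eventually (ge_mem_nhds hc)).and self_mem_nhdsWithin).exists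
  exact ⟨δ, h2, h1⟩

lemma norm_le_two_mul_of_frame {τ : Plane} (hτ : ‖τ‖ = 1) {w : Plane} {r : ℝ}
    (h1 : |inner ℝ w τ| ≤ r) (h2 : |inner ℝ w (perp τ)| ≤ r) : ‖w‖ ≤ 2 * r := by
  have h3 := norm_sq_frame hτ w
  have hr : 0 ≤ r := (abs_nonneg _).trans h1
  have h4 : inner ℝ w τ ^ 2 ≤ r ^ 2 := sq_le_sq' (abs_le.mp h1).1 (abs_le.mp h1).2
  have h5 : inner ℝ w (perp τ) ^ 2 ≤ r ^ 2 := sq_le_sq' (abs_le.mp h2).1 (abs_le.mp h2).2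
  nlinarith [norm_nonneg w]

section Patch

variable {N : ℕ} {k : ℕ} {γ α T η ρ H κ : ℝ} {θ : Fin N → ℝ} {Ω : Fin N → ℝ → Set Plane}
  {x : Fin N → ℝ → ℝ → Plane} {L : Fin N → ℝ → ℝ}

lemma IsPatchSolution.exists_param (hsol : IsPatchSolution α T θ Ω x L) {t : ℝ}
    (ht : t ∈ Ico 0 T) {y : Plane} (hy : y ∈ totalBoundary Ω t) : ∃ i s, y = x i t s := by
  obtain ⟨i, hi⟩ := mem_iUnion.mp hy
  rw [← (hsol.param i t ht).range_eq] at hi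
  obtain ⟨s, hs⟩ := hi
  exact ⟨i, s, hs.symm⟩

lemma IsPatchSolution.mem_totalBoundary (hsol : IsPatchSolution α T θ Ω x L) {t : ℝ}
    (ht : t ∈ Ico 0 T) (i : Fin N) (s : ℝ) : x i t s ∈ totalBoundary Ω t :=
  mem_iUnion.mpr ⟨i, (hsol.param i t ht).mem s⟩

/-- A boundary point in the box is closer than the separation, so it cannot compete with `x i t s`:
it lies on the same curve within arc length `η`. The arc-chord condition then confines it to arc
length `h₀`, where the curve is flat. -/
lemma flatAt_of_separation (hsol : IsPatchSolution α T θ Ω x L) {t : ℝ} (ht : t ∈ Ico 0 T)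
    (hH : 0 ≤ H) (hκ : 0 < κ) (hκ₁ : κ ≤ 1) (hh : ∀ i, IsHolderCurve H κ (x i t)) {h₀ c r : ℝ}
    (hh₀ : H * h₀ ^ κ ≤ 1 / 8) (hc : 0 < c)
    (hac : ∀ i, ∀ s r : ℝ, |s - r| ≤ η → c * |r - s| ≤ ‖x i t s - x i t r‖)
    (hr : 2 * r ≤ c * h₀) (hsep : ENNReal.ofReal (2 * r) < separation η Ω x L t) (i : Fin N)
    (s : ℝ) : FlatAt (totalBoundary Ω t) (x i t s) (deriv (x i t) s) r (2 * H) κ := by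
  intro y hy h1 h2
  have hτ := (hh i).unit_speed s
  have hd : ‖y - x i t s‖ ≤ 2 * r := norm_le_two_mul_of_frame hτ h1 h2
  have hncomp : (x i t s, y) ∉ competingPairs η Ω x L t := by
    intro hmem
    have := separation_le hmem
    simp only [edist_dist, dist_comm, dist_eq_norm] at this
    exact absurd (this.trans (ENNReal.ofReal_le_ofReal hd)) (not_le.mpr hsep)
  obtain ⟨j, s', rfl⟩ := hsol.exists_param ht hy
  have hji : j = i := by
    by_contra hne
    exact hncomp (Or.inl ⟨i, j, Ne.symm hne, (hsol.param i t ht).mem s,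
      (hsol.param j t ht).mem s'⟩)
  subst hji
  have h3 : ∃ m : ℤ, |s - s' + m * L j t| < η := by
    by_contra! hcon
    exact hncomp (Or.inr ⟨j, s, s', hcon, rfl⟩)
  obtain ⟨m, hm⟩ := h3
  have hper : x j t s' = x j t (s' + (-m : ℤ) * L j t) :=
    ((hsol.param j t ht).periodic.int_mul (-m) s').symm
  rw [hper] at hd ⊢
  set s'' := s' + (-m : ℤ) * L j t with hs''
  have h4 : |s - s''| < η := by
    rw [hs'']; push_cast
    rwa [show s - (s' + -(m : ℝ) * L j t) = s - s' + m * L j t by ring]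
  have h5 := hac j s s'' h4.le
  rw [norm_sub_rev] at h5
  have h6 : |s'' - s| ≤ h₀ := by
    have : c * |s'' - s| ≤ c * h₀ := h5.trans (hd.trans hr)
    exact le_of_mul_le_mul_left this hc
  have h7 := ((hh j).frame_bounds hH hκ hκ₁ hh₀ s h6).2
  rwa [add_sub_cancel] at h7

lemma normalVelocity_eq (hα : 0 < α) {ω : Plane → ℝ} {Γ : Set Plane} {Θ B r A : ℝ}
    (hω : IsPatchFunction ω Γ Θ B) {y : ℝ → Plane} {s : ℝ} (hf : FlatAt Γ (y s) (deriv y s) r A κ)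
    (hτ : ‖deriv y s‖ = 1) (hz : ‖y s‖ ≤ B) (hA : 0 ≤ A) (hκ : 0 < κ) (hr : 0 < r)
    (hκα : 2 * α - 1 < κ) :
    normalVelocity α ω y s = vel α ω (y s) (deriv y s) • perp (deriv y s) := by
  unfold normalVelocity unitNormal
  rw [hf.velocityComponent_eq hω hα hτ hz hA hκ hr hκα]

/-- The data needed to control the normal velocity on a time interval. -/
lemma exists_flat (hη : 0 < η) (hH : 0 ≤ H) (hκ : 0 < κ) (hκ₁ : κ ≤ 1)
    (hsol : IsPatchSolution α T θ Ω x L)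
    (hL : ∀ i, ∀ t ∈ Ico 0 T, 2 * η ≤ L i t) (hac : LocalArcChord η T x)
    {T' : ℝ} (hT'0 : 0 ≤ T') (hT' : T' < T)
    (hh : ∀ t ∈ Icc 0 T', ∀ i, IsHolderCurve H κ (x i t)) (i₀ : Fin N) :
    ∃ r > 0, ∀ t ∈ Icc 0 T', ∀ i s,
      FlatAt (totalBoundary Ω t) (x i t s) (deriv (x i t) s) r (2 * H) κ := by
  have hIco : ∀ t ∈ Icc 0 T', t ∈ Ico 0 T := fun t ht => ⟨ht.1, ht.2.trans_lt hT'⟩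
  obtain ⟨tm, htm, hmin⟩ := isCompact_Icc.exists_isMinOn (nonempty_Icc.mpr hT'0)
    (continuousOn_separation hη hH hκ hsol hL hT' hh i₀)
  set m := (separation η Ω x L tm).toReal with hm
  have hmt := separation_ne_top hη hH hκ hsol hL (hIco _ htm) (hh _ htm) i₀
  have hmpos : 0 < m := ENNReal.toReal_pos
    (separation_pos hη hH hκ hsol hL (hIco _ htm) (hh _ htm) i₀).ne' hmt
  obtain ⟨c, hc, hac⟩ := hac
  obtain ⟨h₀, hh₀, hh₀'⟩ := exists_pos_mul_rpow_le (H := H) hκ (show (0 : ℝ) < 1 / 8 by norm_num)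
  refine ⟨min (m / 4) (c * h₀ / 2), lt_min (by positivity) (by positivity), fun t ht i s => ?_⟩
  refine flatAt_of_separation hsol (hIco _ ht) hH hκ hκ₁ (hh t ht) hh₀' hc (hac t (hIco _ ht))
    ?_ ?_ i s
  · linarith [min_le_right (m / 4) (c * h₀ / 2)]
  · refine lt_of_lt_of_le ?_ (hmin ht)
    rw [← ENNReal.ofReal_toReal hmt, ← hm]
    exact (ENNReal.ofReal_lt_ofReal_iff hmpos).mpr (by linarith [min_le_left (m / 4) (c * h₀ / 2)])

end Patch

lemma normalVelocity_periodic {α : ℝ} {ω : Plane → ℝ} {y : ℝ → Plane} {P : ℝ}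
    (hy : Function.Periodic y P) : Function.Periodic (normalVelocity α ω y) P := by
  have h1 : Function.Periodic (deriv y) P := by
    intro s
    rw [← deriv_comp_add_const]
    congr 1
    exact funext hy
  intro s
  unfold normalVelocity unitNormal
  rw [hy s, h1 s]

/-! ### Right Dini derivatives of the separation distance -/

section Dini

variable {N : ℕ} {α T η H κ : ℝ} {θ : Fin N → ℝ} {Ω : Fin N → ℝ → Set Plane}
  {x : Fin N → ℝ → ℝ → Plane} {L : Fin N → ℝ → ℝ} {U : Ultrafilter ℝ}

/-- Points of the boundary at time `t + h` come from points transported by the normal velocity. -/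
lemma exists_transported (hsol : IsPatchSolution α T θ Ω x L) {t : ℝ} (ht : t ∈ Ico 0 T)
    (hU : (U : Filter ℝ) ≤ 𝓝[>] 0)
    (hu : ∀ i, Continuous (normalVelocity α (vorticity θ Ω t) (x i t))) {p : ℝ → Plane}
    (hp : ∀ᶠ h in (U : Filter ℝ), p h ∈ totalBoundary Ω (t + h)) {w : Plane}
    (hw : Tendsto p U (𝓝 w)) :
    ∃ i s, w = x i t s ∧ ∃ σ : ℝ → ℝ, Tendsto σ U (𝓝 s) ∧
      Tendsto (fun h => h⁻¹ * ‖p h - (x i t (σ h)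
        + h • normalVelocity α (vorticity θ Ω t) (x i t) (σ h))‖) U (𝓝 0) := by
  set u := fun i => normalVelocity α (vorticity θ Ω t) (x i t) with hudef
  have hev := (hsol.evolution t ht).mono_left hU
  set D := fun h : ℝ => Metric.hausdorffEDist (totalBoundary Ω (t + h))
    (transportedBoundary α θ Ω x t h) with hD
  have hpos : ∀ᶠ h in (U : Filter ℝ), 0 < h := hU self_mem_nhdsWithin
  have hfin : ∀ᶠ h in (U : Filter ℝ), D h / ENNReal.ofReal h < 1 :=
    hev.eventually (gt_mem_nhds one_pos)
  have h0 : Tendsto (fun h : ℝ => h) U (𝓝 0) := hU.trans nhdsWithin_le_nhds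
  -- The slack `h ^ 2` supplies an approximating point without attainment of the Hausdorff distance
  -- and is negligible after division by `h`. Parameters are reduced to one period so that they have
  -- a limit.
  have hex : ∀ h, ∃ iσ : Fin N × ℝ, 0 < h → D h / ENNReal.ofReal h < 1 →
      p h ∈ totalBoundary Ω (t + h) → iσ.2 ∈ Icc 0 (L iσ.1 t) ∧
      edist (p h) (x iσ.1 t iσ.2 + h • u iσ.1 iσ.2) ≤ D h + ENNReal.ofReal (h ^ 2) := by
    intro h
    by_cases hcond : 0 < h ∧ D h / ENNReal.ofReal h < 1 ∧ p h ∈ totalBoundary Ω (t + h)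
    · obtain ⟨hh, hDh, hph⟩ := hcond
      have hDt : D h ≠ ∞ := by
        intro htop
        rw [htop, ENNReal.top_div_of_ne_top ENNReal.ofReal_ne_top] at hDh
        exact absurd hDh (by simp)
      have hlt : D h < D h + ENNReal.ofReal (h ^ 2) :=
        ENNReal.lt_add_right hDt (by simp only [ne_eq, ENNReal.ofReal_eq_zero, not_le]; positivity)
      obtain ⟨q, hq, hlt⟩ := Metric.exists_edist_lt_of_hausdorffEDist_lt hph hlt
      obtain ⟨i, hi⟩ := mem_iUnion.mp hq
      obtain ⟨s, rfl⟩ := hi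
      have hpar := hsol.param i t ht
      set m := toIcoDiv hpar.length_pos 0 s
      set s' := toIcoMod hpar.length_pos 0 s
      have hs' : s' ∈ Ico 0 (L i t) := by
        simpa using toIcoMod_mem_Ico hpar.length_pos 0 s
      have hss : s = s' + m * L i t := by
        have := toIcoMod_add_toIcoDiv_zsmul hpar.length_pos 0 s
        rw [zsmul_eq_mul] at this
        exact this.symm
      refine ⟨(i, s'), fun _ _ _ => ⟨Ico_subset_Icc_self hs', ?_⟩⟩
      simp only at hlt ⊢
      rw [hss, hpar.periodic.int_mul m s',
        (normalVelocity_periodic hpar.periodic).int_mul m s'] at hlt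
      exact hlt.le
    · obtain ⟨h', hh'⟩ := hp.exists
      obtain ⟨i, -⟩ := mem_iUnion.mp hh'
      exact ⟨(i, 0), fun a b c => absurd ⟨a, b, c⟩ hcond⟩
  choose iσ hiσ using hex
  obtain ⟨i, hi⟩ := exists_eventually_eq_of_finite U fun h => (iσ h).1
  set σ := fun h => (iσ h).2 with hσ
  have hσev : ∀ᶠ h in (U : Filter ℝ), σ h ∈ Icc 0 (L i t) ∧
      edist (p h) (x i t (σ h) + h • u i (σ h)) ≤ D h + ENNReal.ofReal (h ^ 2) := by
    filter_upwards [hpos, hfin, hp, hi] with h h1 h2 h3 h4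
    have := hiσ h h1 h2 h3
    rwa [h4] at this
  obtain ⟨s, -, hs⟩ := isCompact_Icc.ultrafilter_le_nhds (U.map σ) (by
    rw [Ultrafilter.coe_map, le_principal_iff, mem_map]
    exact hσev.mono fun h hh => hh.1)
  have hslim : Tendsto σ U (𝓝 s) := hs
  have herr : Tendsto (fun h => h⁻¹ * ‖p h - (x i t (σ h) + h • u i (σ h))‖) U (𝓝 0) := by
    have h1 : Tendsto (fun h : ℝ => (D h / ENNReal.ofReal h).toReal + h) U (𝓝 0) := by
      have := ((ENNReal.tendsto_toReal ENNReal.zero_ne_top).comp hev).add h0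
      simpa using this
    refine tendsto_of_tendsto_of_tendsto_of_le_of_le' tendsto_const_nhds h1 ?_ ?_
    · filter_upwards [hpos] with h hh
      positivity
    · filter_upwards [hpos, hfin, hσev] with h hh hDh hσh
      have hDt : D h ≠ ∞ := by
        intro htop
        rw [htop, ENNReal.top_div_of_ne_top ENNReal.ofReal_ne_top] at hDh
        exact absurd hDh (by simp)
      have h2 := hσh.2
      rw [edist_dist, dist_eq_norm, ← ENNReal.ofReal_toReal hDt,
        ← ENNReal.ofReal_add ENNReal.toReal_nonneg (by positivity),
        ENNReal.ofReal_le_ofReal_iff (by positivity)] at h2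
      rw [ENNReal.toReal_div, ENNReal.toReal_ofReal hh.le]
      calc h⁻¹ * ‖p h - (x i t (σ h) + h • u i (σ h))‖ ≤ h⁻¹ * ((D h).toReal + h ^ 2) := by
            gcongr
        _ = (D h).toReal / h + h := by field_simp
  refine ⟨i, s, ?_, σ, hslim, herr⟩
  have hx : Tendsto (fun h => x i t (σ h)) U (𝓝 (x i t s)) :=
    ((hsol.param i t ht).contDiff.continuous.tendsto s).comp hslim
  have hut : Tendsto (fun h => u i (σ h)) U (𝓝 (u i s)) := ((hu i).tendsto s).comp hslim
  have h2 : Tendsto (fun h => h * (h⁻¹ * ‖p h - (x i t (σ h) + h • u i (σ h))‖)) U (𝓝 0) := by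
    simpa using h0.mul herr
  have h3 : Tendsto (fun h => p h - (x i t (σ h) + h • u i (σ h))) U (𝓝 0) := by
    rw [tendsto_zero_iff_norm_tendsto_zero]
    refine h2.congr' ?_
    filter_upwards [hpos] with h hh
    rw [← mul_assoc, mul_inv_cancel₀ hh.ne', one_mul]
  have h4 : Tendsto (fun h => x i t (σ h) + h • u i (σ h)) U (𝓝 (x i t s)) := by
    simpa using hx.add (h0.smul hut)
  have h5 := h3.add h4
  simp only [sub_add_cancel, zero_add] at h5
  exact tendsto_nhds_unique hw h5

lemma competingPairs_subset (hsol : IsPatchSolution α T θ Ω x L) {t : ℝ} (ht : t ∈ Ico 0 T)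
    {z : Plane × Plane} (hz : z ∈ competingPairs η Ω x L t) :
    z.1 ∈ totalBoundary Ω t ∧ z.2 ∈ totalBoundary Ω t := by
  rcases hz with ⟨i, j, -, h1, h2⟩ | ⟨i, s, r, -, rfl⟩
  · exact ⟨mem_iUnion.mpr ⟨i, h1⟩, mem_iUnion.mpr ⟨j, h2⟩⟩
  · exact ⟨hsol.mem_totalBoundary ht i s, hsol.mem_totalBoundary ht i r⟩

/-- Along any sequence of time increments, the separation distance decreases at most at the rate at
which the points of some minimizing pair approach each other. -/
lemma exists_minimizer_rate (hη : 0 < η) (hH : 0 ≤ H) (hκ : 0 < κ)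
    (hsol : IsPatchSolution α T θ Ω x L)
    (hL : ∀ i, ∀ t ∈ Ico 0 T, 2 * η ≤ L i t) {T' : ℝ} (hT' : T' < T)
    (hh : ∀ t ∈ Icc 0 T', ∀ i, IsHolderCurve H κ (x i t)) (i₀ : Fin N) {δ : ℝ} (hδ : 0 < δ)
    (hreg : ∀ t ∈ Icc 0 T', ∃ z, IsRegularMinimizer η Ω x L δ t z) {t : ℝ} (ht : t ∈ Ico 0 T')
    (hu : ∀ i, Continuous (normalVelocity α (vorticity θ Ω t) (x i t)))
    (hU : (U : Filter ℝ) ≤ 𝓝[>] 0) :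
    ∃ i j s r, (x i t s, x j t r) ∈ competingPairs η Ω x L t ∧
      edist (x i t s) (x j t r) = separation η Ω x L t ∧
      ∀ ε > 0, ∀ᶠ h in (U : Filter ℝ), (separation η Ω x L t).toReal +
        h * (inner ℝ (‖x i t s - x j t r‖⁻¹ • (x i t s - x j t r))
          (normalVelocity α (vorticity θ Ω t) (x i t) s
            - normalVelocity α (vorticity θ Ω t) (x j t) r) - ε)
        ≤ (separation η Ω x L (t + h)).toReal := by
  have hIco : ∀ t ∈ Icc 0 T', t ∈ Ico 0 T := fun t ht => ⟨ht.1, ht.2.trans_lt hT'⟩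
  have htI : t ∈ Icc 0 T' := Ico_subset_Icc_self ht
  have htT := hIco t htI
  set u := fun i => normalVelocity α (vorticity θ Ω t) (x i t) with hudef
  -- The time `t + h`, clamped to `[t, T']` so that minimizers can be chosen for every `h`; along
  -- `U` the clamping has no effect.
  let τ : ℝ → ℝ := fun h => max t (min (t + h) T')
  have hτmem : ∀ h, τ h ∈ Icc 0 T' := fun h =>
    ⟨ht.1.trans (le_max_left _ _), max_le ht.2.le (min_le_right _ _)⟩
  have h0 : Tendsto (fun h : ℝ => h) U (𝓝 0) := hU.trans nhdsWithin_le_nhds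
  have hpos : ∀ᶠ h in (U : Filter ℝ), 0 < h := hU self_mem_nhdsWithin
  have hτlim : Tendsto τ U (𝓝 t) := by
    have hc : Continuous τ := by fun_prop
    have h1 : τ 0 = t := by simp only [τ, add_zero]; rw [min_eq_left ht.2.le, max_self]
    have := (hc.tendsto 0).mono_left (show (U : Filter ℝ) ≤ 𝓝 0 from h0)
    rwa [h1] at this
  have hτeq : ∀ᶠ h in (U : Filter ℝ), τ h = t + h := by
    filter_upwards [hpos, h0.eventually (gt_mem_nhds (show (0 : ℝ) < T' - t by linarith [ht.2]))]
      with h h1 h2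
    simp only [τ]
    rw [min_eq_left (by linarith), max_eq_right (by linarith)]
  choose z hz using fun h => hreg (τ h) (hτmem h)
  obtain ⟨w, hw, hzw⟩ := IsRegularMinimizer.exists_tendsto hη hH hκ hsol hL
    (fun h => hIco _ (hτmem h)) htT hτlim (fun h => hh _ (hτmem h)) (hh t htI) i₀ hz
  have hb : ∀ᶠ h in (U : Filter ℝ), (z h).1 ∈ totalBoundary Ω (t + h) ∧
      (z h).2 ∈ totalBoundary Ω (t + h) := by
    filter_upwards [hτeq] with h hh'
    rw [← hh']
    exact competingPairs_subset hsol (hIco _ (hτmem h)) (hz h).mem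
  obtain ⟨i, s, hws, σ₁, hσ₁, he₁⟩ := exists_transported hsol htT hU hu
    (hb.mono fun h hh' => hh'.1) ((continuous_fst.tendsto w).comp hzw)
  obtain ⟨j, r, hwr, σ₂, hσ₂, he₂⟩ := exists_transported hsol htT hU hu
    (hb.mono fun h hh' => hh'.2) ((continuous_snd.tendsto w).comp hzw)
  have hweq : w = (x i t s, x j t r) := Prod.ext hws hwr
  subst hweq
  refine ⟨i, j, s, r, hw.mem, hw.edist_eq, fun ε hε => ?_⟩
  have hfin := separation_ne_top hη hH hκ hsol hL htT (hh t htI) i₀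
  have hsp := separation_pos hη hH hκ hsol hL htT (hh t htI) i₀
  set a := fun h => x i t (σ₁ h) with ha
  set b := fun h => x j t (σ₂ h) with hbdef
  have halim : Tendsto a U (𝓝 (x i t s)) :=
    ((hsol.param i t htT).contDiff.continuous.tendsto s).comp hσ₁
  have hblim : Tendsto b U (𝓝 (x j t r)) :=
    ((hsol.param j t htT).contDiff.continuous.tendsto r).comp hσ₂
  have hu₁ : Tendsto (fun h => u i (σ₁ h)) U (𝓝 (u i s)) := ((hu i).tendsto s).comp hσ₁
  have hu₂ : Tendsto (fun h => u j (σ₂ h)) U (𝓝 (u j r)) := ((hu j).tendsto r).comp hσ₂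
  have hne : x i t s - x j t r ≠ 0 := by
    intro h
    have := hw.edist_eq
    rw [sub_eq_zero.mp h] at this
    simp only [edist_self] at this
    exact hsp.ne this
  have hrate : Tendsto (fun h => inner ℝ (‖a h - b h‖⁻¹ • (a h - b h)) (u i (σ₁ h) - u j (σ₂ h))
      - (h⁻¹ * ‖(z h).1 - (a h + h • u i (σ₁ h))‖ + h⁻¹ * ‖(z h).2 - (b h + h • u j (σ₂ h))‖)) U
      (𝓝 (inner ℝ (‖x i t s - x j t r‖⁻¹ • (x i t s - x j t r)) (u i s - u j r))) := by
    have h1 := halim.sub hblim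
    have h2 := ((h1.norm.inv₀ (norm_ne_zero_iff.mpr hne)).smul h1).inner (𝕜 := ℝ) (hu₁.sub hu₂)
    have h3 := he₁.add he₂
    have h4 := h2.sub h3
    rw [add_zero, sub_zero] at h4
    exact h4
  filter_upwards [hpos, hτeq, hrate.eventually (lt_mem_nhds (sub_lt_self _ hε)),
    halim.eventually (Metric.ball_mem_nhds _ hδ), hblim.eventually (Metric.ball_mem_nhds _ hδ)]
    with h hh0 hτh hrh hah hbh
  -- The points `a h`, `b h` from which the minimizing pair at time `t + h` was transported need not
  -- compete at time `t`. Local minimality of the limit pair among all nearby boundary points still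
  -- bounds their distance from below by the separation.
  have hloc := hw.local_min (a h) (hsol.mem_totalBoundary htT i _) (b h)
    (hsol.mem_totalBoundary htT j _) hah hbh
  have hloc' : (separation η Ω x L t).toReal ≤ ‖a h - b h‖ := by
    rw [← dist_eq_norm, dist_edist]
    exact ENNReal.toReal_mono (edist_ne_top _ _) hloc
  have habpos : 0 < ‖a h - b h‖ := (ENNReal.toReal_pos hsp.ne' hfin).trans_le hloc'
  have hsepz : (separation η Ω x L (t + h)).toReal = ‖(z h).1 - (z h).2‖ := by
    rw [← hτh, ← (hz h).edist_eq, ← dist_edist, dist_eq_norm]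
  rw [hsepz]
  set e := ‖a h - b h‖⁻¹ • (a h - b h) with hedef
  set Δ := u i (σ₁ h) - u j (σ₂ h) with hΔ
  have hen : ‖e‖ = 1 := by
    rw [hedef, norm_smul, norm_inv, norm_norm, inv_mul_cancel₀ habpos.ne']
  have h1 : inner ℝ e (a h - b h) = ‖a h - b h‖ := by
    rw [hedef, real_inner_smul_left, real_inner_self_eq_norm_sq]
    field_simp
  have h2 : ‖a h - b h‖ + h * inner ℝ e Δ ≤ ‖(a h - b h) + h • Δ‖ := by
    have h3 := real_inner_le_norm e ((a h - b h) + h • Δ)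
    rw [hen, one_mul, inner_add_right, real_inner_smul_right, h1] at h3
    exact h3
  have h4 : ‖(a h - b h) + h • Δ‖ ≤ ‖(z h).1 - (z h).2‖
      + (‖(z h).1 - (a h + h • u i (σ₁ h))‖ + ‖(z h).2 - (b h + h • u j (σ₂ h))‖) := by
    have h5 : (a h - b h) + h • Δ = ((z h).1 - (z h).2)
        + (-((z h).1 - (a h + h • u i (σ₁ h))) + ((z h).2 - (b h + h • u j (σ₂ h)))) := by
      rw [hΔ, smul_sub]; abel
    rw [h5]
    refine (norm_add_le _ _).trans (add_le_add le_rfl ((norm_add_le _ _).trans ?_))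
    rw [norm_neg]
  have h6 := mul_le_mul_of_nonneg_left hrh.le hh0.le
  rw [mul_sub h (inner ℝ e Δ), mul_add, ← mul_assoc, ← mul_assoc, mul_inv_cancel₀ hh0.ne', one_mul,
    one_mul] at h6
  linarith

end Dini

/-! ### Differences of the kernel -/

section KernelDiff

variable {α : ℝ}

/-- Mean value inequality in the vertical shift `s ∈ [0, d]`: `m` keeps the path away from the
singularity and `W` bounds its height. -/
lemma abs_kern_sub_le (hα : 0 < α) {p : ℝ × ℝ} {d m W : ℝ} (hd : 0 ≤ d) (hm : 0 < m)
    (hp : ∀ s ∈ Icc 0 d, m ^ 2 ≤ p.1 ^ 2 + (p.2 - s) ^ 2 ∧ |p.2 - s| ≤ W) :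
    |kern α (p.1, p.2 - d) - kern α p| ≤ 2 * (1 + α) * d * W * m ^ (-(4 + 2 * α)) := by
  have hder : ∀ s ∈ Icc 0 d, HasDerivWithinAt (fun s => (p.1 ^ 2 + (p.2 - s) ^ 2) ^ (-(1 + α)))
      (2 * (p.2 - s) * (-1) * (-(1 + α)) * (p.1 ^ 2 + (p.2 - s) ^ 2) ^ (-(1 + α) - 1))
      (Icc 0 d) s := by
    intro s hs
    have h1 : HasDerivAt (fun s : ℝ => p.1 ^ 2 + (p.2 - s) ^ 2) (2 * (p.2 - s) * (-1)) s := by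
      have := (((hasDerivAt_id s).const_sub p.2).pow 2).const_add (p.1 ^ 2)
      simpa using this
    have h2 : p.1 ^ 2 + (p.2 - s) ^ 2 ≠ 0 := by
      have := (hp s hs).1
      have hm2 : 0 < m ^ 2 := by positivity
      linarith
    exact (h1.rpow_const (Or.inl h2)).hasDerivWithinAt
  have hb : ∀ s ∈ Icc 0 d, ‖2 * (p.2 - s) * (-1) * (-(1 + α))
      * (p.1 ^ 2 + (p.2 - s) ^ 2) ^ (-(1 + α) - 1)‖ ≤ 2 * (1 + α) * W * m ^ (-(4 + 2 * α)) := by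
    intro s hs
    obtain ⟨h1, h2⟩ := hp s hs
    have h3 : (m ^ 2) ^ (-(1 + α) - 1) = m ^ (-(4 + 2 * α)) := by
      rw [← Real.rpow_natCast, ← Real.rpow_mul hm.le]; congr 1; push_cast; ring
    have h4 : (p.1 ^ 2 + (p.2 - s) ^ 2) ^ (-(1 + α) - 1) ≤ m ^ (-(4 + 2 * α)) := by
      rw [← h3]
      exact Real.rpow_le_rpow_of_nonpos (by positivity) h1 (by linarith)
    have h5 : ‖2 * (p.2 - s) * (-1) * (-(1 + α))‖ = 2 * (1 + α) * |p.2 - s| := by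
      rw [show 2 * (p.2 - s) * (-1) * (-(1 + α)) = 2 * (1 + α) * (p.2 - s) by ring,
        Real.norm_eq_abs, abs_mul, abs_of_pos (by positivity)]
    have hW : 0 ≤ W := (abs_nonneg _).trans h2
    rw [norm_mul, h5, Real.norm_of_nonneg (by positivity)]
    gcongr
  have h := (convex_Icc 0 d).norm_image_sub_le_of_norm_hasDerivWithin_le hder hb
    (left_mem_Icc.mpr hd) (right_mem_Icc.mpr hd)
  rw [Real.norm_eq_abs, sub_zero, sub_zero, Real.norm_of_nonneg hd] at h
  calc _ ≤ _ := h
    _ = _ := by ring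

/-- Relative to the single kernel this gains `d (|b| + d) / a²`, which is useful for `|a| > d`; for
`|a| ≤ d` the trivial bound `abs_fst_mul_kern_sub_le_two` is used instead. -/
lemma abs_fst_mul_kern_sub_le (hα : 0 < α) {p : ℝ × ℝ} {d : ℝ} (hd : 0 ≤ d) (hp : p.1 ≠ 0) :
    |p.1| * |kern α (p.1, p.2 - d) - kern α p| ≤
      2 * (1 + α) * d * (|p.2| + d) * |p.1| ^ (-3 - 2 * α) := by
  have h0 := abs_pos.mpr hp
  have h := abs_kern_sub_le hα (p := p) (W := |p.2| + d) hd h0 fun s hs => by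
    refine ⟨by rw [sq_abs]; nlinarith [sq_nonneg (p.2 - s)], (abs_sub _ _).trans ?_⟩
    rw [abs_of_nonneg hs.1]; linarith [hs.2]
  calc |p.1| * |kern α (p.1, p.2 - d) - kern α p|
      ≤ |p.1| * (2 * (1 + α) * d * (|p.2| + d) * |p.1| ^ (-(4 + 2 * α))) := by gcongr
    _ = 2 * (1 + α) * d * (|p.2| + d) * (|p.1| * |p.1| ^ (-(4 + 2 * α))) := by ring
    _ = _ := by rw [← Real.rpow_one_add' h0.le (by linarith)]; congr 2; ring

lemma abs_fst_mul_kern_sub_le_two (hα : 0 < α) {p : ℝ × ℝ} {d : ℝ} (hp : p.1 ≠ 0) :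
    |p.1| * |kern α (p.1, p.2 - d) - kern α p| ≤ 2 * |p.1| ^ (-1 - 2 * α) := by
  have h1 := abs_fst_mul_kern_le hα hp
  have h2 := abs_fst_mul_kern_le hα (p := (p.1, p.2 - d)) hp
  have h3 : |kern α (p.1, p.2 - d) - kern α p| ≤ kern α (p.1, p.2 - d) + kern α p := by
    have a := kern_nonneg (α := α) p
    have b := kern_nonneg (α := α) (p.1, p.2 - d)
    rw [abs_le]; constructor <;> linarith
  have h4 := mul_le_mul_of_nonneg_left h3 (abs_nonneg p.1)
  simp only at h2
  linarith

/-- The constant in the far field bound of the kernel difference. -/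
def farConst (α : ℝ) : ℝ := 3 * (1 + α) * 2 ^ (4 + 2 * α)

lemma farConst_pos (hα : 0 < α) : 0 < farConst α := by unfold farConst; positivity

/-- A shift by at most half the norm keeps the point at distance at least `‖p‖ / 2` from the
singularity, so the mean value inequality gains a factor `d / ‖p‖`. -/
lemma abs_fst_mul_kern_sub_le_far (hα : 0 < α) {p : ℝ × ℝ} {d : ℝ} (hd : 0 < d)
    (hp : 2 * d ≤ ‖p‖) : |p.1| * |kern α (p.1, p.2 - d) - kern α p| ≤
      farConst α * d * ‖p‖ ^ (-2 - 2 * α) := by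
  have h0 : 0 < ‖p‖ := by linarith
  have h := abs_kern_sub_le hα (p := p) (W := 3 / 2 * ‖p‖) (m := ‖p‖ / 2) hd.le (by positivity)
    fun s hs => by
      have hs' : |s| ≤ ‖p‖ / 2 := by rw [abs_of_nonneg hs.1]; linarith [hs.2]
      have h1 : ‖p‖ ≤ ‖((p.1, p.2 - s) : ℝ × ℝ)‖ + |s| := by
        have h2 : p = (p.1, p.2 - s) + (0, s) := by ext <;> simp
        have h3 : ‖((0 : ℝ), s)‖ = |s| := by simp [Prod.norm_def]
        calc ‖p‖ = ‖((p.1, p.2 - s) : ℝ × ℝ) + (0, s)‖ := by rw [← h2]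
          _ ≤ _ := by rw [← h3]; exact norm_add_le _ _
      constructor
      · refine le_trans ?_ (sq_norm_le (p.1, p.2 - s))
        exact pow_le_pow_left₀ (by positivity) (by linarith) 2
      · refine (abs_sub _ _).trans ?_
        have := norm_snd_le p
        rw [Real.norm_eq_abs] at this
        linarith
  have h1 : |p.1| ≤ ‖p‖ := norm_fst_le p
  calc |p.1| * |kern α (p.1, p.2 - d) - kern α p|
      ≤ ‖p‖ * (2 * (1 + α) * d * (3 / 2 * ‖p‖) * (‖p‖ / 2) ^ (-(4 + 2 * α))) := by gcongr
    _ = 3 * (1 + α) * d * (‖p‖ ^ 2 * (‖p‖ / 2) ^ (-(4 + 2 * α))) := by ring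
    _ = 3 * (1 + α) * d * (‖p‖ ^ 2 * (‖p‖ ^ (-(4 + 2 * α)) * 2 ^ (4 + 2 * α))) := by
      rw [Real.div_rpow h0.le (by norm_num), Real.rpow_neg (by norm_num : (0 : ℝ) ≤ 2),
        div_inv_eq_mul]
    _ = farConst α * d * (‖p‖ ^ (2 : ℝ) * ‖p‖ ^ (-(4 + 2 * α))) := by
      rw [Real.rpow_two]; unfold farConst; ring
    _ = _ := by rw [← Real.rpow_add h0]; congr 2; ring

end KernelDiff

/-! ### The velocity difference integral at unit scale -/

section UnitScale

variable {α β κ A b c₀ Θ d δ : ℝ}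

/-- The set of points at height at most `A |a|^{1+β}` from the graph of `f`, over `|a| ∈ S`. -/
def graphStrip (S : Set ℝ) (f : ℝ → ℝ) (A β : ℝ) : Set (ℝ × ℝ) :=
  {p | p.1 ∈ {a : ℝ | |a| ∈ S} ∧ |p.2 - f p.1| ≤ A * |p.1| ^ (1 + β)}

lemma measurableSet_graphStrip {S : Set ℝ} (hS : MeasurableSet S) {f : ℝ → ℝ} (hf : Measurable f) :
    MeasurableSet (graphStrip S f A β) :=
  (measurable_fst (measurable_norm hS)).inter (measurableSet_le
    ((measurable_snd.sub (hf.comp measurable_fst)).abs) (by fun_prop))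

/-- `|a|^e` on a strip. -/
def stripFun (S : Set ℝ) (f : ℝ → ℝ) (A β e : ℝ) : ℝ × ℝ → ℝ≥0∞ :=
  (graphStrip S f A β).indicator fun p => ENNReal.ofReal (|p.1| ^ e)

lemma measurable_stripFun {S : Set ℝ} (hS : MeasurableSet S) {f : ℝ → ℝ} (hf : Measurable f)
    (e : ℝ) : Measurable (stripFun S f A β e) :=
  Measurable.indicator (by fun_prop) (measurableSet_graphStrip hS hf)

lemma lintegral_stripFun_Ioc_le {f : ℝ → ℝ} (hf : Measurable f) (hA : 0 ≤ A) {e : ℝ}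
    (he : -1 < 1 + β + e) (hb : 0 < b) :
    ∫⁻ p, stripFun (Ioc 0 b) f A β e p ≤
      ENNReal.ofReal (4 * A * (b ^ (1 + β + e + 1) / (1 + β + e + 1))) := by
  unfold stripFun
  rw [lintegral_indicator (measurableSet_graphStrip measurableSet_Ioc hf)]
  refine (lintegral_strip_rpow_le measurableSet_Ioc Ioc_subset_Ioi_self hf hA).trans ?_
  rw [lintegral_rpow_Ioc he hb, ENNReal.ofReal_mul (by positivity : 0 ≤ 4 * A)]

lemma lintegral_stripFun_Ioi_le {f : ℝ → ℝ} (hf : Measurable f) (hA : 0 ≤ A) {e : ℝ}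
    (he : 1 + β + e < -1) (hb : 0 < b) :
    ∫⁻ p, stripFun (Ioi b) f A β e p ≤
      ENNReal.ofReal (4 * A * (b ^ (1 + β + e + 1) / (-(1 + β + e + 1)))) := by
  unfold stripFun
  rw [lintegral_indicator (measurableSet_graphStrip measurableSet_Ioi hf)]
  refine (lintegral_strip_rpow_le measurableSet_Ioi (Ioi_subset_Ioi hb.le) hf hA).trans ?_
  rw [lintegral_rpow_Ioi he hb, ENNReal.ofReal_mul (by positivity : 0 ≤ 4 * A)]

/-- The tail of `|p|^{-2-2α}`. -/
def tailFun (α r : ℝ) : ℝ × ℝ → ℝ≥0∞ :=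
  {p : ℝ × ℝ | r < ‖p‖}.indicator fun p => ENNReal.ofReal (‖p‖ ^ (-2 - 2 * α))

lemma measurable_tailFun (α r : ℝ) : Measurable (tailFun α r) :=
  Measurable.indicator (by fun_prop) (measurableSet_lt (by fun_prop) (by fun_prop))

lemma lintegral_tailFun (hα : 0 < α) {r : ℝ} (hr : 0 < r) :
    ∫⁻ p, tailFun α r p = ENNReal.ofReal (8 * (r ^ (-(2 * α)) / (2 * α))) := by
  unfold tailFun
  rw [lintegral_indicator (measurableSet_lt (by fun_prop) (by fun_prop)),
    lintegral_prod_norm_tail (by linarith) hr]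
  congr 3
  · congr 1; ring
  · ring

end UnitScale

section UnitScale

variable {α β κ A b c₀ Θ d δ : ℝ}

/-- The majorant of the velocity difference integrand near one of the two curves. -/
def nearFun (α β κ A b c₀ d : ℝ) (f : ℝ → ℝ) (p : ℝ × ℝ) : ℝ≥0∞ :=
  ENNReal.ofReal 2 * stripFun (Ioc 0 d) f A β (-1 - 2 * α) p +
    (ENNReal.ofReal (4 * (1 + α) * d ^ 2) * stripFun (Ioi d) f A β (-3 - 2 * α) p +
    ENNReal.ofReal (2 * (1 + α) * (c₀ + A) * d) * stripFun (Ioc 0 b) f A β (κ - 2 - 2 * α) p)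

/-- The constant bounding the integral of the near majorant, divided by `d`. -/
def nearConst (α β κ A b c₀ : ℝ) : ℝ :=
  8 * A + 16 * (1 + α) * A / (1 + 2 * α - β) +
    8 * (1 + α) * (c₀ + A) * A * (b ^ (β - 2 * α + κ) / (β - 2 * α + κ))

lemma measurable_nearFun {f : ℝ → ℝ} (hf : Measurable f) :
    Measurable (nearFun α β κ A b c₀ d f) := by
  unfold nearFun
  exact ((measurable_stripFun measurableSet_Ioc hf _).const_mul _).add
    (((measurable_stripFun measurableSet_Ioi hf _).const_mul _).add
      ((measurable_stripFun measurableSet_Ioc hf _).const_mul _))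

/-- After integration in height the three terms are of order `d`. The first is a multiple of
`d^(1+β-2α) ≤ d`, because `2α ≤ β` and `d ≤ 1`. The second is `d² ∫_d^∞ a^(β-2-2α)`, convergent
because `β < 1 + 2α`. The third is `d ∫_0^b a^(β-2α+κ-1)`, convergent by `κ > 0` even at the
endpoint `β = 2α`. -/
lemma lintegral_nearFun_le (hα : 0 < α) (hβ : 2 * α ≤ β) (hβ' : β < 1 + 2 * α) (hκ : 0 < κ)
    (hA : 0 ≤ A) (hb : 0 < b) (hc : 0 ≤ c₀) (hd : 0 < d) (hd1 : d ≤ 1) {f : ℝ → ℝ}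
    (hf : Measurable f) :
    ∫⁻ p, nearFun α β κ A b c₀ d f p ≤ ENNReal.ofReal (nearConst α β κ A b c₀ * d) := by
  unfold nearFun
  rw [lintegral_add_left ((measurable_stripFun measurableSet_Ioc hf _).const_mul _),
    lintegral_add_left ((measurable_stripFun measurableSet_Ioi hf _).const_mul _),
    lintegral_const_mul _ (measurable_stripFun measurableSet_Ioc hf _),
    lintegral_const_mul _ (measurable_stripFun measurableSet_Ioi hf _),
    lintegral_const_mul _ (measurable_stripFun measurableSet_Ioc hf _)]
  have hpow : d ^ (1 + β - 2 * α) ≤ d := by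
    conv_rhs => rw [← Real.rpow_one d]
    exact Real.rpow_le_rpow_of_exponent_ge hd hd1 (by linarith)
  have e1 : (1 + β + (-1 - 2 * α) + 1) = 1 + β - 2 * α := by ring
  have e2 : (1 + β + (-3 - 2 * α) + 1) = (1 + β - 2 * α) + (-2) := by ring
  have e3 : (1 + β + (κ - 2 - 2 * α) + 1) = β - 2 * α + κ := by ring
  have h1 := lintegral_stripFun_Ioc_le (β := β) (e := -1 - 2 * α) hf hA (by linarith) hd
  have h2 := lintegral_stripFun_Ioi_le (β := β) (e := -3 - 2 * α) hf hA (by linarith) hd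
  have h3 := lintegral_stripFun_Ioc_le (β := β) (e := κ - 2 - 2 * α) hf hA (by linarith) hb
  rw [e1] at h1
  rw [e2] at h2
  rw [e3] at h3
  have p1 : 4 * A * (d ^ (1 + β - 2 * α) / (1 + β - 2 * α)) ≤ 4 * A * d := by
    gcongr
    rw [div_le_iff₀ (by linarith)]
    nlinarith
  have p2 : d ^ 2 * (4 * A * (d ^ (1 + β - 2 * α + -2) / (-(1 + β - 2 * α + -2)))) ≤
      4 * A * (d / (1 + 2 * α - β)) := by
    rw [Real.rpow_add hd, Real.rpow_neg hd.le, Real.rpow_two,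
      show -(1 + β - 2 * α + -2) = 1 + 2 * α - β by ring]
    have h0 : 0 < 1 + 2 * α - β := by linarith
    rw [show d ^ 2 * (4 * A * (d ^ (1 + β - 2 * α) * (d ^ 2)⁻¹ / (1 + 2 * α - β)))
      = 4 * A * (d ^ (1 + β - 2 * α) / (1 + 2 * α - β)) by field_simp]
    gcongr
  have hs : 0 ≤ b ^ (β - 2 * α + κ) / (β - 2 * α + κ) :=
    div_nonneg (by positivity) (by linarith)
  have hs2 : 0 ≤ d ^ (1 + β - 2 * α + -2) / (-(1 + β - 2 * α + -2)) :=
    div_nonneg (by positivity) (by linarith)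
  have hs1 : 0 ≤ d ^ (1 + β - 2 * α) / (1 + β - 2 * α) :=
    div_nonneg (by positivity) (by linarith)
  refine (add_le_add (mul_le_mul_right h1 _)
    (add_le_add (mul_le_mul_right h2 _) (mul_le_mul_right h3 _))).trans ?_
  rw [← ENNReal.ofReal_mul (by positivity), ← ENNReal.ofReal_mul (by positivity),
    ← ENNReal.ofReal_mul (by positivity), ← ENNReal.ofReal_add (by positivity) (by positivity),
    ← ENNReal.ofReal_add (by positivity) (by positivity)]
  refine ENNReal.ofReal_le_ofReal ?_
  have p2' := mul_le_mul_of_nonneg_left p2 (show 0 ≤ 4 * (1 + α) by positivity)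
  calc _ ≤ 2 * (4 * A * d) + (4 * (1 + α) * (4 * A * (d / (1 + 2 * α - β)))
        + 2 * (1 + α) * (c₀ + A) * d * (4 * A * (b ^ (β - 2 * α + κ) / (β - 2 * α + κ)))) := by
        refine add_le_add (mul_le_mul_of_nonneg_left p1 (by norm_num)) (add_le_add ?_ le_rfl)
        rw [mul_assoc (4 * (1 + α))]
        exact p2'
    _ = _ := by unfold nearConst; ring

/-- On the strip the height is at most `d + (c₀ + A) |a|^(1+κ)`. Inserted into the gain `d (|b| + d)
/ a²` for `|a| > d`, it produces exactly the second and third terms of the majorant. -/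
lemma le_nearFun (hα : 0 < α) (hκβ : κ ≤ β) (hA : 0 ≤ A) (hb1 : b ≤ 1)
    (hc : 0 ≤ c₀) (hd : 0 < d) {f : ℝ → ℝ} {p : ℝ × ℝ} (hp : p.1 ≠ 0) (hpb : |p.1| ≤ b)
    (hf : |f p.1| ≤ d + c₀ * |p.1| ^ (1 + κ)) (hs : |p.2 - f p.1| ≤ A * |p.1| ^ (1 + β)) :
    ENNReal.ofReal (|p.1| * |kern α (p.1, p.2 - d) - kern α p|) ≤
      nearFun α β κ A b c₀ d f p := by
  have h0 := abs_pos.mpr hp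
  unfold nearFun
  rcases le_or_gt |p.1| d with hpd | hpd
  · refine le_trans ?_ (le_add_of_nonneg_right zero_le)
    have hmem : p ∈ graphStrip (Ioc 0 d) f A β := ⟨⟨h0, hpd⟩, hs⟩
    unfold stripFun
    rw [indicator_of_mem hmem, ← ENNReal.ofReal_mul (by norm_num)]
    exact ENNReal.ofReal_le_ofReal (abs_fst_mul_kern_sub_le_two hα hp)
  · refine le_trans ?_ (le_add_of_nonneg_left zero_le)
    have hmem : p ∈ graphStrip (Ioi d) f A β := ⟨hpd, hs⟩
    have hmem' : p ∈ graphStrip (Ioc 0 b) f A β := ⟨⟨h0, hpb⟩, hs⟩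
    unfold stripFun
    rw [indicator_of_mem hmem, indicator_of_mem hmem', ← ENNReal.ofReal_mul (by positivity),
      ← ENNReal.ofReal_mul (by positivity), ← ENNReal.ofReal_add (by positivity) (by positivity)]
    refine ENNReal.ofReal_le_ofReal ((abs_fst_mul_kern_sub_le hα hd.le hp).trans ?_)
    have h1 : |p.1| ^ (1 + β) ≤ |p.1| ^ (1 + κ) :=
      Real.rpow_le_rpow_of_exponent_ge h0 (hpb.trans hb1) (by linarith)
    have h2 : |p.2| ≤ |p.2 - f p.1| + |f p.1| := by
      simpa using abs_add_le (p.2 - f p.1) (f p.1)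
    have h3 : |p.2| + d ≤ 2 * d + (c₀ + A) * |p.1| ^ (1 + κ) := by
      nlinarith [mul_le_mul_of_nonneg_left h1 hA]
    have h4 : |p.1| ^ (κ - 2 - 2 * α) = |p.1| ^ (1 + κ) * |p.1| ^ (-3 - 2 * α) := by
      rw [← Real.rpow_add h0]; congr 1; ring
    rw [h4]
    calc 2 * (1 + α) * d * (|p.2| + d) * |p.1| ^ (-3 - 2 * α)
        ≤ 2 * (1 + α) * d * (2 * d + (c₀ + A) * |p.1| ^ (1 + κ)) * |p.1| ^ (-3 - 2 * α) := by
          gcongr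
      _ = _ := by ring

lemma abs_integral_le_of_lintegral_le {f : ℝ × ℝ → ℝ} {g : ℝ × ℝ → ℝ≥0∞} {c : ℝ} (hc : 0 ≤ c)
    (h : ∀ p, ‖f p‖ₑ ≤ g p) (hg : ∫⁻ p, g p ≤ ENNReal.ofReal c) : |∫ p, f p| ≤ c := by
  have h1 := (enorm_integral_le_lintegral_enorm f).trans ((lintegral_mono h).trans hg)
  rw [← ofReal_norm, Real.norm_eq_abs] at h1
  exact (ENNReal.ofReal_le_ofReal_iff hc).mp h1

lemma enorm_integrand_eq {G : ℝ × ℝ → ℝ} (p : ℝ × ℝ) :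
    ‖p.1 * (kern α (p.1, p.2 - d) - kern α p) * G p‖ₑ =
      ENNReal.ofReal |G p| * ENNReal.ofReal (|p.1| * |kern α (p.1, p.2 - d) - kern α p|) := by
  rw [← ofReal_norm, Real.norm_eq_abs, abs_mul, abs_mul, mul_comm, ENNReal.ofReal_mul (abs_nonneg _)]

/-- The velocity difference at two close points between which the boundary consists of two almost
parallel curves. -/
lemma abs_integral_kern_sub_le (hα : 0 < α) (hβ : 2 * α ≤ β) (hβ' : β < 1 + 2 * α) (hκ : 0 < κ)
    (hκβ : κ ≤ β) (hA : 0 ≤ A) (hb : 0 < b) (hb1 : b ≤ 1) (hc : 0 ≤ c₀) (hd : 0 < d)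
    (hdb : 2 * d ≤ b) {G : ℝ × ℝ → ℝ} (hG : ∀ p, |G p| ≤ 2 * Θ) {f g : ℝ → ℝ}
    (hf : Measurable f) (hg : Measurable g) (hf' : ∀ y, |y| ≤ b → |f y| ≤ c₀ * |y| ^ (1 + κ))
    (hg' : ∀ y, |y| ≤ b → |g y| ≤ c₀ * |y| ^ (1 + κ))
    (h : ∀ p, ‖p‖ ≤ b → G p ≠ 0 → |p.2 - f p.1| ≤ A * |p.1| ^ (1 + β) ∨
      |p.2 - (d + g p.1)| ≤ A * |p.1| ^ (1 + β)) :
    |∫ p : ℝ × ℝ, p.1 * (kern α (p.1, p.2 - d) - kern α p) * G p| ≤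
      2 * Θ * (2 * nearConst α β κ A b c₀ + farConst α * (8 * (b ^ (-(2 * α)) / (2 * α)))) * d := by
  have hΘ : 0 ≤ 2 * Θ := (abs_nonneg _).trans (hG 0)
  have hnear : 0 ≤ nearConst α β κ A b c₀ := by
    unfold nearConst
    have := div_nonneg (show 0 ≤ 16 * (1 + α) * A by positivity)
      (show 0 ≤ 1 + 2 * α - β by linarith)
    have := div_nonneg (show 0 ≤ b ^ (β - 2 * α + κ) by positivity)
      (show 0 ≤ β - 2 * α + κ by linarith)
    positivity
  have hfar := farConst_pos hα
  have hgm : Measurable fun y => d + g y := measurable_const.add hg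
  -- One near majorant for each of the two curves, and the tail beyond `b`, where `2 * d ≤ b` makes
  -- the far bound available.
  refine abs_integral_le_of_lintegral_le (g := fun p => ENNReal.ofReal (2 * Θ) *
    (nearFun α β κ A b c₀ d f p + (nearFun α β κ A b c₀ d (fun y => d + g y) p
      + ENNReal.ofReal (farConst α * d) * tailFun α b p))) (by positivity) ?_ ?_
  · intro p
    rw [enorm_integrand_eq]
    rcases eq_or_ne (G p) 0 with h0 | h0
    · rw [h0, abs_zero, ENNReal.ofReal_zero, zero_mul]; exact zero_le
    rcases eq_or_ne p.1 0 with h1 | h1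
    · rw [h1, abs_zero, zero_mul, ENNReal.ofReal_zero, mul_zero]; exact zero_le
    refine mul_le_mul' (ENNReal.ofReal_le_ofReal (hG p)) ?_
    rcases le_or_gt ‖p‖ b with hpb | hpb
    · have hp1 : |p.1| ≤ b := (norm_fst_le p).trans hpb
      rcases h p hpb h0 with hs | hs
      · refine (le_nearFun hα hκβ hA hb1 hc hd h1 hp1 ?_ hs).trans
          (le_add_of_nonneg_right zero_le)
        linarith [hf' _ hp1]
      · refine le_trans ?_ (le_add_of_nonneg_left zero_le)
        refine (le_nearFun (f := fun y => d + g y) hα hκβ hA hb1 hc hd h1 hp1 ?_ hs).trans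
          (le_add_of_nonneg_right zero_le)
        refine (abs_add_le _ _).trans ?_
        rw [abs_of_pos hd]
        linarith [hg' _ hp1]
    · refine le_trans ?_ ((le_add_of_nonneg_left zero_le).trans (le_add_of_nonneg_left zero_le))
      unfold tailFun
      rw [indicator_of_mem (s := {p : ℝ × ℝ | b < ‖p‖}) hpb,
        ← ENNReal.ofReal_mul (by positivity)]
      exact ENNReal.ofReal_le_ofReal (abs_fst_mul_kern_sub_le_far hα hd (by linarith))
  · have hm : Measurable fun p => nearFun α β κ A b c₀ d f p +
        (nearFun α β κ A b c₀ d (fun y => d + g y) p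
          + ENNReal.ofReal (farConst α * d) * tailFun α b p) :=
      (measurable_nearFun hf).add ((measurable_nearFun hgm).add
        ((measurable_tailFun α b).const_mul _))
    rw [lintegral_const_mul _ hm, lintegral_add_left (measurable_nearFun hf),
      lintegral_add_left (measurable_nearFun hgm), lintegral_const_mul _ (measurable_tailFun α b),
      lintegral_tailFun hα hb]
    have h1 := lintegral_nearFun_le hα hβ hβ' hκ hA hb hc hd (by linarith) hf
    have h2 := lintegral_nearFun_le hα hβ hβ' hκ hA hb hc hd (by linarith) hgm
    refine (mul_le_mul_right (add_le_add h1 (add_le_add h2 le_rfl)) _).trans ?_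
    rw [← ENNReal.ofReal_mul (by positivity), ← ENNReal.ofReal_add (by positivity) (by positivity),
      ← ENNReal.ofReal_add (by positivity) (by positivity), ← ENNReal.ofReal_mul (by positivity)]
    refine ENNReal.ofReal_le_ofReal (le_of_eq ?_)
    ring

end UnitScale

section UnitScale

variable {α β κ A b c₀ Θ d δ : ℝ}

/-- The majorant of a single velocity integrand within distance `3d` of the base point. -/
def singleFun (α κ A d δ : ℝ) (p : ℝ × ℝ) : ℝ≥0∞ :=
  stripFun (Ioc 0 δ) (fun _ => 0) A κ (-1 - 2 * α) p + ENNReal.ofReal (3 * d) * tailFun α δ p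

lemma measurable_singleFun : Measurable (singleFun α κ A d δ) := by
  unfold singleFun
  exact (measurable_stripFun measurableSet_Ioc measurable_const _).add
    ((measurable_tailFun α δ).const_mul _)

lemma lintegral_singleFun_le (hα : 0 < α) (hκα : 2 * α - 1 < κ) (hA : 0 ≤ A) (hδ : 0 < δ)
    (hd : 0 < d) : ∫⁻ p, singleFun α κ A d δ p ≤
      ENNReal.ofReal (4 * A * (δ ^ (1 + κ - 2 * α) / (1 + κ - 2 * α)) +
        3 * d * (8 * (δ ^ (-(2 * α)) / (2 * α)))) := by
  unfold singleFun
  rw [lintegral_add_left (measurable_stripFun measurableSet_Ioc measurable_const _),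
    lintegral_const_mul _ (measurable_tailFun α δ), lintegral_tailFun hα hδ]
  have h1 := lintegral_stripFun_Ioc_le (β := κ) (e := -1 - 2 * α) (f := fun _ => 0)
    measurable_const hA (by linarith) hδ
  rw [show 1 + κ + (-1 - 2 * α) + 1 = 1 + κ - 2 * α by ring] at h1
  have h2 : 0 ≤ δ ^ (1 + κ - 2 * α) / (1 + κ - 2 * α) := div_nonneg (by positivity) (by linarith)
  rw [ENNReal.ofReal_add (by positivity) (by positivity),
    ENNReal.ofReal_mul (p := 3 * d) (by positivity)]
  exact add_le_add h1 le_rfl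

/-- Beyond `δ` the geometry is not used: `‖p‖^(-1-2α) ≤ 3d ‖p‖^(-2-2α)` for `‖p‖ ≤ 3d`, which brings
out the factor `d` and reuses the tail integral. -/
lemma le_singleFun (hα : 0 < α) (hd : 0 < d) (hδ : 0 < δ) {p : ℝ × ℝ} (hp : p.1 ≠ 0)
    (hpd : ‖p‖ ≤ 3 * d) (h : ‖p‖ ≤ δ → |p.2| ≤ A * |p.1| ^ (1 + κ)) :
    ENNReal.ofReal (|p.1| * kern α p) ≤ singleFun α κ A d δ p := by
  unfold singleFun
  rcases le_or_gt ‖p‖ δ with hpδ | hpδ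
  · refine le_trans ?_ (le_add_of_nonneg_right zero_le)
    have hmem : p ∈ graphStrip (Ioc 0 δ) (fun _ => 0) A κ :=
      ⟨⟨abs_pos.mpr hp, (norm_fst_le p).trans hpδ⟩, by simpa using h hpδ⟩
    unfold stripFun
    rw [indicator_of_mem hmem]
    exact ENNReal.ofReal_le_ofReal (abs_fst_mul_kern_le hα hp)
  · refine le_trans ?_ (le_add_of_nonneg_left zero_le)
    have h0 : 0 < ‖p‖ := hδ.trans hpδ
    unfold tailFun
    rw [indicator_of_mem (s := {p : ℝ × ℝ | δ < ‖p‖}) hpδ, ← ENNReal.ofReal_mul (by positivity)]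
    refine ENNReal.ofReal_le_ofReal ((abs_fst_mul_kern_le_norm hα h0).trans ?_)
    rw [show (-1 - 2 * α) = 1 + (-2 - 2 * α) by ring, Real.rpow_add h0, Real.rpow_one]
    gcongr

/-- The velocity difference at two points that are not close to each other. -/
lemma abs_integral_kern_sub_le_of_far (hα : 0 < α) (hκα : 2 * α - 1 < κ) (hA : 0 ≤ A) (hδ : 0 < δ)
    (hd : 0 < d) (hδd : δ < 2 * d) {G : ℝ × ℝ → ℝ} (hG : ∀ p, |G p| ≤ 2 * Θ)
    (h₁ : ∀ p, ‖p‖ ≤ δ → G p ≠ 0 → |p.2| ≤ A * |p.1| ^ (1 + κ))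
    (h₂ : ∀ p : ℝ × ℝ, ‖((p.1, p.2 - d) : ℝ × ℝ)‖ ≤ δ → G p ≠ 0 →
      |p.2 - d| ≤ A * |p.1| ^ (1 + κ)) :
    |∫ p : ℝ × ℝ, p.1 * (kern α (p.1, p.2 - d) - kern α p) * G p| ≤
      2 * Θ * (16 * A * (δ ^ (1 + κ - 2 * α) / (1 + κ - 2 * α)) / δ +
        (6 + farConst α) * (8 * (δ ^ (-(2 * α)) / (2 * α)))) * d := by
  have hΘ : 0 ≤ 2 * Θ := (abs_nonneg _).trans (hG 0)
  have hfar := farConst_pos hα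
  have hq : 0 ≤ δ ^ (1 + κ - 2 * α) / (1 + κ - 2 * α) := div_nonneg (by positivity) (by linarith)
  -- Within `2d` no cancellation between the kernels is used: each is bounded on its own, the
  -- shifted one after translation by `(0, d)`.
  refine abs_integral_le_of_lintegral_le (g := fun p => ENNReal.ofReal (2 * Θ) *
    (singleFun α κ A d δ p + (singleFun α κ A d δ (p - (0, d))
      + ENNReal.ofReal (farConst α * d) * tailFun α δ p))) (by positivity) ?_ ?_
  · intro p
    rw [enorm_integrand_eq]
    rcases eq_or_ne (G p) 0 with h0 | h0
    · rw [h0, abs_zero, ENNReal.ofReal_zero, zero_mul]; exact zero_le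
    rcases eq_or_ne p.1 0 with h1 | h1
    · rw [h1, abs_zero, zero_mul, ENNReal.ofReal_zero, mul_zero]; exact zero_le
    refine mul_le_mul' (ENNReal.ofReal_le_ofReal (hG p)) ?_
    have hsub : p - (0, d) = (p.1, p.2 - d) := by ext <;> simp
    rw [hsub]
    rcases le_or_gt (2 * d) ‖p‖ with hpd | hpd
    · refine le_trans ?_ ((le_add_of_nonneg_left zero_le).trans (le_add_of_nonneg_left zero_le))
      unfold tailFun
      rw [indicator_of_mem (s := {p : ℝ × ℝ | δ < ‖p‖}) (hδd.trans_le hpd),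
        ← ENNReal.ofReal_mul (by positivity)]
      exact ENNReal.ofReal_le_ofReal (abs_fst_mul_kern_sub_le_far hα hd hpd)
    · rw [← add_assoc]
      refine le_trans ?_ (le_add_of_nonneg_right zero_le)
      have hnn : |kern α (p.1, p.2 - d) - kern α p| ≤ kern α p + kern α (p.1, p.2 - d) := by
        have a := kern_nonneg (α := α) p
        have b := kern_nonneg (α := α) (p.1, p.2 - d)
        rw [abs_le]; constructor <;> linarith
      have hn : ‖((p.1, p.2 - d) : ℝ × ℝ)‖ ≤ 3 * d := by
        rw [← hsub]
        refine (norm_sub_le _ _).trans ?_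
        have h3 : ‖((0 : ℝ), d)‖ = d := by simp [Prod.norm_def, hd.le]
        rw [h3]; linarith
      refine (ENNReal.ofReal_le_ofReal (mul_le_mul_of_nonneg_left hnn (abs_nonneg _))).trans ?_
      rw [mul_add, ENNReal.ofReal_add (mul_nonneg (abs_nonneg _) (kern_nonneg _))
        (mul_nonneg (abs_nonneg _) (kern_nonneg _))]
      exact add_le_add (le_singleFun hα hd hδ h1 (by linarith) fun h => h₁ p h h0)
        (le_singleFun hα hd hδ (p := (p.1, p.2 - d)) h1 hn fun h => h₂ p h h0)
  · have hs := measurable_singleFun (α := α) (κ := κ) (A := A) (d := d) (δ := δ)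
    have hs' : Measurable fun p : ℝ × ℝ => singleFun α κ A d δ (p - (0, d)) :=
      hs.comp (measurable_id.sub_const _)
    have hm : Measurable fun p => singleFun α κ A d δ p + (singleFun α κ A d δ (p - (0, d))
        + ENNReal.ofReal (farConst α * d) * tailFun α δ p) :=
      hs.add (hs'.add ((measurable_tailFun α δ).const_mul _))
    rw [lintegral_const_mul _ hm, lintegral_add_left hs, lintegral_add_left hs',
      lintegral_const_mul _ (measurable_tailFun α δ), lintegral_tailFun hα hδ,
      lintegral_sub_right_eq_self]
    have h1 := lintegral_singleFun_le hα hκα hA hδ hd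
    refine (mul_le_mul_right (add_le_add h1 (add_le_add h1 le_rfl)) _).trans ?_
    rw [← ENNReal.ofReal_mul (by positivity), ← ENNReal.ofReal_add (by positivity) (by positivity),
      ← ENNReal.ofReal_add (by positivity) (by positivity), ← ENNReal.ofReal_mul (by positivity)]
    refine ENNReal.ofReal_le_ofReal ?_
    -- The strip integrals carry no factor `d`; it is supplied by `δ < 2 * d`.
    have h3 : 8 * A * (δ ^ (1 + κ - 2 * α) / (1 + κ - 2 * α)) ≤
        16 * A * (δ ^ (1 + κ - 2 * α) / (1 + κ - 2 * α)) / δ * d := by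
      rw [div_mul_eq_mul_div, le_div_iff₀ hδ]
      have : 0 ≤ 8 * A * (δ ^ (1 + κ - 2 * α) / (1 + κ - 2 * α)) := by positivity
      nlinarith
    rw [mul_assoc (2 * Θ)]
    refine mul_le_mul_of_nonneg_left ?_ hΘ
    linarith

end UnitScale

/-! ### Scaling -/

section Scaling

variable {α β κ A b c₀ Θ d δ R : ℝ}

lemma kern_smul (hR : 0 < R) (p : ℝ × ℝ) : kern α (R • p) = R ^ (-(2 + 2 * α)) * kern α p := by
  unfold kern
  have h1 : (R • p).1 ^ 2 + (R • p).2 ^ 2 = R ^ 2 * (p.1 ^ 2 + p.2 ^ 2) := by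
    simp only [Prod.smul_fst, Prod.smul_snd, smul_eq_mul]; ring
  rw [h1, Real.mul_rpow (by positivity) (by positivity), ← Real.rpow_natCast, ← Real.rpow_mul hR.le]
  congr 2; push_cast; ring

/-- Homogeneity: the kernel has degree `-2-2α`, the factor `p.1` degree 1 and the area element
degree 2. A unit scale bound proportional to `d / R` thus becomes one proportional to `R^(-2α) d`.
-/
lemma integral_kern_sub_scale (hR : 0 < R) (G : ℝ × ℝ → ℝ) :
    ∫ p : ℝ × ℝ, p.1 * (kern α (p.1, p.2 - d) - kern α p) * G p =
      R ^ (1 - 2 * α) *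
        ∫ p : ℝ × ℝ, p.1 * (kern α (p.1, p.2 - d / R) - kern α p) * G (R • p) := by
  have h1 := Measure.integral_comp_smul (volume : Measure (ℝ × ℝ))
    (fun p : ℝ × ℝ => p.1 * (kern α (p.1, p.2 - d) - kern α p) * G p) R
  have hdim : Module.finrank ℝ (ℝ × ℝ) = 2 := by simp
  rw [hdim, abs_of_pos (by positivity), smul_eq_mul, inv_mul_eq_div, eq_div_iff (by positivity)]
    at h1
  rw [← h1, ← integral_const_mul, ← integral_mul_const]
  congr 1
  ext p
  have h2 : kern α ((R • p).1, (R • p).2 - d) = R ^ (-(2 + 2 * α)) * kern α (p.1, p.2 - d / R) := by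
    rw [← kern_smul hR]
    congr 1
    ext
    · simp
    · simp only [Prod.smul_snd, smul_eq_mul]; field_simp
  rw [h2, kern_smul hR, Prod.smul_fst, smul_eq_mul]
  have h3 : R ^ (1 - 2 * α) = R ^ (-(2 + 2 * α)) * R ^ 3 := by
    rw [← Real.rpow_natCast R 3, ← Real.rpow_add hR]; congr 1; push_cast; ring
  rw [h3]; ring

end Scaling

/-! ### Velocity differences -/

section VelDiff

variable {α β κ A A₀ b c c' c₀ Θ B d δ R : ℝ} {ω : Plane → ℝ} {Γ : Set Plane} {q τ : Plane}

/-- Makes the normal velocity independent of the orientation of the curve, so that a single `τ`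
serves both points of a pair. -/
lemma vel_neg (α : ℝ) (ω : Plane → ℝ) (z τ : Plane) : vel α ω z (-τ) = -vel α ω z τ := by
  have hp : perp (-τ) = -perp τ := perp_neg τ
  have hfp : ∀ p : ℝ × ℝ, framePoint z (-τ) p = framePoint z τ (-p.1, -p.2) := by
    intro p
    unfold framePoint
    rw [hp]; simp
  have e : MeasurePreserving (fun p : ℝ × ℝ => (p.1, -p.2)) :=
    (MeasurePreserving.id volume).prod (Measure.measurePreserving_neg (volume : Measure ℝ))
  have e' : MeasurableEmbedding (fun p : ℝ × ℝ => (p.1, -p.2)) :=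
    ((Homeomorph.refl ℝ).prodCongr (Homeomorph.neg ℝ)).measurableEmbedding
  unfold vel
  rw [← mul_neg, ← integral_neg, ← e.integral_comp e']
  congr 2
  ext p
  unfold oddPart
  rw [hfp, hfp]
  simp only [kern, neg_neg, neg_sq]
  ring

lemma framePoint_add (q τ : Plane) (d : ℝ) (p : ℝ × ℝ) :
    framePoint (q + d • perp τ) τ p = framePoint q τ (p.1, p.2 + d) := by
  unfold framePoint
  simp only [add_smul]; abel

/-- Translation by `d • perp τ` moves the change of base point from the density into the kernel, so
both velocities test the same odd part. -/
lemma vel_sub_vel (hp : Integrable fun p : ℝ × ℝ =>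
      p.1 * kern α p * oddPart ω (q + d • perp τ) τ p)
    (hq : Integrable fun p : ℝ × ℝ => p.1 * kern α p * oddPart ω q τ p) :
    vel α ω (q + d • perp τ) τ - vel α ω q τ =
      -(1 / 2) * ∫ p : ℝ × ℝ, p.1 * (kern α (p.1, p.2 - d) - kern α p) * oddPart ω q τ p := by
  have h1 : ∀ p : ℝ × ℝ, (p - (0, d)).1 * kern α (p - (0, d)) *
      oddPart ω (q + d • perp τ) τ (p - (0, d)) =
      p.1 * kern α (p.1, p.2 - d) * oddPart ω q τ p := by
    intro p
    have h2 : p - (0, d) = (p.1, p.2 - d) := by ext <;> simp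
    rw [h2]
    unfold oddPart
    rw [framePoint_add, framePoint_add]
    simp only [sub_add_cancel]
  have hp' := hp.comp_sub_right (0, d)
  simp_rw [h1] at hp'
  have h3 : ∫ p : ℝ × ℝ, p.1 * kern α p * oddPart ω (q + d • perp τ) τ p =
      ∫ p : ℝ × ℝ, p.1 * kern α (p.1, p.2 - d) * oddPart ω q τ p := by
    rw [← integral_sub_right_eq_self _ ((0, d) : ℝ × ℝ)]
    simp_rw [h1]
  unfold vel
  rw [h3, ← mul_sub, ← integral_sub hp' hq]
  congr 2
  ext p
  ring

/-- Between two thin regions around parabolas (or lines) the density has no odd part. -/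
lemma IsPatchFunction.mem_strip_of_oddPart_ne_zero (hω : IsPatchFunction ω Γ Θ B) (hd : 0 < d)
    (hA : 0 ≤ A) (hβ : 0 ≤ β) (hcc : c ≤ c') (hcβ : c = c' ∨ 1 ≤ β) (hdb : d ≤ b)
    (hAb : A * b ^ (1 + β) ≤ b / 8) (hcb : |c| * b ^ 2 ≤ b / 8) (hcb' : |c'| * b ^ 2 ≤ b / 8)
    (hΓ : ∀ w : ℝ × ℝ, |w.1| ≤ b → |w.2| ≤ 2 * b → framePoint q τ w ∈ Γ →
      |w.2 - c * w.1 ^ 2| ≤ A * |w.1| ^ (1 + β) ∨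
      |w.2 - (d + c' * w.1 ^ 2)| ≤ A * |w.1| ^ (1 + β))
    {w : ℝ × ℝ} (hw : ‖w‖ ≤ b) (hodd : oddPart ω q τ w ≠ 0) :
    |w.2 - c * w.1 ^ 2| ≤ A * |w.1| ^ (1 + β) ∨
      |w.2 - (d + c' * w.1 ^ 2)| ≤ A * |w.1| ^ (1 + β) := by
  by_contra! hcon
  obtain ⟨hf, hg⟩ := hcon
  apply hodd
  have hw1 : |w.1| ≤ b := (norm_fst_le w).trans hw
  have hw2 : |w.2| ≤ b := (norm_snd_le w).trans hw
  have hb : 0 < b := hd.trans_le hdb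
  set S : ℝ → ℝ := fun y => A * |y| ^ (1 + β) with hS
  have hSc : Continuous S :=
    continuous_const.mul (continuous_abs.rpow_const fun _ => Or.inr (by linarith))
  have hS0 : ∀ y, 0 ≤ S y := fun y => by positivity
  have hSb : ∀ y, |y| ≤ |w.1| → S y ≤ b / 8 := fun y hy => by
    refine le_trans ?_ hAb
    have := hy.trans hw1
    simp only [hS]
    gcongr
  have hsq : ∀ y, |y| ≤ |w.1| → y ^ 2 ≤ b ^ 2 := fun y hy => by
    rw [← sq_abs]; exact pow_le_pow_left₀ (abs_nonneg _) (hy.trans hw1) 2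
  have hquad : ∀ e : ℝ, |e| * b ^ 2 ≤ b / 8 → ∀ y, |y| ≤ |w.1| → |e * y ^ 2| ≤ b / 8 := by
    intro e he y hy
    rw [abs_mul, abs_of_nonneg (sq_nonneg y)]
    exact (mul_le_mul_of_nonneg_left (hsq y hy) (abs_nonneg e)).trans he
  have hfg : ∀ y : ℝ, c * y ^ 2 ≤ d + c' * y ^ 2 := fun y => by nlinarith [sq_nonneg y]
  -- It suffices to join `w` to its mirror image by an even graph that stays in the box and misses
  -- both strips. Above or below both strips, an outer edge is translated through `w`.
  have key : ∀ m : ℝ → ℝ, Continuous m → (∀ y, m (-y) = m y) → m w.1 = w.2 →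
      (∀ y, |y| ≤ |w.1| → |m y| ≤ 2 * b ∧ S y < |m y - c * y ^ 2| ∧
        S y < |m y - (d + c' * y ^ 2)|) → oddPart ω q τ w = 0 := by
    intro m hm heven hmw h
    refine hω.oddPart_eq_zero_of_graph hm hmw ((heven _).trans hmw) fun y hy hmem => ?_
    obtain ⟨h1, h2, h3⟩ := h y hy
    rcases hΓ (y, m y) (hy.trans hw1) h1 hmem with h4 | h4
    · exact absurd h4 (not_le.mpr h2)
    · exact absurd h4 (not_le.mpr h3)
  have hw1' : |w.1| ≤ |w.1| := le_rfl
  rcases lt_abs.mp hf with hf' | hf'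
  · rcases lt_abs.mp hg with hg' | hg'
    · refine key (fun y => w.2 + (c' * y ^ 2 + S y) - (c' * w.1 ^ 2 + S w.1)) (by fun_prop)
        (fun y => by simp [hS]) (by ring) fun y hy => ⟨?_, ?_, ?_⟩
      · have h1 := abs_le.mp (hquad c' hcb' y hy)
        have h2 := abs_le.mp (hquad c' hcb' _ hw1')
        have h3 := abs_le.mp hw2
        rw [abs_le]
        constructor <;> linarith [hS0 y, hS0 w.1, hSb y hy, hSb _ hw1']
      · refine lt_of_lt_of_le ?_ (le_abs_self _)
        simp only [hS] at *
        linarith [hfg y]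
      · refine lt_of_lt_of_le ?_ (le_abs_self _)
        simp only [hS] at *
        linarith
    -- The gap between the strips is open at `w` and must remain so towards the axis. For `c = c'`
    -- it widens as `|y|` decreases. For `1 ≤ β`, with `t = |y| / |w.1|`, the strip height satisfies
    -- `S y ≤ t² S w.1`, so the gap at `y` is at least `t²` times the gap at `w` plus `(1 - t²) d`.
    · have hgap : ∀ y, |y| ≤ |w.1| → 0 < (d + c' * y ^ 2 - S y) - (c * y ^ 2 + S y) := by
        intro y hy
        have h0 : 0 < d + (c' - c) * w.1 ^ 2 - 2 * S w.1 := by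
          simp only [hS] at *; linarith
        suffices 0 < d + (c' - c) * y ^ 2 - 2 * S y by linarith
        rcases hcβ with h | h
        · have h2 : S y ≤ S w.1 := by simp only [hS]; gcongr
          rw [h, sub_self, zero_mul] at h0 ⊢
          linarith
        · rcases eq_or_ne w.1 0 with hw0 | hw0
          · have : y = w.1 := by
              rw [hw0, abs_zero] at hy
              rw [hw0, abs_eq_zero.mp (le_antisymm hy (abs_nonneg _))]
            rw [this]; exact h0
          have hpos := abs_pos.mpr hw0
          set t := |y| / |w.1| with ht
          have ht0 : 0 ≤ t := by positivity
          have ht1 : t ≤ 1 := (div_le_one hpos).mpr hy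
          have hyt : |y| = t * |w.1| := by rw [ht]; field_simp
          have h2 : y ^ 2 = t ^ 2 * w.1 ^ 2 := by
            rw [← sq_abs y, hyt, mul_pow, sq_abs]
          have h3 : S y ≤ t ^ 2 * S w.1 := by
            simp only [hS]
            rw [hyt, Real.mul_rpow ht0 hpos.le]
            have h4 : t ^ (1 + β) ≤ t ^ 2 := by
              rw [← Real.rpow_natCast]
              exact Real.rpow_le_rpow_of_exponent_ge' ht0 ht1 (by norm_num)
                (by push_cast; linarith)
            have h5 : 0 ≤ A * |w.1| ^ (1 + β) := by positivity
            nlinarith [mul_le_mul_of_nonneg_right h4 h5]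
          have h6 : t ^ 2 ≤ 1 := pow_le_one₀ ht0 ht1
          rcases eq_or_lt_of_le h6 with h7 | h7
          · rw [h2]; rw [h7] at h3 ⊢; linarith
          · rw [h2]
            nlinarith [mul_nonneg (sq_nonneg t) h0.le, mul_pos (sub_pos.mpr h7) hd]
      -- The graph that divides the gap in the ratio in which `w` divides it.
      set lam := (w.2 - (c * w.1 ^ 2 + S w.1)) /
        ((d + c' * w.1 ^ 2 - S w.1) - (c * w.1 ^ 2 + S w.1)) with hlam
      have hg0 := hgap _ hw1'
      have hl0 : 0 < lam := div_pos (by simp only [hS] at *; linarith) hg0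
      have hl1 : lam < 1 := (div_lt_one hg0).mpr (by simp only [hS] at *; linarith)
      refine key (fun y => (c * y ^ 2 + S y) +
        lam * ((d + c' * y ^ 2 - S y) - (c * y ^ 2 + S y))) (by fun_prop)
        (fun y => by simp [hS]) ?_ fun y hy => ?_
      · rw [hlam, div_mul_cancel₀ _ hg0.ne']; ring
      · have hgy := hgap y hy
        have h1 : 0 < lam * ((d + c' * y ^ 2 - S y) - (c * y ^ 2 + S y)) := mul_pos hl0 hgy
        have h2 : lam * ((d + c' * y ^ 2 - S y) - (c * y ^ 2 + S y)) <
          (d + c' * y ^ 2 - S y) - (c * y ^ 2 + S y) := by nlinarith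
        have h3 := abs_le.mp (hquad c hcb y hy)
        have h4 := abs_le.mp (hquad c' hcb' y hy)
        refine ⟨?_, ?_, ?_⟩
        · rw [abs_le]
          constructor <;> linarith [hS0 y, hSb y hy]
        · refine lt_of_lt_of_le ?_ (le_abs_self _)
          linarith
        · refine lt_of_lt_of_le ?_ (neg_le_abs _)
          linarith
  · refine key (fun y => w.2 + (c * y ^ 2 - S y) - (c * w.1 ^ 2 - S w.1)) (by fun_prop)
      (fun y => by simp [hS]) (by ring) fun y hy => ⟨?_, ?_, ?_⟩
    · have h1 := abs_le.mp (hquad c hcb y hy)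
      have h2 := abs_le.mp (hquad c hcb _ hw1')
      have h3 := abs_le.mp hw2
      rw [abs_le]
      constructor <;> linarith [hS0 y, hS0 w.1, hSb y hy, hSb _ hw1']
    · refine lt_of_lt_of_le ?_ (neg_le_abs _)
      simp only [hS] at *
      linarith
    · refine lt_of_lt_of_le ?_ (neg_le_abs _)
      simp only [hS] at *
      linarith [hfg y]

/-- The velocity difference of two nearby boundary points, between almost parallel curves. -/
lemma abs_vel_sub_le_of_close (hω : IsPatchFunction ω Γ Θ B) (hα : 0 < α) (hβ : 2 * α ≤ β)
    (hβ' : β < 1 + 2 * α) (hκ : 0 < κ) (hκβ : κ ≤ β) (hA : 0 ≤ A₀) (hb : 0 < b) (hb1 : b ≤ 1)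
    (hc₀ : 0 ≤ c₀) (hR : 0 < R) (hd : 0 < d) (hdb : 2 * d ≤ b * R) (hAb : A₀ * b ^ β ≤ 1 / 8)
    (hcb : c₀ * b ≤ 1 / 8) (hc : |c| * R ≤ c₀) (hc' : |c'| * R ≤ c₀) (hcc : c ≤ c')
    (hcβ : (c = 0 ∧ c' = 0) ∨ (1 ≤ β ∧ κ = 1))
    (hp : Integrable fun p : ℝ × ℝ => p.1 * kern α p * oddPart ω (q + d • perp τ) τ p)
    (hq : Integrable fun p : ℝ × ℝ => p.1 * kern α p * oddPart ω q τ p)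
    (hΓ : ∀ w : ℝ × ℝ, |w.1| ≤ b * R → |w.2| ≤ 2 * (b * R) → framePoint q τ w ∈ Γ →
      |w.2 - c * w.1 ^ 2| ≤ A₀ * R ^ (-β) * |w.1| ^ (1 + β) ∨
      |w.2 - (d + c' * w.1 ^ 2)| ≤ A₀ * R ^ (-β) * |w.1| ^ (1 + β)) :
    |vel α ω (q + d • perp τ) τ - vel α ω q τ| ≤
      Θ * (2 * nearConst α β κ A₀ b c₀ + farConst α * (8 * (b ^ (-(2 * α)) / (2 * α)))) *
        (R ^ (-(2 * α)) * d) := by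
  rw [vel_sub_vel hp hq, integral_kern_sub_scale hR, abs_mul, abs_mul]
  have hquad : ∀ e : ℝ, |e| * R ≤ c₀ → |e| * (b * R) ^ 2 ≤ b * R / 8 := by
    intro e he
    calc |e| * (b * R) ^ 2 = (|e| * R) * b * (b * R) := by ring
      _ ≤ c₀ * b * (b * R) := by gcongr
      _ ≤ 1 / 8 * (b * R) := by gcongr
      _ = _ := by ring
  have hAb' : A₀ * R ^ (-β) * (b * R) ^ (1 + β) ≤ b * R / 8 := by
    rw [Real.mul_rpow hb.le hR.le, Real.rpow_add hb, Real.rpow_add hR, Real.rpow_one,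
      Real.rpow_one, Real.rpow_neg hR.le]
    have : 0 < R ^ β := Real.rpow_pos_of_pos hR _
    calc A₀ * (R ^ β)⁻¹ * (b * b ^ β * (R * R ^ β)) = (A₀ * b ^ β) * (b * R) := by field_simp
      _ ≤ 1 / 8 * (b * R) := by gcongr
      _ = _ := by ring
  have hquad' : ∀ e : ℝ, |e| * R ≤ c₀ → (e = 0 ∨ κ = 1) → ∀ y : ℝ, |y| ≤ b →
      |e * R * y ^ 2| ≤ c₀ * |y| ^ (1 + κ) := by
    intro e he hek y hy
    rcases hek with h | h
    · rw [h]; simp; positivity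
    · rw [h, abs_mul, abs_mul, abs_of_pos hR, abs_of_nonneg (sq_nonneg y), ← sq_abs]
      norm_num
      gcongr
  -- At unit scale the curvature coefficients become `c * R` and `c' * R`, bounded by `c₀`, and the
  -- strip constant becomes `A₀`.
  have hint := abs_integral_kern_sub_le (Θ := Θ) (G := fun p => oddPart ω q τ (R • p))
    (f := fun y => c * R * y ^ 2) (g := fun y => c' * R * y ^ 2) hα hβ hβ' hκ hκβ hA hb hb1 hc₀
    (div_pos hd hR) (by rw [← mul_div_assoc, div_le_iff₀ hR]; exact hdb)
    (fun p => hω.abs_oddPart_le _) (by fun_prop) (by fun_prop)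
    (hquad' c hc (hcβ.imp (fun h => h.1) fun h => h.2))
    (hquad' c' hc' (hcβ.imp (fun h => h.2) fun h => h.2)) (fun p hpb hne => by
      have hn : ‖R • p‖ ≤ b * R := by
        rw [norm_smul, Real.norm_of_nonneg hR.le, mul_comm]; gcongr
      have h := hω.mem_strip_of_oddPart_ne_zero (b := b * R) (A := A₀ * R ^ (-β)) (c := c)
        (c' := c') hd (by positivity) (by linarith) hcc
        (hcβ.imp (fun h => h.1.trans h.2.symm) fun h => h.1) (by linarith) hAb' (hquad c hc)
        (hquad c' hc') hΓ hn hne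
      simp only [Prod.smul_fst, Prod.smul_snd, smul_eq_mul] at h
      have hw : A₀ * R ^ (-β) * |R * p.1| ^ (1 + β) = R * (A₀ * |p.1| ^ (1 + β)) := by
        rw [abs_mul, abs_of_pos hR, Real.mul_rpow hR.le (abs_nonneg _), Real.rpow_add hR,
          Real.rpow_one, Real.rpow_neg hR.le]
        have : 0 < R ^ β := Real.rpow_pos_of_pos hR _
        field_simp
      have e1 : R * p.2 - c * (R * p.1) ^ 2 = R * (p.2 - c * R * p.1 ^ 2) := by ring
      have e2 : R * p.2 - (d + c' * (R * p.1) ^ 2) = R * (p.2 - (d / R + c' * R * p.1 ^ 2)) := by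
        field_simp
      rw [hw, e1, e2, abs_mul, abs_mul, abs_of_pos hR, mul_le_mul_iff_right₀ hR,
        mul_le_mul_iff_right₀ hR] at h
      exact h)
  have hRp : 0 < R ^ (1 - 2 * α) := Real.rpow_pos_of_pos hR _
  have hRe : R ^ (1 - 2 * α) * (d / R) = R ^ (-(2 * α)) * d := by
    rw [show 1 - 2 * α = -(2 * α) + 1 by ring, Real.rpow_add_one hR.ne']
    field_simp
  rw [abs_of_pos hRp, show |(-(1 / 2 : ℝ))| = 1 / 2 by norm_num]
  refine (mul_le_mul_of_nonneg_left (mul_le_mul_of_nonneg_left hint hRp.le)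
    (by norm_num)).trans (le_of_eq ?_)
  rw [← hRe]; ring

/-- The velocity difference of two boundary points that are not close to each other. -/
lemma abs_vel_sub_le_of_far (hω : IsPatchFunction ω Γ Θ B) (hα : 0 < α) (hτ : ‖τ‖ = 1)
    (hκα : 2 * α - 1 < κ) (hκ : 0 < κ) (hA : 0 ≤ A₀) (hδ : 0 < δ) (hR : 0 < R) (hd : 0 < d)
    (hδd : δ * R < 2 * d)
    (hp : Integrable fun p : ℝ × ℝ => p.1 * kern α p * oddPart ω (q + d • perp τ) τ p)
    (hq : Integrable fun p : ℝ × ℝ => p.1 * kern α p * oddPart ω q τ p)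
    (hfp : FlatAt Γ (q + d • perp τ) τ (δ * R) (A₀ * R ^ (-κ)) κ)
    (hfq : FlatAt Γ q τ (δ * R) (A₀ * R ^ (-κ)) κ) :
    |vel α ω (q + d • perp τ) τ - vel α ω q τ| ≤
      Θ * (16 * A₀ * (δ ^ (1 + κ - 2 * α) / (1 + κ - 2 * α)) / δ +
        (6 + farConst α) * (8 * (δ ^ (-(2 * α)) / (2 * α)))) * (R ^ (-(2 * α)) * d) := by
  rw [vel_sub_vel hp hq, integral_kern_sub_scale hR, abs_mul, abs_mul]
  have hscale : ∀ (z : Plane) (p : ℝ × ℝ), FlatAt Γ z τ (δ * R) (A₀ * R ^ (-κ)) κ → ‖p‖ ≤ δ →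
      oddPart ω z τ (R • p) ≠ 0 → |p.2| ≤ A₀ * |p.1| ^ (1 + κ) := by
    intro z p hf hpδ hne
    by_contra! hcon
    apply hne
    have hn : ‖R • p‖ ≤ δ * R := by
      rw [norm_smul, Real.norm_of_nonneg hR.le, mul_comm]; gcongr
    refine hf.oddPart_eq_zero hω hτ (by positivity) hκ ((norm_fst_le _).trans hn)
      ((norm_snd_le _).trans hn) ?_
    simp only [Prod.smul_fst, Prod.smul_snd, smul_eq_mul]
    have hw : A₀ * R ^ (-κ) * |R * p.1| ^ (1 + κ) = R * (A₀ * |p.1| ^ (1 + κ)) := by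
      rw [abs_mul, abs_of_pos hR, Real.mul_rpow hR.le (abs_nonneg _), Real.rpow_add hR,
        Real.rpow_one, Real.rpow_neg hR.le]
      have : 0 < R ^ κ := Real.rpow_pos_of_pos hR _
      field_simp
    rw [hw, abs_mul, abs_of_pos hR]
    gcongr
  have hint := abs_integral_kern_sub_le_of_far (Θ := Θ) (G := fun p => oddPart ω q τ (R • p))
    (d := d / R) hα hκα hA hδ (div_pos hd hR)
    (by rw [← mul_div_assoc, lt_div_iff₀ hR]; exact hδd)
    (fun p => hω.abs_oddPart_le _) (fun p hpδ hne => hscale q p hfq hpδ hne)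
    (fun p hpδ hne => by
      refine hscale (q + d • perp τ) (p.1, p.2 - d / R) hfp hpδ ?_
      convert hne using 1
      unfold oddPart
      rw [framePoint_add, framePoint_add]
      have e : R * (p.2 - d / R) + d = R * p.2 := by field_simp; ring
      simp only [Prod.smul_fst, Prod.smul_snd, smul_eq_mul, e]
      rfl)
  have hRp : 0 < R ^ (1 - 2 * α) := Real.rpow_pos_of_pos hR _
  have hRe : R ^ (1 - 2 * α) * (d / R) = R ^ (-(2 * α)) * d := by
    rw [show 1 - 2 * α = -(2 * α) + 1 by ring, Real.rpow_add_one hR.ne']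
    field_simp
  rw [abs_of_pos hRp, show |(-(1 / 2 : ℝ))| = 1 / 2 by norm_num]
  refine (mul_le_mul_of_nonneg_left (mul_le_mul_of_nonneg_left hint hRp.le)
    (by norm_num)).trans (le_of_eq ?_)
  rw [← hRe]; ring

end VelDiff

/-! ### Curves with Hölder continuous curvature -/

lemma norm_sub_sub_smul_le {f f' : ℝ → Plane} {v : Plane} {s h C : ℝ}
    (hf : ∀ u, HasDerivAt f (f' u) u) (hC : ∀ u, |u - s| ≤ |h| → ‖f' u - v‖ ≤ C) :
    ‖f (s + h) - f s - h • v‖ ≤ C * |h| := by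
  have h1 : ∀ u ∈ uIcc s (s + h), HasDerivWithinAt (fun u => f u - u • v)
      (f' u - v) (uIcc s (s + h)) u := by
    intro u _
    have h2 := (hf u).sub ((hasDerivAt_id u).smul_const v)
    rw [one_smul] at h2
    exact h2.hasDerivWithinAt
  have h3 : ∀ u ∈ uIcc s (s + h), ‖f' u - v‖ ≤ C := by
    intro u hu
    have h4 := abs_sub_left_of_mem_uIcc hu
    rw [add_sub_cancel_left] at h4
    exact hC u h4
  have h4 := Convex.norm_image_sub_le_of_norm_hasDerivWithin_le h1 h3 (convex_uIcc _ _)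
    left_mem_uIcc right_mem_uIcc
  have h5 : f (s + h) - (s + h) • v - (f s - s • v) = f (s + h) - f s - h • v := by
    rw [add_smul]; abel
  rw [h5] at h4
  simpa using h4

/-- A twice differentiable unit speed curve with Hölder continuous second derivative. -/
structure IsHolderCurve₂ (M γ : ℝ) (x : ℝ → Plane) : Prop where
  differentiable : Differentiable ℝ x
  differentiable_deriv : Differentiable ℝ (deriv x)
  unit_speed : ∀ s, ‖deriv x s‖ = 1
  holder : ∀ s r, ‖deriv (deriv x) s - deriv (deriv x) r‖ ≤ M * |s - r| ^ γ

namespace IsHolderCurve₂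

variable {M γ R : ℝ} {x : ℝ → Plane}

lemma taylor_deriv (hx : IsHolderCurve₂ M γ x) (hM : 0 ≤ M) (hγ : 0 ≤ γ) (s h : ℝ) :
    ‖deriv x (s + h) - deriv x s - h • deriv (deriv x) s‖ ≤ M * |h| ^ γ * |h| := by
  refine norm_sub_sub_smul_le (fun u => (hx.differentiable_deriv u).hasDerivAt) fun u hu => ?_
  refine (hx.holder u s).trans ?_
  gcongr

lemma taylor (hx : IsHolderCurve₂ M γ x) (hM : 0 ≤ M) (hγ : 0 ≤ γ) (s h : ℝ) :
    ‖x (s + h) - x s - h • deriv x s - (h ^ 2 / 2) • deriv (deriv x) s‖ ≤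
      M * |h| ^ γ * |h| * |h| := by
  have hg : ∀ u, HasDerivAt (fun u => x u - (u - s) • deriv x s
      - ((u - s) ^ 2 / 2) • deriv (deriv x) s)
      (deriv x u - deriv x s - (u - s) • deriv (deriv x) s) u := by
    intro u
    have h1 := (hx.differentiable u).hasDerivAt
    have h2 := ((hasDerivAt_id u).sub_const s).smul_const (deriv x s)
    have h3 : HasDerivAt (fun u : ℝ => (u - s) ^ 2 / 2) (u - s) u := by
      have := (((hasDerivAt_id u).sub_const s).pow 2).div_const 2
      simpa using this
    have h4 := (h1.sub h2).sub (h3.smul_const (deriv (deriv x) s))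
    rw [one_smul] at h4
    exact h4
  have h := norm_sub_sub_smul_le (v := 0) (s := s) (h := h) (C := M * |h| ^ γ * |h|) hg
    fun u hu => by
      rw [sub_zero]
      have h5 := hx.taylor_deriv hM hγ s (u - s)
      rw [add_sub_cancel] at h5
      refine h5.trans ?_
      gcongr
  simp only [add_sub_cancel_left, sub_self, zero_smul, smul_zero, sub_zero] at h
  refine le_trans (le_of_eq ?_) h
  congr 1
  simp only [ne_eq, OfNat.ofNat_ne_zero, not_false_eq_true, zero_pow, zero_div, zero_smul, sub_zero]
  abel

/-- Interpolation: the unit tangents at `s ± R` differ by at most 2 and the two Taylor errors add at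
most 2, all divided by `2R`. The direct bound of the second derivative by the boundary norm would be
too weak at length scale `R`. -/
lemma norm_deriv_deriv_le (hx : IsHolderCurve₂ M γ x) (hM : 0 ≤ M) (hγ : 0 ≤ γ) (hR : 0 < R)
    (hMR : M * R ^ γ * R ≤ 1) (s : ℝ) : ‖deriv (deriv x) s‖ ≤ 2 / R := by
  have h1 := hx.taylor_deriv hM hγ s R
  have h2 := hx.taylor_deriv hM hγ s (-R)
  rw [abs_neg] at h2
  rw [abs_of_pos hR] at h1 h2
  have h3 : (2 * R) • deriv (deriv x) s = (deriv x (s + R) - deriv x (s + -R))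
      - ((deriv x (s + R) - deriv x s - R • deriv (deriv x) s)
        - (deriv x (s + -R) - deriv x s - (-R) • deriv (deriv x) s)) := by
    rw [mul_smul, two_smul, neg_smul]; abel
  have h4 : ‖(2 * R) • deriv (deriv x) s‖ ≤ 4 := by
    rw [h3]
    refine (norm_sub_le _ _).trans ?_
    have h5 := norm_sub_le (deriv x (s + R)) (deriv x (s + -R))
    have h6 := norm_sub_le (deriv x (s + R) - deriv x s - R • deriv (deriv x) s)
      (deriv x (s + -R) - deriv x s - (-R) • deriv (deriv x) s)
    rw [hx.unit_speed, hx.unit_speed] at h5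
    linarith
  rw [norm_smul, Real.norm_of_nonneg (by positivity)] at h4
  rw [le_div_iff₀ hR]; linarith

lemma isHolderCurve (hx : IsHolderCurve₂ M γ x) (hM : 0 ≤ M) (hγ : 0 ≤ γ) (hR : 0 < R)
    (hMR : M * R ^ γ * R ≤ 1) : IsHolderCurve (2 / R) 1 x where
  differentiable := hx.differentiable
  unit_speed := hx.unit_speed
  holder s r := by
    have := Convex.norm_image_sub_le_of_norm_deriv_le (f := deriv x) (s := univ) (C := 2 / R)
      (x := r) (y := s) (fun u _ => hx.differentiable_deriv u)
      (fun u _ => hx.norm_deriv_deriv_le hM hγ hR hMR u) convex_univ trivial trivial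
    simpa using this

end IsHolderCurve₂

/-- The curve `x` stays, for arc length at most `l` from `s`, close to the parabola with curvature
`2 c` in the frame `(τ, τ^⊥)`. -/
def NearParabola (x : ℝ → Plane) (s : ℝ) (τ : Plane) (c A β l : ℝ) : Prop :=
  ∀ h, |h| ≤ l → |inner ℝ (x (s + h) - x s) (perp τ) - c * inner ℝ (x (s + h) - x s) τ ^ 2| ≤
    A * |inner ℝ (x (s + h) - x s) τ| ^ (1 + β)

lemma IsHolderCurve.nearParabola {H κ h₀ : ℝ} {x : ℝ → Plane} (hx : IsHolderCurve H κ x)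
    (hH : 0 ≤ H) (hκ : 0 < κ) (hκ₁ : κ ≤ 1) (hh₀ : H * h₀ ^ κ ≤ 1 / 8) {s : ℝ} {τ : Plane}
    (hτ : deriv x s = τ ∨ deriv x s = -τ) : NearParabola x s τ 0 (2 * H) κ h₀ := by
  intro h hh
  have h1 := (hx.frame_bounds hH hκ hκ₁ hh₀ s hh).2
  rw [zero_mul, sub_zero]
  rcases hτ with h2 | h2
  · rwa [h2] at h1
  · rw [h2, perp_neg, inner_neg_right, inner_neg_right, abs_neg, abs_neg] at h1
    exact h1

/-- Second order Taylor expansion in arc length `h`, with `h²` then replaced by the square of the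
tangential coordinate. The replacement costs `O(|h|³ / R²)`, which is `O(R^(-1-γ) |h|^(2+γ))`
because `|h| ≤ R`. The orientation of the tangent drops out since only `h²` enters. -/
lemma IsHolderCurve₂.nearParabola {M γ R h₀ : ℝ} {x : ℝ → Plane} (hx : IsHolderCurve₂ M γ x)
    (hγ : 0 < γ) (hγ₁ : γ ≤ 1) (hR : 0 < R) (hM : M = R ^ (-(1 + γ))) (hh₀ : h₀ ≤ R / 16) {s : ℝ}
    {τ : Plane} (hτ : deriv x s = τ ∨ deriv x s = -τ) :
    NearParabola x s τ (inner ℝ (deriv (deriv x) s) (perp τ) / 2) (16 * R ^ (-(1 + γ))) (1 + γ)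
      h₀ := by
  intro h hh
  have hM0 : 0 ≤ M := by rw [hM]; positivity
  have hMR : M * R ^ γ * R ≤ 1 := by
    rw [hM, mul_assoc, ← Real.rpow_add_one hR.ne', ← Real.rpow_add hR]
    rw [show -(1 + γ) + (γ + 1) = 0 by ring, Real.rpow_zero]
  have hcurv := hx.norm_deriv_deriv_le hM0 hγ.le hR hMR s
  have hH := hx.isHolderCurve hM0 hγ.le hR hMR
  have h1 := hH.taylor (by positivity) zero_le_one s h
  have h2 := hx.taylor hM0 hγ.le s h
  have hu := hx.unit_speed s
  have hτ1 : ‖τ‖ = 1 := by rcases hτ with e | e <;> rw [e] at hu <;> simpa using hu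
  obtain ⟨σ, hσ, hdτ⟩ : ∃ σ : ℝ, σ ^ 2 = 1 ∧ deriv x s = σ • τ := by
    rcases hτ with e | e
    · exact ⟨1, by norm_num, by rw [e, one_smul]⟩
    · exact ⟨-1, by norm_num, by rw [e, neg_one_smul]⟩
  rw [hdτ] at h1 h2
  set w := x (s + h) - x s with hw
  set v := deriv (deriv x) s with hv
  have hττ : inner ℝ τ τ = (1 : ℝ) := by rw [real_inner_self_eq_norm_sq, hτ1]; norm_num
  have i1 : |inner ℝ (w - h • σ • τ) τ| ≤ ‖w - h • σ • τ‖ := by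
    simpa [hτ1] using abs_real_inner_le_norm (w - h • σ • τ) τ
  have i2 : |inner ℝ (w - h • σ • τ - (h ^ 2 / 2) • v) (perp τ)| ≤
      ‖w - h • σ • τ - (h ^ 2 / 2) • v‖ := by
    simpa [hτ1] using abs_real_inner_le_norm (w - h • σ • τ - (h ^ 2 / 2) • v) (perp τ)
  rw [inner_sub_left, real_inner_smul_left, real_inner_smul_left, hττ, mul_one] at i1
  rw [inner_sub_left, inner_sub_left, real_inner_smul_left, real_inner_smul_left, inner_perp_self,
    mul_zero, mul_zero, sub_zero, real_inner_smul_left] at i2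
  have hc : |inner ℝ v (perp τ)| ≤ 2 / R := by
    have := abs_real_inner_le_norm v (perp τ)
    rw [norm_perp, hτ1, mul_one] at this
    exact this.trans hcurv
  set X := inner ℝ w τ with hX
  set Y := inner ℝ w (perp τ) with hY
  set e := inner ℝ v (perp τ) with he
  have hhR : |h| ≤ R / 16 := hh.trans hh₀
  rw [Real.rpow_one] at h1
  have hX1 : |X - h * σ| ≤ 2 / R * |h| * |h| := i1.trans h1
  have hX2 : |X - h * σ| ≤ |h| / 8 := by
    refine hX1.trans ?_
    have : 2 / R * |h| ≤ 1 / 8 := by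
      rw [div_mul_eq_mul_div, div_le_iff₀ hR]; linarith
    nlinarith [abs_nonneg h]
  have hσ1 : |σ| = 1 := by
    have := sq_abs σ
    rw [hσ] at this
    nlinarith [abs_nonneg σ]
  have hhσ : |h * σ| = |h| := by rw [abs_mul, hσ1, mul_one]
  have hXle : |X| ≤ 9 / 8 * |h| := by
    have := abs_sub_abs_le_abs_sub X (h * σ)
    rw [hhσ] at this; linarith
  have hXge : |h| ≤ 8 / 7 * |X| := by
    have := abs_sub_abs_le_abs_sub (h * σ) X
    rw [hhσ, abs_sub_comm] at this; linarith
  rcases eq_or_ne h 0 with h0 | h0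
  · have hw0 : w = 0 := by rw [hw, h0, add_zero, sub_self]
    rw [hX, hY, hw0]; simp; positivity
  have hpos := abs_pos.mpr h0
  have hp3 : |h| ^ γ * |h| * |h| = |h| ^ (1 + (1 + γ)) := by
    rw [← Real.rpow_add_one hpos.ne', ← Real.rpow_add_one hpos.ne']; congr 1; ring
  have t1 : |Y - h ^ 2 / 2 * e| ≤ R ^ (-(1 + γ)) * |h| ^ (1 + (1 + γ)) := by
    refine i2.trans (h2.trans (le_of_eq ?_))
    rw [← hp3, hM]; ring
  have t2 : |h ^ 2 - X ^ 2| ≤ 17 / 4 / R * |h| ^ 3 := by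
    have : h ^ 2 - X ^ 2 = -((X - h * σ) * (X + h * σ)) := by
      have : h ^ 2 = (h * σ) ^ 2 := by rw [mul_pow, hσ, mul_one]
      rw [this]; ring
    rw [this, abs_neg, abs_mul]
    have h5 : |X + h * σ| ≤ 17 / 8 * |h| := by
      refine (abs_add_le _ _).trans ?_
      rw [hhσ]; linarith
    calc |X - h * σ| * |X + h * σ| ≤ (2 / R * |h| * |h|) * (17 / 8 * |h|) := by gcongr
      _ = _ := by ring
  have t3 : R ^ (-(2 : ℝ)) * |h| ^ 3 ≤ R ^ (-(1 + γ)) * |h| ^ (1 + (1 + γ)) := by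
    have e1 : R ^ (-(2 : ℝ)) = R ^ (-(1 + γ)) * R ^ (-(1 - γ)) := by
      rw [← Real.rpow_add hR]; congr 1; ring
    have e2 : |h| ^ 3 = |h| ^ (1 + (1 + γ)) * |h| ^ (1 - γ) := by
      rw [← Real.rpow_add hpos, ← Real.rpow_natCast]; congr 1; push_cast; ring
    have e3 : |h| ^ (1 - γ) ≤ R ^ (1 - γ) :=
      Real.rpow_le_rpow hpos.le (by linarith) (by linarith)
    have e4 : R ^ (-(1 - γ)) * R ^ (1 - γ) = 1 := by
      rw [← Real.rpow_add hR]; simp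
    rw [e1, e2]
    calc R ^ (-(1 + γ)) * R ^ (-(1 - γ)) * (|h| ^ (1 + (1 + γ)) * |h| ^ (1 - γ))
        ≤ R ^ (-(1 + γ)) * R ^ (-(1 - γ)) * (|h| ^ (1 + (1 + γ)) * R ^ (1 - γ)) := by gcongr
      _ = R ^ (-(1 + γ)) * |h| ^ (1 + (1 + γ)) * (R ^ (-(1 - γ)) * R ^ (1 - γ)) := by ring
      _ = _ := by rw [e4, mul_one]
  have t4 : |e / 2 * (h ^ 2 - X ^ 2)| ≤ 17 / 4 * (R ^ (-(2 : ℝ)) * |h| ^ 3) := by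
    rw [abs_mul, abs_div, abs_two]
    calc |e| / 2 * |h ^ 2 - X ^ 2| ≤ (2 / R) / 2 * (17 / 4 / R * |h| ^ 3) := by gcongr
      _ = _ := by
        rw [Real.rpow_neg hR.le, Real.rpow_two]; field_simp
  have t5 : |h| ^ (1 + (1 + γ)) ≤ 2 * |X| ^ (1 + (1 + γ)) := by
    calc |h| ^ (1 + (1 + γ)) ≤ (8 / 7 * |X|) ^ (1 + (1 + γ)) := by gcongr
      _ = (8 / 7) ^ (1 + (1 + γ)) * |X| ^ (1 + (1 + γ)) := by
        rw [Real.mul_rpow (by norm_num) (abs_nonneg _)]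
      _ ≤ (8 / 7) ^ (3 : ℝ) * |X| ^ (1 + (1 + γ)) := by
        gcongr
        · norm_num
        · linarith
      _ ≤ _ := by
        gcongr
        have : (8 / 7 : ℝ) ^ (3 : ℝ) = (8 / 7) ^ 3 := by
          rw [← Real.rpow_natCast]; norm_num
        rw [this]; norm_num
  have hsplit : Y - e / 2 * X ^ 2 = (Y - h ^ 2 / 2 * e) + e / 2 * (h ^ 2 - X ^ 2) := by ring
  rw [hsplit]
  refine (abs_add_le _ _).trans ?_
  have hRp : 0 ≤ R ^ (-(1 + γ)) := by positivity
  have t6 := mul_le_mul_of_nonneg_left t5 hRp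
  have t7 : 0 ≤ R ^ (-(1 + γ)) * |X| ^ (1 + (1 + γ)) := by positivity
  linarith

/-! ### Nearly straight arcs -/

section Straight

variable {H κ r : ℝ} {x : ℝ → Plane}

/-- The tangent stays within `1/2` of `deriv x s`, so its component in that direction is at least `1
- (1/2)²/2 = 7/8`. -/
lemma IsHolderCurve.le_inner (hx : IsHolderCurve H κ x) (hH : 0 ≤ H) (hκ : 0 < κ) {l : ℝ}
    (hl : H * l ^ κ ≤ 1 / 2) {s a b : ℝ} (ha : s - l ≤ a) (hab : a ≤ b) (hb : b ≤ s + l) :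
    7 / 8 * (b - a) ≤ inner ℝ (x b - x a) (deriv x s) := by
  have hder : ∀ u, HasDerivAt (fun u => inner ℝ (x u) (deriv x s))
      (inner ℝ (deriv x u) (deriv x s)) u := by
    intro u
    have := (hx.differentiable u).hasDerivAt.inner ℝ (hasDerivAt_const u (deriv x s))
    simpa using this
  have h := Convex.mul_sub_le_image_sub_of_le_deriv (convex_Icc (s - l) (s + l))
    (f := fun u => inner ℝ (x u) (deriv x s)) (C := 7 / 8)
    (fun u _ => (hder u).continuousAt.continuousWithinAt)
    (fun u _ => (hder u).differentiableAt.differentiableWithinAt) (fun u hu => by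
      rw [(hder u).deriv]
      have hu' := interior_subset hu
      have h1 := hx.holder u s
      have h2 : H * |u - s| ^ κ ≤ 1 / 2 := by
        refine le_trans ?_ hl
        have : |u - s| ≤ l := abs_le.mpr ⟨by linarith [hu'.1], by linarith [hu'.2]⟩
        gcongr
      have h3 := norm_sub_sq_real (deriv x u) (deriv x s)
      rw [hx.unit_speed, hx.unit_speed] at h3
      have h4 : ‖deriv x u - deriv x s‖ ^ 2 ≤ (1 / 2) ^ 2 :=
        pow_le_pow_left₀ (norm_nonneg _) (h1.trans h2) 2
      linarith) a ⟨ha, by linarith⟩ b ⟨by linarith, hb⟩ hab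
  rwa [inner_sub_left]

lemma IsHolderCurve.le_norm_sub (hx : IsHolderCurve H κ x) (hH : 0 ≤ H) (hκ : 0 < κ) {l : ℝ}
    (hl : H * l ^ κ ≤ 1 / 2) {s h : ℝ} (hh : |h| ≤ l) : 7 / 8 * |h| ≤ ‖x (s + h) - x s‖ := by
  have h1 := abs_real_inner_le_norm (x (s + h) - x s) (deriv x s)
  rw [hx.unit_speed, mul_one] at h1
  refine le_trans ?_ h1
  rcases le_total 0 h with h0 | h0
  · rw [abs_of_nonneg h0] at hh ⊢
    have := hx.le_inner hH hκ hl (s := s) (a := s) (b := s + h) (by linarith) (by linarith)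
      (by linarith)
    rw [add_sub_cancel_left] at this
    exact this.trans (le_abs_self _)
  · rw [abs_of_nonpos h0] at hh ⊢
    have := hx.le_inner hH hκ hl (s := s) (a := s + h) (b := s) (by linarith) (by linarith)
      (by linarith)
    rw [← neg_sub (x (s + h)) (x s), inner_neg_left] at this
    refine le_trans ?_ (neg_le_abs _)
    linarith

end Straight

/-! ### Local structure of the boundary at admissible pairs -/

section Local

variable {N : ℕ} {α T η H κ : ℝ} {θ : Fin N → ℝ} {Ω : Fin N → ℝ → Set Plane}
  {x : Fin N → ℝ → ℝ → Plane} {L : Fin N → ℝ → ℝ}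

/-- A small connected part of the boundary is contained in a short arc. -/
lemma IsPatchSolution.exists_param_of_isPreconnected (hsol : IsPatchSolution α T θ Ω x L) {t : ℝ}
    (ht : t ∈ Ico 0 T) {i : Fin N} (hx : IsHolderCurve H κ (x i t)) (hH : 0 ≤ H) (hκ : 0 < κ)
    {l : ℝ} (hl0 : 0 ≤ l) (hl : H * l ^ κ ≤ 1 / 2) {C : Set Plane} (hC : IsPreconnected C)
    (hCΓ : C ⊆ totalBoundary Ω t) {s : ℝ} (hs : x i t s ∈ C)
    (hCb : C ⊆ Metric.ball (x i t s) (7 / 8 * l)) {y : Plane} (hy : y ∈ C) :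
    ∃ h, |h| ≤ l ∧ y = x i t (s + h) := by
  have hpar := hsol.param i t ht
  -- `F₁` is the arc of half-length `l` about `s`, `F₂` the rest of the boundary. Both are closed
  -- and they share only the ends of the arc, which lie outside the ball containing `C`;
  -- connectedness puts `C` into `F₁`.
  set F₁ := x i t '' Icc (s - l) (s + l) with hF₁
  set F₂ := x i t '' Icc (s + l) (s - l + L i t) ∪ ⋃ j ∈ {j | j ≠ i}, frontier (Ω j t) with hF₂
  have hc₁ : IsClosed F₁ := (isCompact_Icc.image hpar.contDiff.continuous).isClosed
  have hc₂ : IsClosed F₂ := (isCompact_Icc.image hpar.contDiff.continuous).isClosed.union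
    ((toFinite _).isClosed_biUnion fun j _ => isClosed_frontier)
  have hcov : C ⊆ F₁ ∪ F₂ := by
    intro y hy
    obtain ⟨j, u, rfl⟩ := hsol.exists_param ht (hCΓ hy)
    rcases eq_or_ne j i with rfl | hne
    · set v := toIcoMod hpar.length_pos (s - l) u with hv
      have hvm : v ∈ Ico (s - l) (s - l + L j t) := toIcoMod_mem_Ico hpar.length_pos (s - l) u
      have hxv : x j t u = x j t v :=
        hpar.eq_iff.mpr ⟨toIcoDiv hpar.length_pos (s - l) u, by
          have := toIcoMod_add_toIcoDiv_zsmul hpar.length_pos (s - l) u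
          rw [zsmul_eq_mul] at this
          exact this.symm⟩
      rw [hxv]
      rcases le_total v (s + l) with h | h
      · exact Or.inl ⟨v, ⟨hvm.1, h⟩, rfl⟩
      · exact Or.inr (Or.inl ⟨v, ⟨h, hvm.2.le⟩, rfl⟩)
    · exact Or.inr (Or.inr (mem_biUnion (show j ∈ {j | j ≠ i} from hne)
        ((hsol.param j t ht).mem u)))
  have hdisj : C ∩ (F₁ ∩ F₂) = ∅ := by
    rw [eq_empty_iff_forall_notMem]
    rintro y ⟨hyC, ⟨a, ha, rfl⟩, hy2⟩
    have h1 : 7 / 8 * |a - s| < 7 / 8 * l := by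
      have h2 := hx.le_norm_sub hH hκ hl (s := s) (h := a - s)
        (abs_le.mpr ⟨by linarith [ha.1], by linarith [ha.2]⟩)
      rw [add_sub_cancel, ← dist_eq_norm] at h2
      exact h2.trans_lt (hCb hyC)
    obtain ⟨h3, h4⟩ := abs_lt.mp (lt_of_mul_lt_mul_left h1 (by norm_num))
    rcases hy2 with ⟨b, hb, hab⟩ | hy2
    · obtain ⟨m, hm⟩ := hpar.eq_iff.mp hab
      have hm0 : (0 : ℝ) < m := by
        by_contra! hcon
        nlinarith [hpar.length_pos, hb.1]
      have hm1 : (m : ℝ) < 1 := by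
        by_contra! hcon
        nlinarith [hpar.length_pos, hb.2]
      have e1 : 0 < m := by exact_mod_cast hm0
      have e2 : m < 1 := by exact_mod_cast hm1
      omega
    · obtain ⟨j, hj, hyj⟩ := mem_iUnion₂.mp hy2
      exact (hsol.disjoint t ht i j (Ne.symm hj)).ne_of_mem (hpar.mem a) hyj rfl
  have hsF : x i t s ∈ F₁ := ⟨s, ⟨by linarith, by linarith⟩, rfl⟩
  rcases isPreconnected_iff_subset_of_disjoint_closed.mp hC F₁ F₂ hc₁ hc₂ hcov hdisj with h | h
  · obtain ⟨a, ha, rfl⟩ := h hy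
    exact ⟨a - s, abs_le.mpr ⟨by linarith [ha.1], by linarith [ha.2]⟩, by rw [add_sub_cancel]⟩
  · exact absurd (show x i t s ∈ C ∩ (F₁ ∩ F₂) from ⟨hs, hsF, h hs⟩) (by rw [hdisj]; simp)

/-- If `p` and `q` are closer than `4r`, both balls lie in the larger one; otherwise they are
disjoint and connectedness confines `C` to the ball about `p`. -/
lemma subset_ball_of_isPreconnected {C : Set Plane} {p q : Plane} {r : ℝ} (hr : 0 < r)
    (hC : IsPreconnected C) (hp : p ∈ C) (h : C ⊆ Metric.ball p (2 * r) ∪ Metric.ball q (2 * r)) :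
    C ⊆ Metric.ball p (6 * r) := by
  rcases lt_or_ge (dist p q) (4 * r) with hd | hd
  · refine h.trans (union_subset (Metric.ball_subset_ball (by linarith)) ?_)
    refine Metric.ball_subset_ball' ?_
    rw [dist_comm]; linarith
  · have hdisj : Disjoint (Metric.ball p (2 * r)) (Metric.ball q (2 * r)) :=
      Metric.ball_disjoint_ball (by linarith)
    rcases hC.subset_or_subset Metric.isOpen_ball Metric.isOpen_ball hdisj h with h1 | h1
    · exact h1.trans (Metric.ball_subset_ball (by linarith))
    · have h2 : dist p q < 2 * r := h1 hp
      linarith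

lemma IsAdmissible.symm {Γ : Set Plane} {r : ℝ} {p q : Plane} (h : IsAdmissible Γ r p q) :
    IsAdmissible Γ r q p := by
  obtain ⟨C₁, C₂, h1, h2, h3, h4, h5, h6, h7⟩ := h
  refine ⟨C₂, C₁, h2, h1, h3.symm, by rw [union_comm, h4, union_comm], h6, h5, ?_⟩
  rw [edist_comm, h7, iInf₂_comm]
  simp_rw [edist_comm]

/-- Each of the two curves of the admissible pair lies in a `6r`-ball about its base point, and arcs
of half-length `8r` reach beyond it because `7/8 * 8r = 7r`. -/
lemma exists_param_of_isAdmissible (hsol : IsPatchSolution α T θ Ω x L) {t : ℝ}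
    (ht : t ∈ Ico 0 T) (hx : ∀ i, IsHolderCurve H κ (x i t)) (hH : 0 ≤ H) (hκ : 0 < κ)
    {r : ℝ} (hr : 0 < r) (hl : H * (8 * r) ^ κ ≤ 1 / 2) {i j : Fin N} {s u : ℝ}
    (hadm : IsAdmissible (totalBoundary Ω t) r (x i t s) (x j t u)) {y : Plane}
    (hy : y ∈ totalBoundary Ω t)
    (hyb : dist y (x i t s) < 2 * r ∨ dist y (x j t u) < 2 * r) :
    (∃ h, |h| ≤ 8 * r ∧ y = x i t (s + h)) ∨ ∃ h, |h| ≤ 8 * r ∧ y = x j t (u + h) := by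
  obtain ⟨C₁, C₂, h1, h2, -, h4, h5, h6, -⟩ := hadm
  have hsub₁ : C₁ ⊆ totalBoundary Ω t ∩ (Metric.ball (x i t s) (2 * r) ∪
    Metric.ball (x j t u) (2 * r)) := by rw [h4]; exact subset_union_left
  have hsub₂ : C₂ ⊆ totalBoundary Ω t ∩ (Metric.ball (x i t s) (2 * r) ∪
    Metric.ball (x j t u) (2 * r)) := by rw [h4]; exact subset_union_right
  have hb₁ := subset_ball_of_isPreconnected hr h1.isPreconnected h5 (hsub₁.trans inter_subset_right)
  have hb₂ := subset_ball_of_isPreconnected hr h2.isPreconnected h6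
    (q := x i t s) (by rw [union_comm]; exact hsub₂.trans inter_subset_right)
  have hmem : y ∈ C₁ ∪ C₂ := by rw [← h4]; exact ⟨hy, hyb⟩
  have hle : 6 * r ≤ 7 / 8 * (8 * r) := by linarith
  rcases hmem with hm | hm
  · exact Or.inl (hsol.exists_param_of_isPreconnected ht (hx i) hH hκ (by positivity) hl
      h1.isPreconnected (hsub₁.trans inter_subset_left) h5
      (hb₁.trans (Metric.ball_subset_ball hle)) hm)
  · exact Or.inr (hsol.exists_param_of_isPreconnected ht (hx j) hH hκ (by positivity) hl
      h2.isPreconnected (hsub₂.trans inter_subset_left) h6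
      (hb₂.trans (Metric.ball_subset_ball hle)) hm)

/-- Within distance `|p - q|` of `p` the second curve is not met, so only the arc through `p`
remains. -/
lemma exists_param_of_isAdmissible_left (hsol : IsPatchSolution α T θ Ω x L) {t : ℝ}
    (ht : t ∈ Ico 0 T) (hx : ∀ i, IsHolderCurve H κ (x i t)) (hH : 0 ≤ H) (hκ : 0 < κ)
    {r : ℝ} (hr : 0 < r) (hl : H * (8 * r) ^ κ ≤ 1 / 2) {i : Fin N} {s : ℝ} {q : Plane}
    (hadm : IsAdmissible (totalBoundary Ω t) r (x i t s) q) {y : Plane}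
    (hy : y ∈ totalBoundary Ω t) (hy1 : dist y (x i t s) < 2 * r)
    (hy2 : dist y (x i t s) < dist (x i t s) q) :
    ∃ h, |h| ≤ 8 * r ∧ y = x i t (s + h) := by
  obtain ⟨C₁, C₂, h1, -, -, h4, h5, h6, h7⟩ := hadm
  have hsub₁ : C₁ ⊆ totalBoundary Ω t ∩ (Metric.ball (x i t s) (2 * r) ∪
    Metric.ball q (2 * r)) := by rw [h4]; exact subset_union_left
  have hb₁ := subset_ball_of_isPreconnected hr h1.isPreconnected h5 (hsub₁.trans inter_subset_right)
  have hmem : y ∈ C₁ ∪ C₂ := by rw [← h4]; exact ⟨hy, Or.inl hy1⟩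
  have hle : 6 * r ≤ 7 / 8 * (8 * r) := by linarith
  rcases hmem with hm | hm
  · exact hsol.exists_param_of_isPreconnected ht (hx i) hH hκ (by positivity) hl
      h1.isPreconnected (hsub₁.trans inter_subset_left) h5
      (hb₁.trans (Metric.ball_subset_ball hle)) hm
  · have h8 : edist (x i t s) q ≤ edist (x i t s) y := by
      rw [h7]; exact iInf₂_le_of_le _ h5 (iInf₂_le y hm)
    rw [edist_dist, edist_dist, ENNReal.ofReal_le_ofReal_iff dist_nonneg, dist_comm _ y] at h8
    linarith

end Local

/-! ### First and second order conditions at minimizing pairs -/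

lemma inner_eq_zero_of_eventually_le {y : ℝ → Plane} {s : ℝ} {q v : Plane}
    (hy : HasDerivAt y v s) (hmin : ∀ᶠ u in 𝓝 s, ‖y s - q‖ ≤ ‖y u - q‖) :
    inner ℝ (y s - q) v = 0 := by
  have h1 : HasDerivAt (fun u => ‖y u - q‖ ^ 2) (2 * inner ℝ (y s - q) v) s :=
    (hy.sub_const q).norm_sq
  have h2 : IsLocalMin (fun u => ‖y u - q‖ ^ 2) s := by
    filter_upwards [hmin] with u hu
    gcongr
  have := h2.hasDerivAt_eq_zero h1
  linarith

/-- When both curves are run in direction `τ`, their difference is `d τ^⊥ + (h²/2) V + o(h²)` with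
`V` the difference of the second derivatives. Its squared length `d² + d h² ⟨V, τ^⊥⟩ + o(h²)` is
minimal at `h = 0`. -/
lemma inner_deriv_deriv_le {M γ d σ₁ σ₂ s u : ℝ} {y z : ℝ → Plane} (hy : IsHolderCurve₂ M γ y)
    (hz : IsHolderCurve₂ M γ z) (hM : 0 ≤ M) (hγ : 0 < γ) (hd : 0 < d) {τ : Plane} (hτ : ‖τ‖ = 1)
    (hσ₁ : σ₁ ^ 2 = 1) (hσ₂ : σ₂ ^ 2 = 1) (h₁ : deriv y s = σ₁ • τ) (h₂ : deriv z u = σ₂ • τ)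
    (hyz : y s - z u = d • perp τ)
    (hmin : ∀ᶠ h in 𝓝 (0 : ℝ), d ≤ ‖y (s + σ₁ * h) - z (u + σ₂ * h)‖) :
    inner ℝ (deriv (deriv z) u) (perp τ) ≤ inner ℝ (deriv (deriv y) s) (perp τ) := by
  set V := deriv (deriv y) s - deriv (deriv z) u with hV
  obtain ⟨D, hD⟩ : ∃ D : ℝ → Plane, ∀ h, D h = y (s + σ₁ * h) - z (u + σ₂ * h) - d • perp τ :=
    ⟨_, fun _ => rfl⟩
  have habs : ∀ σ : ℝ, σ ^ 2 = 1 → ∀ h, |σ * h| = |h| := by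
    intro σ hσ h
    have h3 : |σ| = 1 := by
      have := sq_abs σ
      rw [hσ] at this
      nlinarith [abs_nonneg σ]
    rw [abs_mul, h3, one_mul]
  have hDle : ∀ h, ‖D h - (h ^ 2 / 2) • V‖ ≤ 2 * (M * |h| ^ γ * |h| * |h|) := by
    intro h
    have t1 := hy.taylor hM hγ.le s (σ₁ * h)
    have t2 := hz.taylor hM hγ.le u (σ₂ * h)
    rw [habs σ₁ hσ₁, h₁, mul_pow, hσ₁, one_mul, smul_smul, mul_right_comm, ← sq, hσ₁,
      one_mul] at t1
    rw [habs σ₂ hσ₂, h₂, mul_pow, hσ₂, one_mul, smul_smul, mul_right_comm, ← sq, hσ₂,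
      one_mul] at t2
    have e : D h - (h ^ 2 / 2) • V =
        (y (s + σ₁ * h) - y s - h • τ - (h ^ 2 / 2) • deriv (deriv y) s) -
        (z (u + σ₂ * h) - z u - h • τ - (h ^ 2 / 2) • deriv (deriv z) u) := by
      rw [hD, hV, smul_sub, ← hyz]; abel
    rw [e]
    refine (norm_sub_le _ _).trans ?_
    linarith
  have hlim : Tendsto (fun h : ℝ => (h ^ 2)⁻¹ • D h) (𝓝[>] 0) (𝓝 ((1 / 2 : ℝ) • V)) := by
    rw [tendsto_iff_norm_sub_tendsto_zero]
    have hb : Tendsto (fun h : ℝ => 2 * (M * |h| ^ γ)) (𝓝[>] 0) (𝓝 0) := by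
      have : Continuous fun h : ℝ => 2 * (M * |h| ^ γ) :=
        continuous_const.mul (continuous_const.mul
          (continuous_abs.rpow_const fun _ => Or.inr hγ.le))
      simpa [Real.zero_rpow hγ.ne'] using (this.tendsto 0).mono_left nhdsWithin_le_nhds
    refine tendsto_of_tendsto_of_tendsto_of_le_of_le' tendsto_const_nhds hb
      (Eventually.of_forall fun h => norm_nonneg _) ?_
    filter_upwards [self_mem_nhdsWithin] with h hh
    rw [mem_Ioi] at hh
    have e : (h ^ 2)⁻¹ • D h - (1 / 2 : ℝ) • V = (h ^ 2)⁻¹ • (D h - (h ^ 2 / 2) • V) := by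
      rw [smul_sub (h ^ 2)⁻¹ (D h), smul_smul, show (h ^ 2)⁻¹ * (h ^ 2 / 2) = 1 / 2 by field_simp]
    rw [e, norm_smul, norm_inv, Real.norm_of_nonneg (by positivity), inv_mul_le_iff₀ (by positivity)]
    refine (hDle h).trans (le_of_eq ?_)
    rw [abs_of_pos hh]; ring
  have hlim2 : Tendsto (fun h : ℝ => 2 * d * inner ℝ ((h ^ 2)⁻¹ • D h) (perp τ)
      + h ^ 2 * ‖(h ^ 2)⁻¹ • D h‖ ^ 2) (𝓝[>] 0)
      (𝓝 (2 * d * inner ℝ ((1 / 2 : ℝ) • V) (perp τ) + 0 ^ 2 * ‖(1 / 2 : ℝ) • V‖ ^ 2)) := by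
    have h0 : Tendsto (fun h : ℝ => h) (𝓝[>] 0) (𝓝 0) := nhdsWithin_le_nhds
    exact ((hlim.inner (𝕜 := ℝ) tendsto_const_nhds).const_mul _).add ((h0.pow 2).mul (hlim.norm.pow 2))
  have hnn := ge_of_tendsto hlim2 (b := 0) (by
    filter_upwards [self_mem_nhdsWithin, nhdsWithin_le_nhds hmin] with h hh hm
    rw [mem_Ioi] at hh
    have e : y (s + σ₁ * h) - z (u + σ₂ * h) = d • perp τ + D h := by rw [hD]; abel
    rw [e] at hm
    have h3 : d ^ 2 ≤ ‖d • perp τ + D h‖ ^ 2 := pow_le_pow_left₀ hd.le hm 2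
    rw [norm_add_sq_real, norm_smul, norm_perp, hτ, mul_one, Real.norm_of_nonneg hd.le,
      real_inner_smul_left, real_inner_comm] at h3
    rw [real_inner_smul_left, norm_smul, norm_inv, Real.norm_of_nonneg (sq_nonneg h)]
    have h4 : 0 ≤ (h ^ 2)⁻¹ * (2 * (d * inner ℝ (D h) (perp τ)) + ‖D h‖ ^ 2) :=
      mul_nonneg (by positivity) (by linarith)
    refine h4.trans (le_of_eq ?_)
    field_simp)
  rw [real_inner_smul_left, hV, inner_sub_left] at hnn
  have : 0 ≤ d * (inner ℝ (deriv (deriv y) s) (perp τ) - inner ℝ (deriv (deriv z) u) (perp τ)) := by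
    linarith
  have := nonneg_of_mul_nonneg_right this hd
  linarith

/-! ### Boundary curves at the natural length scale -/

lemma NearParabola.mono {y : ℝ → Plane} {s c A A' β l l' : ℝ} {τ : Plane}
    (h : NearParabola y s τ c A β l) (hA : A ≤ A') (hl : l' ≤ l) : NearParabola y s τ c A' β l' :=
  fun u hu => (h u (hu.trans hl)).trans (by gcongr)

lemma FlatAt.neg {Γ : Set Plane} {z τ : Plane} {r A κ : ℝ} (h : FlatAt Γ z τ r A κ) :
    FlatAt Γ z (-τ) r A κ := by
  intro y hy h1 h2
  rw [inner_neg_right, abs_neg] at h1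
  rw [perp_neg, inner_neg_right, abs_neg] at h2
  rw [perp_neg, inner_neg_right, inner_neg_right, abs_neg, abs_neg]
  exact h y hy h1 h2

lemma le_tangentExp {k : ℕ} {γ : ℝ} : tangentExp k γ ≤ k + γ - 1 := min_le_left _ _

/-- Half the signed curvature, which is well defined when the curve is `C²`. -/
def curvCoeff (k : ℕ) (y : ℝ → Plane) (s : ℝ) (τ : Plane) : ℝ :=
  if k = 2 then inner ℝ (deriv (deriv y) s) (perp τ) / 2 else 0

section Scale

variable {N : ℕ} {k : ℕ} {γ α T : ℝ} {θ : Fin N → ℝ} {Ω : Fin N → ℝ → Set Plane}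
  {x : Fin N → ℝ → ℝ → Plane} {L : Fin N → ℝ → ℝ} {t R : ℝ}

lemma IsHolderPatchSolution.isHolderCurve₂ (hsol : IsHolderPatchSolution 2 γ α T θ Ω x L)
    (hγ : 0 < γ) {M : ℝ} (ht : t ∈ Ico 0 T) (hM0 : 0 ≤ M)
    (hM : boundaryNorm 2 γ x t ≤ ENNReal.ofReal M) (i : Fin N) : IsHolderCurve₂ M γ (x i t) where
  differentiable := (hsol.param i t ht).differentiable
  differentiable_deriv := by
    have h3 : ContDiff ℝ (1 + 1) (x i t) := by
      convert hsol.contDiff_param i t ht using 1; norm_num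
    exact (contDiff_succ_iff_deriv.mp h3).2.2.differentiable one_ne_zero
  unit_speed := (hsol.param i t ht).unit_speed
  holder s r := by
    have h := norm_iteratedDeriv_sub_le_of_boundaryNorm_le hM hM0 hγ i s r
    simpa only [iteratedDeriv_succ, iteratedDeriv_zero] using h

lemma exponent_two (γ : ℝ) : ((2 : ℕ) : ℝ) + γ - 1 = 1 + γ := by push_cast; ring

lemma exponent_one (γ : ℝ) : ((1 : ℕ) : ℝ) + γ - 1 = γ := by push_cast; ring

lemma rpow_neg_mul_self (hR : 0 < R) : R ^ (-(1 + γ)) * R ^ γ * R ≤ 1 := by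
  rw [mul_assoc, ← Real.rpow_add_one hR.ne', ← Real.rpow_add hR,
    show -(1 + γ) + (γ + 1) = 0 by ring, Real.rpow_zero]

/-- Common form of the tangent bound at length scale `R`: for `k = 1` it is the Hölder bound itself,
for `k = 2` the curvature bound `2 / R`. -/
lemma IsHolderPatchSolution.isHolderCurve_scale (hsol : IsHolderPatchSolution k γ α T θ Ω x L)
    (hk : k = 1 ∨ k = 2) (hγ : 0 < γ) (hγ₁ : γ ≤ 1) (ht : t ∈ Ico 0 T) (hR : 0 < R)
    (hM : boundaryNorm k γ x t ≤ ENNReal.ofReal (R ^ (-((k : ℝ) + γ - 1)))) (i : Fin N) :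
    IsHolderCurve (2 * R ^ (-tangentExp k γ)) (tangentExp k γ) (x i t) := by
  rcases hk with rfl | rfl
  · have h := hsol.isHolderCurve (Or.inl rfl) hγ hγ₁ ht (by positivity) hM i
    refine ⟨h.differentiable, h.unit_speed, fun s r => (h.holder s r).trans ?_⟩
    rw [exponent_one, tangentExp_one hγ₁]
    have : 0 ≤ R ^ (-γ) := by positivity
    gcongr
    linarith
  · rw [exponent_two] at hM
    have h := (hsol.isHolderCurve₂ hγ ht (by positivity) hM i).isHolderCurve (by positivity) hγ.le
      hR (rpow_neg_mul_self hR)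
    rw [tangentExp_two hγ, Real.rpow_neg_one]
    exact h

lemma IsHolderPatchSolution.nearParabola (hsol : IsHolderPatchSolution k γ α T θ Ω x L)
    (hk : k = 1 ∨ k = 2) (hγ : 0 < γ) (hγ₁ : γ ≤ 1) (ht : t ∈ Ico 0 T) (hR : 0 < R)
    (hM : boundaryNorm k γ x t ≤ ENNReal.ofReal (R ^ (-((k : ℝ) + γ - 1)))) {h₀ : ℝ}
    (hh₀ : 0 < h₀) (hh₁ : h₀ ≤ 1 / 16) (hh₂ : h₀ ^ tangentExp k γ ≤ 1 / 16) {i : Fin N} {s : ℝ}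
    {τ : Plane} (hτ : deriv (x i t) s = τ ∨ deriv (x i t) s = -τ) :
    NearParabola (x i t) s τ (curvCoeff k (x i t) s τ) (16 * R ^ (-((k : ℝ) + γ - 1)))
      ((k : ℝ) + γ - 1) (h₀ * R) := by
  rcases hk with rfl | rfl
  · have h := hsol.isHolderCurve (Or.inl rfl) hγ hγ₁ ht (by positivity) hM i
    rw [tangentExp_one hγ₁] at h hh₂
    rw [exponent_one] at *
    have h2 : R ^ (-γ) * (h₀ * R) ^ γ ≤ 1 / 8 := by
      rw [Real.mul_rpow hh₀.le hR.le, Real.rpow_neg hR.le]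
      have : 0 < R ^ γ := by positivity
      rw [show (R ^ γ)⁻¹ * (h₀ ^ γ * R ^ γ) = h₀ ^ γ by field_simp]
      linarith
    have h3 := h.nearParabola (by positivity) hγ hγ₁ h2 hτ
    have : 0 ≤ R ^ (-γ) := by positivity
    exact h3.mono (by linarith) le_rfl
  · rw [exponent_two] at *
    have h := hsol.isHolderCurve₂ hγ ht (by positivity) hM i
    exact h.nearParabola hγ hγ₁ hR rfl (by nlinarith) hτ

lemma IsHolderPatchSolution.abs_curvCoeff_le (hsol : IsHolderPatchSolution k γ α T θ Ω x L)
    (hγ : 0 < γ) (ht : t ∈ Ico 0 T) (hR : 0 < R)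
    (hM : boundaryNorm k γ x t ≤ ENNReal.ofReal (R ^ (-((k : ℝ) + γ - 1)))) (i : Fin N) (s : ℝ)
    {τ : Plane} (hτ : ‖τ‖ = 1) : |curvCoeff k (x i t) s τ| * R ≤ 1 := by
  unfold curvCoeff
  split_ifs with h2
  · subst h2
    rw [exponent_two] at hM
    have h := (hsol.isHolderCurve₂ hγ ht (by positivity) hM i).norm_deriv_deriv_le (by positivity)
      hγ.le hR (rpow_neg_mul_self hR) s
    have h1 := abs_real_inner_le_norm (deriv (deriv (x i t)) s) (perp τ)
    rw [norm_perp, hτ, mul_one] at h1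
    have h3 := h1.trans h
    rw [le_div_iff₀ hR] at h3
    rw [abs_div, abs_two]
    linarith
  · simp

lemma IsPatchSolution.exists_norm_le (hsol : IsPatchSolution α T θ Ω x L) (ht : t ∈ Ico 0 T) :
    ∃ B, 0 ≤ B ∧ ∀ i s, ‖x i t s‖ ≤ B := by
  have hb : Bornology.IsBounded (totalBoundary Ω t) := by
    unfold totalBoundary
    refine (Bornology.isBounded_iUnion).mpr fun i => ?_
    exact (hsol.isBounded i t ht).closure.subset frontier_subset_closure
  obtain ⟨B, hB⟩ := hb.exists_norm_le
  exact ⟨max B 0, le_max_right _ _, fun i s =>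
    (hB _ (hsol.mem_totalBoundary ht i s)).trans (le_max_left _ _)⟩

end Scale

/-! ### The relative velocity of minimizing pairs -/

section Pair

variable {N : ℕ} {k : ℕ} {γ α T ρ : ℝ} {θ : Fin N → ℝ} {Ω : Fin N → ℝ → Set Plane}
  {x : Fin N → ℝ → ℝ → Plane} {L : Fin N → ℝ → ℝ} {t R r : ℝ}

/-- At an admissible pair both tangents are orthogonal to the segment joining the points. -/
lemma inner_deriv_eq_zero_of_isAdmissible (hsol : IsPatchSolution α T θ Ω x L) (ht : t ∈ Ico 0 T)
    {i : Fin N} {s : ℝ} {q : Plane} (hr : 0 < r) (hq : q ∈ totalBoundary Ω t)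
    (hne : x i t s ≠ q) (hadm : IsAdmissible (totalBoundary Ω t) r (x i t s) q) :
    inner ℝ (x i t s - q) (deriv (x i t) s) = 0 := by
  have hpos : 0 < min (dist (x i t s) q) (2 * r) := lt_min (dist_pos.mpr hne) (by linarith)
  have hpar := hsol.param i t ht
  refine inner_eq_zero_of_eventually_le (hpar.differentiable s).hasDerivAt ?_
  filter_upwards [(hpar.contDiff.continuous.tendsto s).eventually (Metric.ball_mem_nhds _ hpos)]
    with u hu
  have h := hadm.le_edist (hsol.mem_totalBoundary ht i u) hq hu (by rwa [dist_self])
  rwa [edist_dist, edist_dist, ENNReal.ofReal_le_ofReal_iff dist_nonneg, dist_eq_norm,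
    dist_eq_norm] at h

/-- The second order condition at the minimum; this ordering of the curvatures keeps the gap between
the two parabolas open. For `k = 1` both coefficients are zero. -/
lemma curvCoeff_le_of_isAdmissible (hsol : IsHolderPatchSolution k γ α T θ Ω x L)
    (hγ : 0 < γ) (ht : t ∈ Ico 0 T) (hR : 0 < R)
    (hM : boundaryNorm k γ x t ≤ ENNReal.ofReal (R ^ (-((k : ℝ) + γ - 1))))
    {i j : Fin N} {s u d : ℝ} {τ : Plane} (hτ : ‖τ‖ = 1) (hr : 0 < r) (hd : 0 < d)
    (hpq : x i t s - x j t u = d • perp τ)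
    (h₁ : deriv (x i t) s = τ ∨ deriv (x i t) s = -τ)
    (h₂ : deriv (x j t) u = τ ∨ deriv (x j t) u = -τ)
    (hadm : IsAdmissible (totalBoundary Ω t) r (x i t s) (x j t u)) :
    curvCoeff k (x j t) u τ ≤ curvCoeff k (x i t) s τ := by
  unfold curvCoeff
  split_ifs with h2
  swap
  · exact le_rfl
  subst h2
  have hsig : ∀ v : Plane, v = τ ∨ v = -τ → ∃ σ : ℝ, σ ^ 2 = 1 ∧ v = σ • τ := by
    rintro v (rfl | rfl)
    · exact ⟨1, by norm_num, by simp⟩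
    · exact ⟨-1, by norm_num, by simp⟩
  obtain ⟨σ₁, hσ₁, e₁⟩ := hsig _ h₁
  obtain ⟨σ₂, hσ₂, e₂⟩ := hsig _ h₂
  have hc := fun i => hsol.isHolderCurve₂ hγ ht (by positivity) hM i
  have hdist : dist (x i t s) (x j t u) = d := by
    rw [dist_eq_norm, hpq, norm_smul, norm_perp, hτ, mul_one, Real.norm_of_nonneg hd.le]
  have hpos : 0 < min (dist (x i t s) (x j t u)) (2 * r) := by
    rw [hdist]; exact lt_min hd (by linarith)
  have hnear : ∀ (i' : Fin N) (s' σ : ℝ), ∀ᶠ h in 𝓝 (0 : ℝ),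
      dist (x i' t (s' + σ * h)) (x i' t s') < min (dist (x i t s) (x j t u)) (2 * r) := by
    intro i' s' σ
    have hcont : Continuous fun h : ℝ => x i' t (s' + σ * h) :=
      (hsol.param i' t ht).contDiff.continuous.comp (by fun_prop)
    have := hcont.tendsto 0
    rw [mul_zero, add_zero] at this
    exact this.eventually (Metric.ball_mem_nhds _ hpos)
  have h := inner_deriv_deriv_le (hc i) (hc j) (by positivity) hγ hd hτ hσ₁ hσ₂ e₁ e₂ hpq (by
    filter_upwards [hnear i s σ₁, hnear j u σ₂] with h hi hj
    have h3 := hadm.le_edist (hsol.mem_totalBoundary ht i _) (hsol.mem_totalBoundary ht j _) hi hj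
    rw [edist_dist, edist_dist, ENNReal.ofReal_le_ofReal_iff dist_nonneg, hdist, dist_eq_norm] at h3
    exact h3)
  linarith

/-- Near an admissible pair of close points the boundary lies in two thin regions. -/
lemma mem_strips_of_isAdmissible (hp : IsPatchSolution α T θ Ω x L) (ht : t ∈ Ico 0 T) {H κ : ℝ}
    (hcur : ∀ i, IsHolderCurve H κ (x i t)) (hH : 0 ≤ H) (hκ : 0 < κ) (hr : 0 < r)
    (hr8 : H * (8 * r) ^ κ ≤ 1 / 2) {i j : Fin N} {s u d c c' A β l b : ℝ} {τ : Plane}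
    (hτ : ‖τ‖ = 1) (hd : 0 < d) (hpq : x i t s = x j t u + d • perp τ)
    (hni : NearParabola (x i t) s τ c' A β l) (hnj : NearParabola (x j t) u τ c A β l)
    (hadm : IsAdmissible (totalBoundary Ω t) r (x i t s) (x j t u)) (hdb : 2 * d ≤ b)
    (hbl : 6 * b ≤ l) (hbr : 3 * b ≤ r) {w : ℝ × ℝ} (hw1 : |w.1| ≤ b) (hw2 : |w.2| ≤ 2 * b)
    (hmem : framePoint (x j t u) τ w ∈ totalBoundary Ω t) :
    |w.2 - c * w.1 ^ 2| ≤ A * |w.1| ^ (1 + β) ∨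
      |w.2 - (d + c' * w.1 ^ 2)| ≤ A * |w.1| ^ (1 + β) := by
  obtain ⟨f1, f2⟩ := inner_framePoint_sub (z := x j t u) hτ w
  have hnorm : ‖framePoint (x j t u) τ w - x j t u‖ ≤ 2 * (2 * b) :=
    norm_le_two_mul_of_frame hτ (by rw [f1]; linarith) (by rw [f2]; exact hw2)
  rcases exists_param_of_isAdmissible hp ht hcur hH hκ hr hr8 hadm hmem
    (Or.inr (by rw [dist_eq_norm]; linarith)) with ⟨h, hh, hy⟩ | ⟨h, hh, hy⟩
  · right
    have g1 : x i t (s + h) - x i t s =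
        (framePoint (x j t u) τ w - x j t u) - d • perp τ := by rw [← hy, hpq]; abel
    have g2 : inner ℝ (x i t (s + h) - x i t s) τ = w.1 := by
      rw [g1, inner_sub_left (framePoint (x j t u) τ w - x j t u), f1, real_inner_smul_left,
        inner_perp_self_left, mul_zero, sub_zero]
    have g3 : inner ℝ (x i t (s + h) - x i t s) (perp τ) = w.2 - d := by
      rw [g1, inner_sub_left (framePoint (x j t u) τ w - x j t u), f2, real_inner_smul_left,
        inner_perp_perp, real_inner_self_eq_norm_sq, hτ]
      ring
    have hle := (hcur i).le_norm_sub hH hκ hr8 (s := s) hh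
    have hn2 : ‖x i t (s + h) - x i t s‖ ≤ 2 * (2 * b) + d := by
      rw [g1]
      refine (norm_sub_le _ _).trans (add_le_add hnorm (le_of_eq ?_))
      rw [norm_smul, norm_perp, hτ, mul_one, Real.norm_of_nonneg hd.le]
    have h3 := hni h (by linarith)
    rw [g2, g3] at h3
    rwa [← sub_sub]
  · left
    have hle := (hcur j).le_norm_sub hH hκ hr8 (s := u) hh
    rw [← hy] at hle
    have h3 := hnj h (by linarith)
    rw [← hy, f1, f2] at h3
    exact h3

/-- The boundary is flat at each point of an admissible pair, at scales below their distance. -/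
lemma flatAt_of_isAdmissible (hp : IsPatchSolution α T θ Ω x L) (ht : t ∈ Ico 0 T) {H κ : ℝ}
    (hcur : ∀ i, IsHolderCurve H κ (x i t)) (hH : 0 ≤ H) (hκ : 0 < κ) (hr : 0 < r)
    (hr8 : H * (8 * r) ^ κ ≤ 1 / 2) {i : Fin N} {s A l b : ℝ} {q τ : Plane}
    (hτ : ‖τ‖ = 1) (hni : NearParabola (x i t) s τ 0 A κ l)
    (hadm : IsAdmissible (totalBoundary Ω t) r (x i t s) q)
    (hbd : 2 * b < dist (x i t s) q) (hbr : 2 * b < 2 * r) (hbl : 4 * b ≤ l) :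
    FlatAt (totalBoundary Ω t) (x i t s) τ b A κ := by
  intro y hy a1 a2
  have hnorm := norm_le_two_mul_of_frame hτ a1 a2
  have hb : 0 ≤ b := (abs_nonneg _).trans a1
  obtain ⟨h, hh, hyh⟩ := exists_param_of_isAdmissible_left hp ht hcur hH hκ hr hr8 hadm hy
    (by rw [dist_eq_norm]; linarith) (by rw [dist_eq_norm y]; linarith)
  have hle := (hcur i).le_norm_sub hH hκ hr8 (s := s) hh
  rw [← hyh] at hle
  have h3 := hni h (by linarith)
  rwa [← hyh, zero_mul, sub_zero] at h3

/-- The velocity estimate at length scale `R`. If `2d ≤ bR`, the boundary near the pair is a pair of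
almost parallel arcs and cancellation between the kernels is used; otherwise each point sees a flat
boundary up to scale `bR/4`, and `d` itself is comparable to or larger than `R`. -/
lemma exists_abs_vel_sub_le (hk : k = 1 ∨ k = 2) (hα : 0 < α) (hγ : 0 < γ) (hγ₁ : γ ≤ 1)
    (hβ : 2 * α ≤ (k : ℝ) + γ - 1) (hβ' : (k : ℝ) + γ - 1 < 1 + 2 * α)
    (hκα : 2 * α - 1 < tangentExp k γ) {Θ r₀ : ℝ} (hr₀ : 0 < r₀) :
    ∃ C : ℝ, ∀ {N : ℕ} {T : ℝ} {θ : Fin N → ℝ} {Ω : Fin N → ℝ → Set Plane}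
      {x : Fin N → ℝ → ℝ → Plane} {L : Fin N → ℝ → ℝ} {t R r : ℝ},
      IsHolderPatchSolution k γ α T θ Ω x L → t ∈ Ico 0 T → ∑ i, |θ i| = Θ → 0 < R →
      boundaryNorm k γ x t ≤ ENNReal.ofReal (R ^ (-((k : ℝ) + γ - 1))) → r₀ * R ≤ r →
      2 * R ^ (-tangentExp k γ) * (8 * r) ^ tangentExp k γ ≤ 1 / 2 →
      ∀ {i j : Fin N} {s u : ℝ} {τ : Plane} {d : ℝ}, ‖τ‖ = 1 → 0 < d →
      x i t s = x j t u + d • perp τ →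
      (deriv (x i t) s = τ ∨ deriv (x i t) s = -τ) →
      (deriv (x j t) u = τ ∨ deriv (x j t) u = -τ) →
      IsAdmissible (totalBoundary Ω t) r (x i t s) (x j t u) →
      Integrable (fun p : ℝ × ℝ => p.1 * kern α p * oddPart (vorticity θ Ω t) (x i t s) τ p) →
      Integrable (fun p : ℝ × ℝ => p.1 * kern α p * oddPart (vorticity θ Ω t) (x j t u) τ p) →
      |vel α (vorticity θ Ω t) (x i t s) τ - vel α (vorticity θ Ω t) (x j t u) τ| ≤
        C * (R ^ (-(2 * α)) * d) := by
  have hk1 : 1 ≤ k := by omega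
  have hκ : 0 < tangentExp k γ := tangentExp_pos hk1 hγ
  have hκ₁ : tangentExp k γ ≤ 1 := min_le_right _ _
  have hκβ : tangentExp k γ ≤ (k : ℝ) + γ - 1 := le_tangentExp
  obtain ⟨h₁, hh₁, hh₁'⟩ := exists_pos_mul_rpow_le (H := 1) hκ (show (0 : ℝ) < 1 / 16 by norm_num)
  obtain ⟨b₁, hb₁, hb₁'⟩ := exists_pos_mul_rpow_le (H := 16) (hκ.trans_le hκβ)
    (show (0 : ℝ) < 1 / 8 by norm_num)
  set κ := tangentExp k γ with hκdef
  set β := (k : ℝ) + γ - 1 with hβdef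
  set h₀ := min h₁ (1 / 16) with hh₀def
  have hh₀ : 0 < h₀ := lt_min hh₁ (by norm_num)
  have hh₀1 : h₀ ≤ 1 / 16 := min_le_right _ _
  have hh₀2 : h₀ ^ κ ≤ 1 / 16 := by
    refine le_trans ?_ hh₁'
    rw [one_mul]
    exact Real.rpow_le_rpow hh₀.le (min_le_left _ _) hκ.le
  -- A fixed fraction of `R` chosen so that the arcs met are nearly parabolic (`h₀`), lie in the
  -- balls of the admissible pair (`r₀`), have small curvature term (`1/8`) and small strip height
  -- (`b₁`).
  set b := min (min (h₀ / 6) (r₀ / 3)) (min (1 / 8) b₁) with hbdef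
  have hb : 0 < b := lt_min (lt_min (by positivity) (by positivity)) (lt_min (by norm_num) hb₁)
  have hbh : b ≤ h₀ / 6 := (min_le_left _ _).trans (min_le_left _ _)
  have hbr : b ≤ r₀ / 3 := (min_le_left _ _).trans (min_le_right _ _)
  have hb8 : b ≤ 1 / 8 := (min_le_right _ _).trans (min_le_left _ _)
  have hbb : 16 * b ^ β ≤ 1 / 8 := by
    refine le_trans ?_ hb₁'
    have : b ≤ b₁ := (min_le_right _ _).trans (min_le_right _ _)
    have := hκ.trans_le hκβ
    gcongr
  refine ⟨max (Θ * (2 * nearConst α β κ 16 b 1 + farConst α * (8 * (b ^ (-(2 * α)) / (2 * α)))))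
    (Θ * (16 * 4 * ((b / 4) ^ (1 + κ - 2 * α) / (1 + κ - 2 * α)) / (b / 4) +
        (6 + farConst α) * (8 * ((b / 4) ^ (-(2 * α)) / (2 * α))))), ?_⟩
  intro N T θ Ω x L t R r hsol ht hΘ hR hM hrR hr8 i j s u τ d hτ hd hpq h₁ h₂ hadm hip hiq
  have hp := hsol.toIsPatchSolution
  obtain ⟨B, hB0, hB⟩ := hp.exists_norm_le ht
  have hω := hp.isPatchFunction ht hB0 hB
  rw [hΘ] at hω
  have hcur := fun i => hsol.isHolderCurve_scale hk hγ hγ₁ ht hR hM i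
  have hH0 : 0 ≤ 2 * R ^ (-κ) := by positivity
  have hr : 0 < r := (by positivity : 0 < r₀ * R).trans_le hrR
  have hbR : b * R ≤ r / 3 := by nlinarith
  have hsub : x i t s - x j t u = d • perp τ := by rw [hpq]; abel
  have hdist : dist (x i t s) (x j t u) = d := by
    rw [dist_eq_norm, hsub, norm_smul, norm_perp, hτ, mul_one, Real.norm_of_nonneg hd.le]
  have hRd : 0 ≤ R ^ (-(2 * α)) * d := by positivity
  rcases le_or_gt (2 * d) (b * R) with hdb | hdb
  · refine le_trans ?_ (mul_le_mul_of_nonneg_right (le_max_left _ _) hRd)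
    have hcc := curvCoeff_le_of_isAdmissible hsol hγ ht hR hM hτ hr hd hsub h₁ h₂ hadm
    have hci := hsol.abs_curvCoeff_le hγ ht hR hM i s hτ
    have hcj := hsol.abs_curvCoeff_le hγ ht hR hM j u hτ
    have hni := hsol.nearParabola hk hγ hγ₁ ht hR hM hh₀ hh₀1 hh₀2 h₁
    have hnj := hsol.nearParabola hk hγ hγ₁ ht hR hM hh₀ hh₀1 hh₀2 h₂
    rw [hpq] at hip ⊢
    refine abs_vel_sub_le_of_close hω hα hβ hβ' hκ hκβ (by norm_num) hb (by linarith) zero_le_one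
      hR hd hdb hbb (by linarith) hcj hci hcc ?_ hip hiq ?_
    · rcases hk with rfl | rfl
      · exact Or.inl ⟨by simp [curvCoeff], by simp [curvCoeff]⟩
      · exact Or.inr ⟨by rw [hβdef, exponent_two]; linarith, tangentExp_two hγ⟩
    · exact fun w hw1 hw2 hmem => mem_strips_of_isAdmissible hp ht hcur hH0 hκ hr hr8 hτ hd hpq hni
        hnj hadm hdb (by nlinarith) (by linarith) hw1 hw2 hmem
  · refine le_trans ?_ (mul_le_mul_of_nonneg_right (le_max_right _ _) hRd)
    have hpw : 2 * R ^ (-κ) * (h₀ * R) ^ κ ≤ 1 / 8 := by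
      rw [Real.mul_rpow hh₀.le hR.le, Real.rpow_neg hR.le]
      have : 0 < R ^ κ := by positivity
      rw [show 2 * (R ^ κ)⁻¹ * (h₀ ^ κ * R ^ κ) = 2 * h₀ ^ κ by field_simp]
      linarith
    have hA4 : 2 * (2 * R ^ (-κ)) = 4 * R ^ (-κ) := by ring
    have hni := (hcur i).nearParabola hH0 hκ hκ₁ hpw h₁
    have hnj := (hcur j).nearParabola hH0 hκ hκ₁ hpw h₂
    rw [hA4] at hni hnj
    have hbl : 4 * (b / 4 * R) ≤ h₀ * R := by nlinarith
    have hfp := flatAt_of_isAdmissible hp ht hcur hH0 hκ hr hr8 hτ hni hadm (b := b / 4 * R)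
      (by rw [hdist]; linarith) (by linarith) hbl
    have hfq := flatAt_of_isAdmissible hp ht hcur hH0 hκ hr hr8 hτ hnj hadm.symm (b := b / 4 * R)
      (by rw [dist_comm, hdist]; linarith) (by linarith) hbl
    rw [hpq] at hip hfp ⊢
    exact abs_vel_sub_le_of_far hω hα hτ hκα hκ (by norm_num) (by positivity) hR hd
      (by linarith) hip hiq hfp hfq

end Pair

section Rate

variable {N : ℕ} {k : ℕ} {γ α T ρ : ℝ} {θ : Fin N → ℝ} {Ω : Fin N → ℝ → Set Plane}
  {x : Fin N → ℝ → ℝ → Plane} {L : Fin N → ℝ → ℝ} {t R r : ℝ}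

/-- This accounts for the 100 in `localRadius`: it makes the tangent change by at most `1/2` along
arcs of half-length `8r`. The left side is at most `2/100` for `k = 1` and at most `2/10` for `k =
2`. -/
lemma two_mul_rpow_hundred_le (hk : k = 1 ∨ k = 2) (hγ : 0 < γ) (hγ₁ : γ ≤ 1) :
    (2 * (100 : ℝ) ^ (-(1 / ((k : ℝ) + γ - 1)))) ^ tangentExp k γ ≤ 1 / 4 := by
  rcases hk with rfl | rfl
  · rw [exponent_one, tangentExp_one hγ₁, Real.mul_rpow (by norm_num) (by positivity),
      ← Real.rpow_mul (by norm_num)]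
    rw [show -(1 / γ) * γ = -1 by field_simp, Real.rpow_neg_one]
    have : (2 : ℝ) ^ γ ≤ 2 ^ (1 : ℝ) := Real.rpow_le_rpow_of_exponent_le (by norm_num) hγ₁
    rw [Real.rpow_one] at this
    linarith
  · rw [exponent_two, tangentExp_two hγ, Real.rpow_one]
    have h1 : (100 : ℝ) ^ (-(1 / (1 + γ))) ≤ 100 ^ (-(1 / 2 : ℝ)) := by
      refine Real.rpow_le_rpow_of_exponent_le (by norm_num) (neg_le_neg ?_)
      exact one_div_le_one_div_of_le (by linarith) (by linarith)
    have h2 : (100 : ℝ) ^ (-(1 / 2 : ℝ)) = 1 / 10 := by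
      rw [show (100 : ℝ) = 10 ^ (2 : ℝ) by norm_num, ← Real.rpow_mul (by norm_num)]
      norm_num
    linarith

/-- The relative normal velocity of an admissible pair in the direction of the segment joining the
two points is controlled by their distance. -/
lemma exists_abs_inner_normalVelocity_le (hk : k = 1 ∨ k = 2) (hα : 0 < α) (hγ : 0 < γ)
    (hγ₁ : γ ≤ 1) (hβ : 2 * α ≤ (k : ℝ) + γ - 1) (hβ' : (k : ℝ) + γ - 1 < 1 + 2 * α)
    (hκα : 2 * α - 1 < tangentExp k γ) (hρ : 0 < ρ) (Θ : ℝ) :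
    ∃ C : ℝ, 0 < C ∧ ∀ {N : ℕ} {T : ℝ} {θ : Fin N → ℝ} {Ω : Fin N → ℝ → Set Plane}
      {x : Fin N → ℝ → ℝ → Plane} {L : Fin N → ℝ → ℝ} {t r₁ A₁ : ℝ},
      IsHolderPatchSolution k γ α T θ Ω x L → t ∈ Ico 0 T → ∑ i, |θ i| = Θ → 0 < r₁ → 0 ≤ A₁ →
      (∀ i s, FlatAt (totalBoundary Ω t) (x i t s) (deriv (x i t) s) r₁ A₁ (tangentExp k γ)) →
      ∀ {i j : Fin N} {s u : ℝ}, x i t s ≠ x j t u →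
      IsAdmissible (totalBoundary Ω t) (localRadius k γ ρ x t) (x i t s) (x j t u) →
      |inner ℝ (‖x i t s - x j t u‖⁻¹ • (x i t s - x j t u))
        (normalVelocity α (vorticity θ Ω t) (x i t) s
          - normalVelocity α (vorticity θ Ω t) (x j t) u)| ≤
        C * (boundaryNorm k γ x t).toReal ^ rateExponent k α γ * ‖x i t s - x j t u‖ := by
  have hk1 : 1 ≤ k := by omega
  have hκ : 0 < tangentExp k γ := tangentExp_pos hk1 hγ
  have hβ0 : 0 < (k : ℝ) + γ - 1 := by linarith
  have h100 := two_mul_rpow_hundred_le hk hγ hγ₁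
  obtain ⟨C, hC⟩ := exists_abs_vel_sub_le hk hα hγ hγ₁ hβ hβ' hκα (Θ := Θ)
    (r₀ := 1 / 4 * min ρ ((100 : ℝ) ^ (-(1 / ((k : ℝ) + γ - 1))))) (by positivity)
  refine ⟨max C 1, by positivity, ?_⟩
  intro N T θ Ω x L t r₁ A₁ hsol ht hΘ hr₁ hA₁ hflat i j s u hne hadm
  have hp := hsol.toIsPatchSolution
  obtain ⟨B, hB0, hB⟩ := hp.exists_norm_le ht
  have hω := hp.isPatchFunction ht hB0 hB
  have htop := hsol.boundaryNorm_ne_top ht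
  set M := (boundaryNorm k γ x t).toReal with hMdef
  have hM1 : 1 ≤ M := by
    rw [hMdef, ← ENNReal.toReal_one]
    exact ENNReal.toReal_mono htop (hp.one_le_boundaryNorm hk1 ht i)
  have hM0 : 0 < M := by linarith
  set β := (k : ℝ) + γ - 1 with hβdef
  -- The natural length scale, defined by `R^(-β) = M`; it is at most 1 because unit tangents force
  -- `1 ≤ M`.
  set R := M ^ (-(1 / β)) with hRdef
  have hR : 0 < R := by positivity
  have hR1 : R ≤ 1 := Real.rpow_le_one_of_one_le_of_nonpos hM1 (by
    rw [neg_nonpos]; positivity)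
  have hRM : R ^ (-β) = M := by
    rw [hRdef, ← Real.rpow_mul hM0.le, show -(1 / β) * -β = 1 by field_simp, Real.rpow_one]
  have hM : boundaryNorm k γ x t ≤ ENNReal.ofReal (R ^ (-β)) := by
    rw [hRM, hMdef, ENNReal.ofReal_toReal htop]
  have h100M : (100 * M) ^ (-(1 / β)) = 100 ^ (-(1 / β)) * R := by
    rw [Real.mul_rpow (by norm_num) hM0.le]
  have hr : 1 / 4 * min ρ ((100 : ℝ) ^ (-(1 / β))) * R ≤ localRadius k γ ρ x t := by
    unfold localRadius
    rw [← hMdef, ← hβdef, h100M, mul_assoc, min_mul_of_nonneg _ _ hR.le]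
    gcongr
    nlinarith
  have hr8 : 2 * R ^ (-tangentExp k γ) * (8 * localRadius k γ ρ x t) ^ tangentExp k γ ≤ 1 / 2 := by
    have h1 : 8 * localRadius k γ ρ x t ≤ 2 * 100 ^ (-(1 / β)) * R := by
      unfold localRadius
      rw [← hMdef, ← hβdef, h100M]
      linarith [min_le_right ρ ((100 : ℝ) ^ (-(1 / β)) * R)]
    have h2 : 0 ≤ 8 * localRadius k γ ρ x t := by
      have := localRadius_pos (k := k) (γ := γ) (x := x) (t := t) hρ hM0
      linarith
    have h3 : (8 * localRadius k γ ρ x t) ^ tangentExp k γ ≤ 1 / 4 * R ^ tangentExp k γ := by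
      refine (Real.rpow_le_rpow h2 h1 hκ.le).trans ?_
      rw [Real.mul_rpow (by positivity) hR.le]
      gcongr
    rw [Real.rpow_neg hR.le]
    have h4 : 0 < R ^ tangentExp k γ := by positivity
    calc _ ≤ 2 * (R ^ tangentExp k γ)⁻¹ * (1 / 4 * R ^ tangentExp k γ) := by gcongr
      _ = 1 / 2 := by field_simp; norm_num
  have hrpos := localRadius_pos (k := k) (γ := γ) (x := x) (t := t) hρ hM0
  set d := ‖x i t s - x j t u‖ with hd
  have hdpos : 0 < d := norm_pos_iff.mpr (sub_ne_zero.mpr hne)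
  set e := d⁻¹ • (x i t s - x j t u) with he
  have he1 : ‖e‖ = 1 := by
    rw [he, norm_smul, norm_inv, Real.norm_of_nonneg hdpos.le, ← hd, inv_mul_cancel₀ hdpos.ne']
  -- `τ` is chosen so that `τ^⊥` is the unit vector along the segment; both tangents are then `τ` or
  -- `-τ`, and both normal velocities are multiples of `e`.
  obtain ⟨τ, hτe⟩ : ∃ τ, perp τ = e := ⟨-perp e, by rw [perp_neg, perp_perp, neg_neg]⟩
  have hτe' : τ = -perp e := by rw [← hτe, perp_perp, neg_neg]
  have hτ : ‖τ‖ = 1 := by rw [← norm_perp, hτe, he1]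
  have hsub : x i t s - x j t u = d • perp τ := by
    rw [hτe, he, smul_smul, mul_inv_cancel₀ hdpos.ne', one_smul]
  have hperp : ∀ v : Plane, ‖v‖ = 1 → inner ℝ (d • perp τ) v = 0 → v = τ ∨ v = -τ := by
    intro v hv h
    rw [real_inner_smul_left, mul_eq_zero, or_iff_right hdpos.ne', hτe, real_inner_comm] at h
    rcases eq_perp_or_neg_of_inner_eq_zero he1 hv h with h' | h'
    · right; rw [hτe', neg_neg]; exact h'
    · left; rw [hτe']; exact h'
  have h₁ : deriv (x i t) s = τ ∨ deriv (x i t) s = -τ := by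
    refine hperp _ ((hp.param i t ht).unit_speed s) ?_
    rw [← hsub]
    exact inner_deriv_eq_zero_of_isAdmissible hp ht hrpos (hp.mem_totalBoundary ht j u) hne hadm
  have h₂ : deriv (x j t) u = τ ∨ deriv (x j t) u = -τ := by
    refine hperp _ ((hp.param j t ht).unit_speed u) ?_
    rw [← hsub, ← neg_sub (x j t u) (x i t s), inner_neg_left, neg_eq_zero]
    exact inner_deriv_eq_zero_of_isAdmissible hp ht hrpos (hp.mem_totalBoundary ht i s) hne.symm
      hadm.symm
  have hfl : ∀ i s, (deriv (x i t) s = τ ∨ deriv (x i t) s = -τ) →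
      FlatAt (totalBoundary Ω t) (x i t s) τ r₁ A₁ (tangentExp k γ) := by
    intro i s h
    rcases h with h | h
    · rw [← h]; exact hflat i s
    · rw [show τ = -deriv (x i t) s by rw [h, neg_neg]]; exact (hflat i s).neg
  have hnv : ∀ i s, (deriv (x i t) s = τ ∨ deriv (x i t) s = -τ) →
      normalVelocity α (vorticity θ Ω t) (x i t) s =
        vel α (vorticity θ Ω t) (x i t s) τ • e := by
    intro i s h
    rw [normalVelocity_eq hα hω (hflat i s) ((hp.param i t ht).unit_speed s) (hB i s) hA₁ hκ hr₁ hκα]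
    rcases h with h | h
    · rw [h, hτe]
    · rw [h, vel_neg, perp_neg, hτe, neg_smul, smul_neg, neg_neg]
  rw [hnv i s h₁, hnv j u h₂, ← sub_smul, real_inner_smul_right, real_inner_self_eq_norm_sq, he1,
    one_pow, mul_one]
  have h := hC hsol ht hΘ hR hM hr hr8 hτ hdpos (by rw [← hsub]; abel) h₁ h₂ hadm
    ((hfl i s h₁).integrable hω hα hτ (hB i s) hA₁ hκ hr₁ hκα)
    ((hfl j u h₂).integrable hω hα hτ (hB j u) hA₁ hκ hr₁ hκα)
  refine h.trans ?_
  rw [mul_assoc]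
  -- The estimate gives the power `2α/β` of `M`; as `1 ≤ M` and `1 ≤ k`, it is dominated by the
  -- stated exponent, which coincides with it for `k = 1`.
  have hpow : R ^ (-(2 * α)) ≤ M ^ rateExponent k α γ := by
    rw [hRdef, ← Real.rpow_mul hM0.le]
    refine Real.rpow_le_rpow_of_exponent_le hM1 ?_
    unfold rateExponent
    rw [← hβdef, show -(1 / β) * -(2 * α) = 2 * α / β by ring]
    have : (1 : ℝ) ≤ k := by exact_mod_cast hk1
    gcongr
    linarith
  have hRd : 0 ≤ R ^ (-(2 * α)) * d := by positivity
  calc C * (R ^ (-(2 * α)) * d) ≤ max C 1 * (R ^ (-(2 * α)) * d) := by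
        gcongr; exact le_max_left _ _
    _ ≤ _ := by gcongr

end Rate

/-! ### A Gronwall inequality with almost everywhere control of the Dini derivative -/

section Gronwall

variable {f a : ℝ → ℝ} {b K : ℝ}

/-- Comparison of `-f` with a line of slope `K + 1`; the comparison principle needs a slope strictly
above `K`. -/
lemma sub_le_mul_of_slope_lt (hf : ContinuousOn f (Icc 0 b))
    (hK : ∀ t ∈ Ico 0 b, ∀ r, K < r → ∃ᶠ z in 𝓝[>] t, slope (fun u => -f u) t z < r) {s t : ℝ}
    (hs : s ∈ Icc 0 b) (ht : t ∈ Icc 0 b) (hst : s ≤ t) : f s - f t ≤ (K + 1) * (t - s) := by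
  have h := image_le_of_liminf_slope_right_lt_deriv_boundary (f := fun u => -f u)
    (f' := fun _ => K) (a := s) (b := t) (B := fun u => -f s + (K + 1) * (u - s))
    (B' := fun _ => K + 1) (hf.neg.mono (Icc_subset_Icc hs.1 ht.2))
    (fun u hu r hr => hK u ⟨hs.1.trans hu.1, hu.2.trans_le ht.2⟩ r hr) (by simp)
    (fun u => by
      have := (((hasDerivAt_id u).sub_const s).const_mul (K + 1)).const_add (-f s)
      simpa using this)
    (fun _ _ _ => by linarith) (right_mem_Icc.mpr hst)
  linarith

lemma neg_deriv_le_of_slope_lt {t f' c : ℝ} (hd : HasDerivAt f f' t)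
    (h : ∀ r, c < r → ∃ᶠ z in 𝓝[>] t, slope (fun u => -f u) t z < r) : -f' ≤ c := by
  refine le_of_forall_gt_imp_ge_of_dense fun r hr => ?_
  have h1 : Tendsto (slope (fun u => -f u) t) (𝓝[>] t) (𝓝 (-f')) :=
    (hasDerivAt_iff_tendsto_slope.mp hd.neg).mono_left
      (nhdsWithin_mono _ fun z hz => ne_of_gt hz)
  by_contra! hcon
  have h2 := h1.eventually (lt_mem_nhds hcon)
  obtain ⟨z, h3, h4⟩ := ((h r hr).and_eventually h2).exists
  linarith

/-- An almost everywhere Dini bound alone would not control `f`. The crude bound `K`, valid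
everywhere, makes `G = log f + K' t` monotone; hence `G` is differentiable almost everywhere and the
integral of its derivative is at most its increment, so a singular part can only help. Where `G` is
differentiable, the sharp bound reads `K' - deriv G t ≤ a t`. No measurability of `a` is required.
-/
lemma log_sub_log_le_lintegral (hb : 0 < b) (hK0 : 0 ≤ K) (hf : ContinuousOn f (Icc 0 b))
    (hpos : ∀ t ∈ Icc 0 b, 0 < f t)
    (hK : ∀ t ∈ Ico 0 b, ∀ r, K < r → ∃ᶠ z in 𝓝[>] t, slope (fun u => -f u) t z < r)
    (ha : ∀ᵐ t ∂(volume.restrict (Ioo 0 b)), ∀ r, a t * f t < r →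
      ∃ᶠ z in 𝓝[>] t, slope (fun u => -f u) t z < r) :
    ENNReal.ofReal (Real.log (f 0) - Real.log (f b)) ≤ ∫⁻ t in Icc 0 b, ENNReal.ofReal (a t) := by
  obtain ⟨tm, htm, hmin⟩ := isCompact_Icc.exists_isMinOn (nonempty_Icc.mpr hb.le) hf
  set m := f tm with hm
  have hm0 : 0 < m := hpos tm htm
  -- `f` loses at most `K + 1` per unit time and is at least `m`, so `log f` loses at most `(K + 1)
  -- / m`.
  set K' := (K + 1) / m with hK'
  have hK'0 : 0 ≤ K' := by positivity
  set G : ℝ → ℝ := fun t => Real.log (f t) + K' * t with hG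
  have hmono : MonotoneOn G (uIcc 0 b) := by
    rw [uIcc_of_le hb.le]
    intro s hs t ht hst
    have h1 := sub_le_mul_of_slope_lt hf hK hs ht hst
    have hft := hpos t ht
    have hfs := hpos s hs
    have h2 : Real.log (f s) - Real.log (f t) ≤ f s / f t - 1 := by
      rw [← Real.log_div hfs.ne' hft.ne']
      exact Real.log_le_sub_one_of_pos (by positivity)
    have h3 : f s / f t - 1 ≤ K' * (t - s) := by
      rw [div_sub_one hft.ne', div_le_iff₀ hft]
      have h4 : m ≤ f t := hmin ht
      have h5 : (K + 1) * (t - s) ≤ K' * (t - s) * f t := by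
        rw [hK', div_mul_eq_mul_div, div_mul_eq_mul_div, le_div_iff₀ hm0]
        have : 0 ≤ (K + 1) * (t - s) := mul_nonneg (by linarith) (by linarith)
        gcongr
      linarith
    simp only [hG]
    linarith
  have hint := hmono.intervalIntegrable_deriv
  have hle : ∫ t in (0 : ℝ)..b, deriv G t ≤ G b - G 0 := by
    have h1 := hmono.intervalIntegral_deriv_mem_uIcc
    have h2 : 0 ≤ G b - G 0 := sub_nonneg.mpr (hmono (by simp) (by simp) hb.le)
    rw [uIcc_of_le h2] at h1
    exact h1.2
  have hae : ∀ᵐ t ∂(volume.restrict (Ioo 0 b)), K' - deriv G t ≤ a t := by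
    have h1 : ∀ᵐ t ∂(volume.restrict (Ioo 0 b)), DifferentiableWithinAt ℝ G (Ioo 0 b) t :=
      (hmono.mono (by rw [uIcc_of_le hb.le]; exact Ioo_subset_Icc_self)).ae_differentiableWithinAt
        measurableSet_Ioo
    filter_upwards [h1, ha, ae_restrict_mem measurableSet_Ioo] with t h1 h2 ht
    have hft := hpos t (Ioo_subset_Icc_self ht)
    have hGd : HasDerivAt G (deriv G t) t :=
      (h1.differentiableAt (Ioo_mem_nhds ht.1 ht.2)).hasDerivAt
    have hlog : HasDerivAt (fun u => G u - K' * u) (deriv G t - K') t := by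
      have := hGd.sub ((hasDerivAt_id t).const_mul K')
      rwa [mul_one] at this
    -- `f` is recovered as `exp (G u - K' * u)`, so it is differentiable wherever `G` is.
    have hfd : HasDerivAt f (f t * (deriv G t - K')) t := by
      have h3 := hlog.exp
      have h4 : Real.exp (G t - K' * t) = f t := by
        simp only [hG, add_sub_cancel_right]
        exact Real.exp_log hft
      rw [h4] at h3
      refine h3.congr_of_eventuallyEq ?_
      filter_upwards [Ioo_mem_nhds ht.1 ht.2] with u hu
      simp only [hG, add_sub_cancel_right]
      exact (Real.exp_log (hpos u (Ioo_subset_Icc_self hu))).symm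
    have h5 := neg_deriv_le_of_slope_lt hfd h2
    rw [← mul_neg, neg_sub, mul_comm] at h5
    exact le_of_mul_le_mul_right h5 hft
  have hint2 : IntegrableOn (fun t => K' - deriv G t) (Ioo 0 b) := by
    have h1 : IntegrableOn (deriv G) (Ioc 0 b) :=
      (intervalIntegrable_iff_integrableOn_Ioc_of_le hb.le).mp hint
    exact (integrableOn_const (by simp)).sub (h1.mono_set Ioo_subset_Ioc_self)
  have hval : Real.log (f 0) - Real.log (f b) ≤ ∫ t in Ioo 0 b, (K' - deriv G t) := by
    rw [← integral_Ioc_eq_integral_Ioo, ← intervalIntegral.integral_of_le hb.le,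
      intervalIntegral.integral_sub intervalIntegrable_const hint, intervalIntegral.integral_const]
    simp only [hG] at hle
    simp only [sub_zero, smul_eq_mul]
    linarith
  calc ENNReal.ofReal (Real.log (f 0) - Real.log (f b))
      ≤ ENNReal.ofReal (∫ t in Ioo 0 b, (K' - deriv G t)) := ENNReal.ofReal_le_ofReal hval
    _ ≤ ∫⁻ t in Ioo 0 b, ENNReal.ofReal (K' - deriv G t) := by
      refine ENNReal.ofReal_le_of_le_toReal ?_
      rw [integral_eq_lintegral_pos_part_sub_lintegral_neg_part hint2]
      linarith [ENNReal.toReal_nonneg (a := ∫⁻ t in Ioo 0 b, ENNReal.ofReal (-(K' - deriv G t)))]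
    _ ≤ ∫⁻ t in Ioo 0 b, ENNReal.ofReal (a t) := by
      refine lintegral_mono_ae ?_
      filter_upwards [hae] with t ht
      exact ENNReal.ofReal_le_ofReal ht
    _ ≤ _ := lintegral_mono_set Ioo_subset_Icc_self

end Gronwall

lemma expNeg_top : expNeg ∞ = 0 := by
  simp [expNeg]

lemma expNeg_antitone : Antitone expNeg := by
  intro a b hab
  unfold expNeg
  exact EReal.exp_monotone (EReal.neg_le_neg_iff.mpr (EReal.coe_ennreal_le_coe_ennreal_iff.mpr hab))

lemma expNeg_zero : expNeg 0 = 1 := by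
  simp [expNeg]

lemma expNeg_ofReal {v : ℝ} (hv : 0 ≤ v) : expNeg (ENNReal.ofReal v) = ENNReal.ofReal (Real.exp (-v)) := by
  unfold expNeg
  rw [EReal.coe_ennreal_ofReal, max_eq_left hv, ← EReal.coe_neg, EReal.exp_coe]

lemma ofReal_mul_expNeg_le {u v : ℝ} (hu : 0 < u) (hv : 0 < v) {I : ℝ≥0∞}
    (h : ENNReal.ofReal (Real.log u - Real.log v) ≤ I) :
    ENNReal.ofReal u * expNeg I ≤ ENNReal.ofReal v := by
  rcases eq_or_ne I ∞ with rfl | hI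
  · rw [expNeg_top, mul_zero]; exact zero_le
  rw [← ENNReal.ofReal_toReal hI, expNeg_ofReal ENNReal.toReal_nonneg, ← ENNReal.ofReal_mul hu.le]
  refine ENNReal.ofReal_le_ofReal ?_
  have h1 : Real.log u - Real.log v ≤ I.toReal := (ENNReal.ofReal_le_iff_le_toReal hI).mp h
  calc u * Real.exp (-I.toReal) = Real.exp (Real.log u + -I.toReal) := by
        rw [Real.exp_add, Real.exp_log hu]
    _ ≤ Real.exp (Real.log v) := Real.exp_le_exp.mpr (by linarith)
    _ = v := Real.exp_log hv

/-! ### From the rate of approach to the exponential lower bound. -/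

section Conclusion

variable {N : ℕ} {k : ℕ} {α γ T η ρ H κ : ℝ} {θ : Fin N → ℝ} {Ω : Fin N → ℝ → Set Plane}
  {x : Fin N → ℝ → ℝ → Plane} {L : Fin N → ℝ → ℝ}

/-- A bound on the relative velocity of all minimizing pairs bounds the lower right Dini derivative
of the separation distance. -/
lemma frequently_slope_lt (hη : 0 < η) (hH : 0 ≤ H) (hκ : 0 < κ)
    (hsol : IsPatchSolution α T θ Ω x L)
    (hL : ∀ i, ∀ t ∈ Ico 0 T, 2 * η ≤ L i t) {T' : ℝ} (hT' : T' < T)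
    (hh : ∀ t ∈ Icc 0 T', ∀ i, IsHolderCurve H κ (x i t)) (i₀ : Fin N) {δ : ℝ} (hδ : 0 < δ)
    (hreg : ∀ t ∈ Icc 0 T', ∃ z, IsRegularMinimizer η Ω x L δ t z) {t : ℝ} (ht : t ∈ Ico 0 T')
    (hu : ∀ i, Continuous (normalVelocity α (vorticity θ Ω t) (x i t))) {c : ℝ}
    (hc : ∀ i j s r, (x i t s, x j t r) ∈ competingPairs η Ω x L t →
      edist (x i t s) (x j t r) = separation η Ω x L t →
      |inner ℝ (‖x i t s - x j t r‖⁻¹ • (x i t s - x j t r))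
          (normalVelocity α (vorticity θ Ω t) (x i t) s
            - normalVelocity α (vorticity θ Ω t) (x j t) r)| ≤ c) {b : ℝ} (hb : c < b) :
    ∃ᶠ z in 𝓝[>] t, slope (fun u => -(separation η Ω x L u).toReal) t z < b := by
  -- `∃ᶠ` unfolds to a negation: `hcon` says that the slope is eventually at least `b` on the right
  -- of `t`, and a single increment along an ultrafilter refutes this.
  intro hcon
  obtain ⟨U, hU⟩ := Ultrafilter.exists_le (𝓝[>] (0 : ℝ))
  obtain ⟨i, j, s, r, h1, h2, h3⟩ :=
    exists_minimizer_rate hη hH hκ hsol hL hT' hh i₀ hδ hreg ht hu hU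
  have h4 := h3 ((b - c) / 2) (by linarith)
  have hmap : Tendsto (fun h : ℝ => t + h) U (𝓝[>] t) := by
    refine tendsto_nhdsWithin_iff.mpr ⟨?_, ?_⟩
    · have : Tendsto (fun h : ℝ => t + h) (𝓝 0) (𝓝 t) := by
        have hc : Continuous fun h : ℝ => t + h := by fun_prop
        simpa using hc.tendsto 0
      exact this.mono_left (hU.trans nhdsWithin_le_nhds)
    · filter_upwards [hU self_mem_nhdsWithin] with h hh
      exact lt_add_of_pos_right t hh
  obtain ⟨h, h5, h6, h7⟩ := (h4.and ((hmap.eventually hcon).and (hU self_mem_nhdsWithin))).exists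
  apply h6
  rw [slope_def_field, add_sub_cancel_left, div_lt_iff₀ h7]
  have h8 := (abs_le.mp (hc i j s r h1 h2)).1
  nlinarith

end Conclusion

section Conclusion

variable {N : ℕ} {k : ℕ} {α γ T η ρ C : ℝ} {θ : Fin N → ℝ} {Ω : Fin N → ℝ → Set Plane}
  {x : Fin N → ℝ → ℝ → Plane} {L : Fin N → ℝ → ℝ}

lemma separation_eq_top (x : Fin 0 → ℝ → ℝ → Plane) (Ω : Fin 0 → ℝ → Set Plane)
    (L : Fin 0 → ℝ → ℝ) (t : ℝ) : separation η Ω x L t = ∞ := by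
  unfold separation
  simp only [iInf_eq_top]
  rintro z (⟨i, -⟩ | ⟨i, -⟩) <;> exact i.elim0

lemma abs_inner_unit_le {v w₁ w₂ : Plane} {K : ℝ} (h₁ : ‖w₁‖ ≤ K) (h₂ : ‖w₂‖ ≤ K) :
    |inner ℝ (‖v‖⁻¹ • v) (w₁ - w₂)| ≤ 2 * K := by
  have hK : 0 ≤ K := (norm_nonneg _).trans h₁
  have hv : ‖‖v‖⁻¹ • v‖ ≤ 1 := by
    rw [norm_smul, norm_inv, norm_norm]
    exact inv_mul_le_one
  calc _ ≤ ‖‖v‖⁻¹ • v‖ * ‖w₁ - w₂‖ := abs_real_inner_le_norm _ _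
    _ ≤ 1 * (‖w₁‖ + ‖w₂‖) := by gcongr; exact norm_sub_le _ _
    _ ≤ _ := by linarith

/-- Provides the crude bound for the Gronwall argument. `K` depends on the solution through `M` and
`r₁`, but only its existence matters. -/
lemma exists_normalVelocity_bound (hα : 0 < α) (hκ : 0 < tangentExp k γ)
    (hκα : 2 * α - 1 < tangentExp k γ) (hp : IsPatchSolution α T θ Ω x L) {M r₁ t : ℝ}
    (hM0 : 0 ≤ M) (hr₁ : 0 < r₁) (hIco : ∀ τ ∈ Icc 0 t, τ ∈ Ico 0 T)
    (hM : ∀ τ ∈ Icc 0 t, boundaryNorm k γ x τ ≤ ENNReal.ofReal M)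
    (hh : ∀ τ ∈ Icc 0 t, ∀ i, IsHolderCurve M (tangentExp k γ) (x i τ))
    (hflat : ∀ τ ∈ Icc 0 t, ∀ i s, FlatAt (totalBoundary Ω τ) (x i τ s) (deriv (x i τ) s) r₁
      (2 * M) (tangentExp k γ)) :
    (∀ τ ∈ Icc 0 t, ∀ i, Continuous (normalVelocity α (vorticity θ Ω τ) (x i τ))) ∧
    ∃ K, ∀ τ ∈ Icc 0 t, ∀ i s, ‖normalVelocity α (vorticity θ Ω τ) (x i τ) s‖ ≤ K := by
  have hB : ∀ τ ∈ Icc 0 t, ∀ i s, ‖x i τ s‖ ≤ M := fun τ hτ i s => by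
    have := norm_iteratedDeriv_le_of_boundaryNorm_le (hM τ hτ) hM0 i (Nat.zero_le k) s
    rwa [iteratedDeriv_zero] at this
  have hω : ∀ τ ∈ Icc 0 t, IsPatchFunction (vorticity θ Ω τ) (totalBoundary Ω τ) (∑ i, |θ i|) M :=
    fun τ hτ => hp.isPatchFunction (hIco τ hτ) hM0 (hB τ hτ)
  have hA : 0 ≤ 2 * M := by linarith
  have hnv : ∀ τ ∈ Icc 0 t, ∀ i, normalVelocity α (vorticity θ Ω τ) (x i τ) = fun s =>
      vel α (vorticity θ Ω τ) (x i τ s) (deriv (x i τ) s) • perp (deriv (x i τ) s) :=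
    fun τ hτ i => funext fun s => normalVelocity_eq hα (hω τ hτ) (hflat τ hτ i s)
      ((hh τ hτ i).unit_speed s) (hB τ hτ i s) hA hκ hr₁ hκα
  have hu : ∀ τ ∈ Icc 0 t, ∀ i, Continuous (normalVelocity α (vorticity θ Ω τ) (x i τ)) := by
    intro τ hτ i
    rw [hnv τ hτ i]
    have hdc := (hh τ hτ i).continuous_deriv hκ
    exact (continuous_vel (hh τ hτ i).differentiable.continuous hdc (hflat τ hτ i) (hω τ hτ) hα
      (hh τ hτ i).unit_speed (hB τ hτ i) hA hκ hr₁ hκα).smul (continuous_perp.comp hdc)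
  refine ⟨hu, 1 / 2 * ∫ p, velBound α (∑ i, |θ i|) M r₁ (2 * M) (tangentExp k γ) p, ?_⟩
  intro τ hτ i s
  rw [hnv τ hτ i, norm_smul, norm_perp, (hh τ hτ i).unit_speed, mul_one, Real.norm_eq_abs]
  exact (hflat τ hτ i s).abs_vel_le (hω τ hτ) hα ((hh τ hτ i).unit_speed s) (hB τ hτ i s) hA hκ
    hr₁ hκα

/-- The Gronwall inequality on `[0, t]`, fed at every time with the crude rate `2 * K` and at almost
every time with the sharp rate of admissible pairs. -/
lemma separation_mul_expNeg_le (hk : k = 1 ∨ k = 2) (hα : 0 < α) (hγ : 0 < γ)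
    (hγ₁ : γ ≤ 1) (hκα : 2 * α - 1 < tangentExp k γ) (hrate : 0 ≤ rateExponent k α γ)
    (hη : 0 < η) (hρ : 0 < ρ) (hC0 : 0 < C)
    (hsol : IsHolderPatchSolution k γ α T θ Ω x L)
    (hL : ∀ i, ∀ t ∈ Ico 0 T, 2 * η ≤ L i t) (hac : LocalArcChord η T x)
    (hadm : ∀ᵐ t ∂(volume.restrict (Ico 0 T)), ∀ z ∈ competingPairs η Ω x L t,
      edist z.1 z.2 = separation η Ω x L t →
      IsAdmissible (totalBoundary Ω t) (localRadius k γ ρ x t) z.1 z.2)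
    (hC : ∀ {t r₁ A₁ : ℝ}, t ∈ Ico 0 T → 0 < r₁ → 0 ≤ A₁ →
      (∀ i s, FlatAt (totalBoundary Ω t) (x i t s) (deriv (x i t) s) r₁ A₁ (tangentExp k γ)) →
      ∀ {i j : Fin N} {s u : ℝ}, x i t s ≠ x j t u →
      IsAdmissible (totalBoundary Ω t) (localRadius k γ ρ x t) (x i t s) (x j t u) →
      |inner ℝ (‖x i t s - x j t u‖⁻¹ • (x i t s - x j t u))
        (normalVelocity α (vorticity θ Ω t) (x i t) s
          - normalVelocity α (vorticity θ Ω t) (x j t) u)| ≤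
        C * (boundaryNorm k γ x t).toReal ^ rateExponent k α γ * ‖x i t s - x j t u‖)
    {t : ℝ} (ht : t ∈ Ico 0 T) :
    separation η Ω x L 0 * expNeg (ENNReal.ofReal C *
      ∫⁻ τ in Icc 0 t, boundaryNorm k γ x τ ^ rateExponent k α γ) ≤ separation η Ω x L t := by
  -- Without patches there are no competing pairs and the separation is `∞`.
  rcases Nat.eq_zero_or_pos N with rfl | hN
  · rw [separation_eq_top x Ω L t]; exact le_top
  obtain ⟨i₀⟩ : Nonempty (Fin N) := ⟨⟨0, hN⟩⟩
  rcases eq_or_lt_of_le ht.1 with h0 | h0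
  · rw [← h0, Icc_self, Measure.restrict_singleton]
    simp [expNeg_zero]
  have hk1 : 1 ≤ k := by omega
  have hκ : 0 < tangentExp k γ := tangentExp_pos hk1 hγ
  have hκ₁ : tangentExp k γ ≤ 1 := min_le_right _ _
  have hp := hsol.toIsPatchSolution
  obtain ⟨M, hM1, hM⟩ := hsol.exists_norm_bound ht.2
  have hM0 : 0 ≤ M := by linarith
  have hIco : ∀ τ ∈ Icc 0 t, τ ∈ Ico 0 T := fun τ hτ => ⟨hτ.1, hτ.2.trans_lt ht.2⟩
  have hh : ∀ τ ∈ Icc 0 t, ∀ i, IsHolderCurve M (tangentExp k γ) (x i τ) := fun τ hτ i =>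
    hsol.isHolderCurve hk hγ hγ₁ (hIco τ hτ) hM0 (hM τ hτ) i
  obtain ⟨r₁, hr₁, hflat⟩ := exists_flat hη hM0 hκ hκ₁ hp hL hac h0.le ht.2 hh i₀
  obtain ⟨δ, hδ, hreg⟩ := exists_regularMinimizer hη hρ hM0 hκ hp hL h0 ht.2 hh hk1 hγ hM hadm i₀
  have hA : 0 ≤ 2 * M := by linarith
  obtain ⟨hu, K, hK⟩ := exists_normalVelocity_bound hα hκ hκα hp hM0 hr₁ hIco hM hh hflat
  have hK0 : 0 ≤ K := (norm_nonneg _).trans (hK 0 ⟨le_rfl, h0.le⟩ i₀ 0)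
  have hfin : ∀ τ ∈ Icc 0 t, separation η Ω x L τ ≠ ∞ := fun τ hτ =>
    separation_ne_top hη hM0 hκ hp hL (hIco τ hτ) (hh τ hτ) i₀
  have hpos : ∀ τ ∈ Icc 0 t, 0 < separation η Ω x L τ := fun τ hτ =>
    separation_pos hη hM0 hκ hp hL (hIco τ hτ) (hh τ hτ) i₀
  have hfpos : ∀ τ ∈ Icc 0 t, 0 < (separation η Ω x L τ).toReal := fun τ hτ =>
    ENNReal.toReal_pos (hpos τ hτ).ne' (hfin τ hτ)
  have hcont : ContinuousOn (fun τ => (separation η Ω x L τ).toReal) (Icc 0 t) :=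
    ENNReal.continuousOn_toReal.comp (continuousOn_separation hη hM0 hκ hp hL ht.2 hh i₀) hfin
  have hslope : ∀ τ ∈ Ico 0 t, ∀ {c b : ℝ}, (∀ i j s r, (x i τ s, x j τ r) ∈
      competingPairs η Ω x L τ → edist (x i τ s) (x j τ r) = separation η Ω x L τ →
      |inner ℝ (‖x i τ s - x j τ r‖⁻¹ • (x i τ s - x j τ r))
          (normalVelocity α (vorticity θ Ω τ) (x i τ) s
            - normalVelocity α (vorticity θ Ω τ) (x j τ) r)| ≤ c) → c < b →
      ∃ᶠ z in 𝓝[>] τ, slope (fun u => -(separation η Ω x L u).toReal) τ z < b :=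
    fun τ hτ _ _ hc hb => frequently_slope_lt hη hM0 hκ hp hL ht.2 hh i₀ hδ hreg hτ
      (hu τ (Ico_subset_Icc_self hτ)) hc hb
  have hae : ∀ᵐ τ ∂volume.restrict (Ioo 0 t), ∀ r,
      C * (boundaryNorm k γ x τ).toReal ^ rateExponent k α γ * (separation η Ω x L τ).toReal < r →
      ∃ᶠ z in 𝓝[>] τ, slope (fun u => -(separation η Ω x L u).toReal) τ z < r := by
    have hsub : Ioo 0 t ⊆ Ico 0 T := fun τ hτ => hIco τ (Ioo_subset_Icc_self hτ)
    filter_upwards [ae_restrict_of_ae_restrict_of_subset hsub hadm,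
      ae_restrict_mem measurableSet_Ioo] with τ hτ hmem r hr
    have hτI := Ioo_subset_Icc_self hmem
    refine hslope τ (Ioo_subset_Ico_self hmem) (fun i j s u h1 h2 => ?_) hr
    have hne : x i τ s ≠ x j τ u := by
      intro h
      rw [h, edist_self] at h2
      exact (hpos τ hτI).ne h2
    have hd : (separation η Ω x L τ).toReal = ‖x i τ s - x j τ u‖ := by
      rw [← h2, ← dist_edist, dist_eq_norm]
    rw [hd]
    have hz : IsAdmissible (totalBoundary Ω τ) (localRadius k γ ρ x τ) (x i τ s) (x j τ u) :=
      hτ (x i τ s, x j τ u) h1 h2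
    exact hC (hIco τ hτI) hr₁ hA (hflat τ hτI) hne hz
  have hall : ∀ τ ∈ Ico 0 t, ∀ r, 2 * K < r →
      ∃ᶠ z in 𝓝[>] τ, slope (fun u => -(separation η Ω x L u).toReal) τ z < r :=
    fun τ hτ r hr => hslope τ hτ (fun i j s u _ _ => abs_inner_unit_le
      (hK τ (Ico_subset_Icc_self hτ) i s) (hK τ (Ico_subset_Icc_self hτ) j u)) hr
  have hmain := log_sub_log_le_lintegral h0 (by positivity) hcont hfpos hall hae
  have h0mem : (0 : ℝ) ∈ Icc 0 t := ⟨le_rfl, h0.le⟩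
  have htmem : t ∈ Icc 0 t := ⟨h0.le, le_rfl⟩
  rw [← ENNReal.ofReal_toReal (hfin 0 h0mem), ← ENNReal.ofReal_toReal (hfin t htmem)]
  refine ofReal_mul_expNeg_le (hfpos 0 h0mem) (hfpos t htmem) (hmain.trans (le_of_eq ?_))
  rw [← lintegral_const_mul' _ _ ENNReal.ofReal_ne_top]
  refine setLIntegral_congr_fun measurableSet_Icc fun τ hτ => ?_
  rw [ENNReal.ofReal_mul hC0.le, ← ENNReal.ofReal_rpow_of_nonneg ENNReal.toReal_nonneg hrate,
    ENNReal.ofReal_toReal (hsol.boundaryNorm_ne_top (hIco τ hτ))]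

/-- For unit speed curves, a Lipschitz bound on the tangent controls all its Hölder norms. -/
lemma boundaryNorm_one_le {t K : ℝ} (hγ : 0 < γ) (hγ₁ : γ ≤ 1)
    (hu : ∀ i s, ‖deriv (x i t) s‖ = 1) (hK : 1 ≤ K)
    (h : boundaryNorm 1 1 x t ≤ ENNReal.ofReal K) :
    boundaryNorm 1 γ x t ≤ ENNReal.ofReal (3 * K) := by
  unfold boundaryNorm at h ⊢
  refine iSup_le fun j => ?_
  have hj := (le_iSup_iff.mpr fun b hb => hb j).trans h
  set S := ∑ l ∈ Finset.range (1 + 1), ⨆ s, ‖iteratedDeriv l (x j t) s‖ₑ with hS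
  have hlip : ∀ s r : ℝ, s ≠ r → ‖iteratedDeriv 1 (x j t) s - iteratedDeriv 1 (x j t) r‖ₑ /
      ENNReal.ofReal (|s - r| ^ γ) ≤ (⨆ (s : ℝ) (r : ℝ) (_ : s ≠ r),
      ‖iteratedDeriv 1 (x j t) s - iteratedDeriv 1 (x j t) r‖ₑ / ENNReal.ofReal (|s - r| ^ (1 : ℝ)))
      + 2 := by
    intro s r hsr
    have hpos : 0 < |s - r| := abs_pos.mpr (sub_ne_zero.mpr hsr)
    rcases le_total |s - r| 1 with h1 | h1
    · refine le_trans ?_ (le_add_of_nonneg_right zero_le)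
      refine le_iSup_of_le s (le_iSup_of_le r (le_iSup_of_le hsr ?_))
      refine ENNReal.div_le_div_left (ENNReal.ofReal_le_ofReal ?_) _
      exact Real.rpow_le_rpow_of_exponent_ge hpos h1 hγ₁
    · refine le_trans ?_ (le_add_of_nonneg_left zero_le)
      have h2 : (1 : ℝ≥0∞) ≤ ENNReal.ofReal (|s - r| ^ γ) := by
        rw [← ENNReal.ofReal_one]
        exact ENNReal.ofReal_le_ofReal (Real.one_le_rpow h1 hγ.le)
      refine (ENNReal.div_le_div_left h2 _).trans ?_
      rw [div_one, iteratedDeriv_one, ← ofReal_norm]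
      exact (ENNReal.ofReal_le_ofReal (q := 2) ((norm_sub_le _ _).trans
        (by rw [hu, hu]; norm_num))).trans (by simp)
  calc _ ≤ S + ((⨆ (s : ℝ) (r : ℝ) (_ : s ≠ r),
      ‖iteratedDeriv 1 (x j t) s - iteratedDeriv 1 (x j t) r‖ₑ / ENNReal.ofReal (|s - r| ^ (1 : ℝ)))
      + 2) := by
        gcongr
        exact iSup_le fun s => iSup_le fun r => iSup_le fun hsr => hlip s r hsr
    _ ≤ ENNReal.ofReal K + 2 := by
        rw [← add_assoc]
        gcongr
    _ = ENNReal.ofReal (K + 2) := by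
        rw [ENNReal.ofReal_add (by linarith) (by norm_num)]; simp
    _ ≤ _ := ENNReal.ofReal_le_ofReal (by linarith)

lemma ceil_two_mul_eq {α : ℝ} (hα₀ : 0 < α) (hα₁ : α < 1) :
    ⌈2 * α⌉₊ = 1 ∨ ⌈2 * α⌉₊ = 2 := by
  have h1 : 0 < ⌈2 * α⌉₊ := Nat.ceil_pos.mpr (by linarith)
  have h2 : ⌈2 * α⌉₊ ≤ 2 := Nat.ceil_le.mpr (by push_cast; linarith)
  omega

lemma ofReal_exp_le_expNeg {t K q : ℝ} {g : ℝ → ℝ≥0∞} (hC : 0 ≤ C) (hK : 0 ≤ K) (ht : 0 ≤ t)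
    (hq : 0 ≤ q) (hg : ∀ τ ∈ Icc 0 t, g τ ≤ ENNReal.ofReal K) :
    ENNReal.ofReal (Real.exp (-(C * K ^ q * t))) ≤
      expNeg (ENNReal.ofReal C * ∫⁻ τ in Icc 0 t, g τ ^ q) := by
  rw [← expNeg_ofReal (by positivity)]
  refine expNeg_antitone ?_
  rw [mul_assoc, ENNReal.ofReal_mul hC]
  gcongr
  calc ∫⁻ τ in Icc 0 t, g τ ^ q ≤ ∫⁻ _ in Icc 0 t, ENNReal.ofReal (K ^ q) := by
        refine setLIntegral_mono measurable_const fun τ hτ => ?_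
        rw [← ENNReal.ofReal_rpow_of_nonneg hK hq]
        exact ENNReal.rpow_le_rpow (hg τ hτ) hq
    _ = _ := by
        rw [setLIntegral_const, Real.volume_Icc, sub_zero, ENNReal.ofReal_mul (by positivity)]

end Conclusion

end SQGPatch

end

theorem theorem2 (α γ η ρ : ℝ) (k : ℕ) (hα₀ : 0 < α) (hα₁ : α < 1) (hk : k = ⌈2 * α⌉₊)
    (hγ₀ : 2 * α - (⌈2 * α⌉₊ : ℝ) + 1 ≤ γ) (hγ₁ : γ ≤ 1) (hη : 0 < η) (hρ : 0 < ρ)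
    (N : ℕ) (θ : Fin N → ℝ) :
    ∃ C : ℝ, 0 < C ∧
      ∀ (T : ℝ) (_ : 0 < T) (Ω : Fin N → ℝ → Set SQGPatch.Plane)
        (x : Fin N → ℝ → ℝ → SQGPatch.Plane) (L : Fin N → ℝ → ℝ)
        (_ : SQGPatch.IsHolderPatchSolution k γ α T θ Ω x L)
        (_ : ∀ i, ∀ t ∈ Ico 0 T, 2 * η ≤ L i t)
        (_ : SQGPatch.LocalArcChord η T x)
        (_ : ∀ᵐ t ∂(volume.restrict (Ico 0 T)), ∀ z ∈ SQGPatch.competingPairs η Ω x L t,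
          edist z.1 z.2 = SQGPatch.separation η Ω x L t →
          SQGPatch.IsAdmissible (SQGPatch.totalBoundary Ω t)
            (SQGPatch.localRadius k γ ρ x t) z.1 z.2),
        (∀ t ∈ Ico 0 T,
          SQGPatch.separation η Ω x L 0 *
              SQGPatch.expNeg (ENNReal.ofReal C *
                ∫⁻ τ in Icc 0 t,
                  SQGPatch.boundaryNorm k γ x τ ^ SQGPatch.rateExponent k α γ) ≤
            SQGPatch.separation η Ω x L t) ∧
        (SQGPatch.separation η Ω x L 0 *
              SQGPatch.expNeg (ENNReal.ofReal C *
                ∫⁻ τ in Ico 0 T,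
                  SQGPatch.boundaryNorm k γ x τ ^ SQGPatch.rateExponent k α γ) ≤
            liminf (fun t => SQGPatch.separation η Ω x L t) (𝓝[<] T)) ∧
        (α ≤ 1 / 2 → ∀ K : ℝ, 0 < K →
          (∀ t ∈ Ico 0 T, SQGPatch.boundaryNorm 1 1 x t ≤ ENNReal.ofReal K) →
          ∀ t ∈ Ico 0 T,
            SQGPatch.separation η Ω x L 0 *
                ENNReal.ofReal (Real.exp (-(C * K ^ SQGPatch.rateExponent k α γ * t))) ≤
              SQGPatch.separation η Ω x L t) := by
  have hk12 : k = 1 ∨ k = 2 := hk ▸ SQGPatch.ceil_two_mul_eq hα₀ hα₁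
  have hk₀ : 2 * α ≤ (k : ℝ) := hk ▸ Nat.le_ceil _
  have hk₁ : (k : ℝ) < 2 * α + 1 := hk ▸ Nat.ceil_lt_add_one (by linarith)
  rw [← hk] at hγ₀
  have hγ : 0 < γ := by linarith
  have hrate : 0 ≤ SQGPatch.rateExponent k α γ := by
    have hk1 : (1 : ℝ) ≤ k := by rcases hk12 with rfl | rfl <;> norm_num
    exact div_nonneg (by linarith) (by linarith)
  have hκα : 2 * α - 1 < SQGPatch.tangentExp k γ := by
    rcases hk12 with rfl | rfl
    · rw [SQGPatch.tangentExp_one hγ₁]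
      push_cast at hγ₀
      linarith
    · rw [SQGPatch.tangentExp_two hγ]
      linarith
  obtain ⟨C₀, hC₀, hC⟩ := SQGPatch.exists_abs_inner_normalVelocity_le hk12 hα₀ hγ hγ₁
    (by linarith) (by linarith) hκα hρ (∑ i, |θ i|)
  -- The constant is enlarged by a power of 3 for the sake of the last claim, where
  -- `boundaryNorm_one_le` replaces the `C^{1,1}` bound `K` by the `C^{1,γ}` bound `3 * K`.
  have hC₀' : C₀ ≤ C₀ * 3 ^ SQGPatch.rateExponent k α γ :=
    le_mul_of_one_le_right hC₀.le (Real.one_le_rpow (by norm_num) hrate)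
  refine ⟨C₀ * 3 ^ SQGPatch.rateExponent k α γ, by positivity, ?_⟩
  intro T hT Ω x L hsol hL hac hadm
  have hmain : ∀ t ∈ Ico 0 T, SQGPatch.separation η Ω x L 0 * SQGPatch.expNeg (ENNReal.ofReal C₀ *
      ∫⁻ τ in Icc 0 t, SQGPatch.boundaryNorm k γ x τ ^ SQGPatch.rateExponent k α γ) ≤
      SQGPatch.separation η Ω x L t := fun t ht =>
    SQGPatch.separation_mul_expNeg_le hk12 hα₀ hγ hγ₁ hκα hrate hη hρ hC₀ hsol hL hac hadm
      (fun ht' hr₁ hA₁ hflat => hC hsol ht' rfl hr₁ hA₁ hflat) ht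
  refine ⟨fun t ht => ?_, ?_, ?_⟩
  · refine le_trans ?_ (hmain t ht)
    gcongr
    refine SQGPatch.expNeg_antitone ?_
    gcongr
  -- For every `t < T` the integral over `[0, t]` is at most the one over `[0, T)`, so the bound
  -- with the full integral holds at all times and passes to the lower limit.
  · refine le_liminf_of_le (by isBoundedDefault) ?_
    filter_upwards [Ico_mem_nhdsLT hT] with t ht
    refine le_trans ?_ (hmain t ht)
    gcongr
    refine SQGPatch.expNeg_antitone ?_
    gcongr
    exact ht.2
  · intro hα K hK hbound t ht
    have hk1 : k = 1 := by
      have h : k ≤ 1 := by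
        rw [hk]
        exact Nat.ceil_le.mpr (by push_cast; linarith)
      omega
    subst hk1
    rcases Nat.eq_zero_or_pos N with rfl | hN
    · rw [SQGPatch.separation_eq_top x Ω L t]
      exact le_top
    have hp := hsol.toIsPatchSolution
    -- The unit tangent contributes at least 1 to the norm.
    have hK1 : 1 ≤ K := ENNReal.one_le_ofReal.mp
      ((hp.one_le_boundaryNorm le_rfl ht ⟨0, hN⟩).trans (hbound t ht))
    refine le_trans ?_ (hmain t ht)
    gcongr
    rw [mul_assoc C₀, ← Real.mul_rpow (by norm_num) hK.le]
    refine SQGPatch.ofReal_exp_le_expNeg hC₀.le (by positivity) ht.1 hrate fun τ hτ => ?_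
    have hτT : τ ∈ Ico 0 T := ⟨hτ.1, hτ.2.trans_lt ht.2⟩
    exact SQGPatch.boundaryNorm_one_le hγ hγ₁ (fun i => (hp.param i τ hτT).unit_speed) hK1
      (hbound τ hτT)
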